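/- **Proposition (Second variation formula).** Let $(M^n,g)$ be a compact Riemannian manifold (smooth, Hausdorff, without boundary) with Riemannian measure $dv$ and Levi-Civita connection $\nabla$, and let $z$ be a square integrable (measurable) differential $k$-form on $M$, $\|z\|^2=\int_M|z|^2\,dv$. Conventions: for a pointwise orthonormal frame $\{v_j\}$ with dual coframe $\{\omega^j\}$ put $c(\omega^j)=e(\omega^j)-i_{v_j}$ and $\hat c(\omega^j)=e(\omega^j)+i_{v_j}$, where $e$ is exterior and $i$ is interior multiplication. For a vector field $X$ let $A$ and $B$ be the skew and the symmetric summand of the endomorphism $\nabla X\colon v\mapsto\nabla_vX$, with components $B^j_m=\langle v_j,Bv_m\rangle$ and $X^kB^j_{m;k}=\langle v_j,(\nabla_XB)v_m\rangle$. Let $R(a,b,c,d)=\langle R(a,b)c,d\rangle$ with $R(U,V)W=\nabla_U\nabla_VW-\nabla_V\nabla_UW-\nabla_{[U,V]}W$, so that $R(a,b,b,a)$ is a sectional curvature for orthonormal $a,b$. Repeated indices are summed. (I) Suppose that for every gradient field $X=\nabla f$, $f\in C^\infty(M)$, with flow $\phi_t$, the function $t\mapsto\|\phi_t^*z\|^2$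 has a local minimum at $t=0$. Then for every gradient field $X$ the integrands below are integrable and $$0\le\Big\langle z,\Big(-X^kB^j_{m;k}\,c(\omega^j)\hat c(\omega^m)+\big(\textstyle\sum_{i,m}B^i_m\,c(\omega^i)\hat c(\omega^m)\big)^2\Big)z\Big\rangle_{L^2},$$ $$0\le\Big\langle z,\Big(\big[(A^2+B^2)^j_m+R(X,v_m,v_j,X)\big]c(\omega^j)\hat c(\omega^m)+\big(\textstyle\sum_{i,m}B^i_m\,c(\omega^i)\hat c(\omega^m)\big)^2\Big)z\Big\rangle_{L^2}.$$ Moreover, for every Killing field $X$ (a smooth vector field with $B=0$) the second inequality is an equality. If the frame is chosen such that $\langle i_{v_j}z,i_{v_m}z\rangle=0$ at every point for $j\ne m$, this equality reads $$0=\int_M\sum_j\big(|\nabla_{v_j}X|^2-R(X,v_j,v_j,X)\big)\big(2|i_{v_j}z|^2-|z|^2\big)\,dv .$$ (II) This generalizes the integral Bochner formula for Killing fields: if $k=n$ and $|z|=1$ everywhere (for example, if $z$ is the volume form of an oriented $M$), then the hypothesis of (I) holds, and for every Killing field $X$ $$0=\int_M\sum_j\big(|\nabla_{v_j}X|^2-R(X,v_j,v_j,X)\big)\,dv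 .$$ -/

import Mathlib

open scoped Manifold ContDiff Bundle Topology
open MeasureTheory Bundle

noncomputable section

namespace SecondVariation

section Forms

variable {V : Type*} [NormedAddCommGroup V] [InnerProductSpace ℝ V]

/-- Alternating forms of all degrees on `V`; `a k` is the component of degree `k`. -/
abbrev Forms (V : Type*) [NormedAddCommGroup V] [InnerProductSpace ℝ V] : Type _ :=
  ∀ k : ℕ, V [⋀^Fin k]→ₗ[ℝ] ℝ

/-- A form of degree `k`, regarded as an element of the space of forms of all degrees. -/
def ofDegree {k : ℕ} (α : V [⋀^Fin k]→ₗ[ℝ] ℝ) : Forms V := Pi.single k α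

/-- Exterior multiplication `e(η)`:
`(η ∧ α)(v₀, …, v_k) = ∑ i, (-1)^i η(v_i) α(v₀, …, v_{i-1}, v_{i+1}, …, v_k)`. -/
def extMul (η : V →ₗ[ℝ] ℝ) : Module.End ℝ (Forms V) :=
  LinearMap.pi fun k => match k with
    | 0 => 0
    | k + 1 => AlternatingMap.alternatizeUncurryFinLM ∘ₗ LinearMap.smulRightₗ η ∘ₗ LinearMap.proj k

/-- Interior multiplication `i_v`: `(i_v α)(v₁, …, v_k) = α(v, v₁, …, v_k)`. -/
def intMul (v : V) : Module.End ℝ (Forms V) :=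
  LinearMap.pi fun k =>
    LinearMap.applyₗ v ∘ₗ AlternatingMap.curryLeftLinearMap ∘ₗ LinearMap.proj (k + 1)

/-- Clifford multiplication `c(ω) = e(ω) - i_v` by the covector `ω = ⟨v, ·⟩`. -/
def cliff (v : V) : Module.End ℝ (Forms V) := extMul (innerₛₗ ℝ v) - intMul v

/-- `ĉ(ω) = e(ω) + i_v` for the covector `ω = ⟨v, ·⟩`. -/
def cliffHat (v : V) : Module.End ℝ (Forms V) := extMul (innerₛₗ ℝ v) + intMul v

/-- The operator `∑ j m, S j m c(ω^j) ĉ(ω^m)`, for the coframe `ω` dual to the orthonormal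
frame `v`. -/
def cliffSum {n : ℕ} (v : OrthonormalBasis (Fin n) ℝ V) (S : Fin n → Fin n → ℝ) :
    Module.End ℝ (Forms V) :=
  ∑ j, ∑ m, S j m • (cliff (v j) * cliffHat (v m))

variable [FiniteDimensional ℝ V]

/-- The inner product on forms of degree `k` that is induced by the inner product of `V`: the sum
of `α(e_I) β(e_I)` over increasing `I`, written as a sum over all `I` divided by `k!`. -/
def formInner {k : ℕ} (α β : V [⋀^Fin k]→ₗ[ℝ] ℝ) : ℝ :=
  (1 / (k.factorial : ℝ)) * ∑ J : Fin k → Fin (Module.finrank ℝ V),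
    α (fun i => stdOrthonormalBasis ℝ V (J i)) * β (fun i => stdOrthonormalBasis ℝ V (J i))

/-- The inner product on forms of all degrees; different degrees are orthogonal, and forms of
degree greater than the dimension vanish. -/
def formsInner (a b : Forms V) : ℝ :=
  ∑ k ∈ Finset.range (Module.finrank ℝ V + 1), formInner (a k) (b k)

end Forms

section LeviCivita

variable {E : Type*} [NormedAddCommGroup E] [NormedSpace ℝ E]
  {H : Type*} [TopologicalSpace H] {I : ModelWithCorners ℝ E H}
  {M : Type*} [TopologicalSpace M] [ChartedSpace H M]
  [RiemannianBundle (fun x : M => TangentSpace I x)]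

/-- The Koszul expression, equal to `2 ⟨∇_V X, W⟩` for the Levi-Civita connection. -/
def koszul (X V W : ∀ x : M, TangentSpace I x) (x : M) : ℝ :=
  mvfderiv I (fun y => inner ℝ (X y) (W y)) x (V x)
    + mvfderiv I (fun y => inner ℝ (W y) (V y)) x (X x)
    - mvfderiv I (fun y => inner ℝ (V y) (X y)) x (W x)
    + inner ℝ (VectorField.mlieBracket I V X x) (W x)
    - inner ℝ (VectorField.mlieBracket I X W x) (V x)
    + inner ℝ (VectorField.mlieBracket I W V x) (X x)

variable {X Y V W : ∀ x : M, TangentSpace I x} {f : M → ℝ} {x : M}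

lemma koszul_sub_swap : koszul V X W x - koszul X V W x = 
   2 * inner ℝ (VectorField.mlieBracket I X V x) (W x) := by
  have e1 : ∀ A B : ∀ x : M, TangentSpace I x,
      (fun y => (inner ℝ (A y) (B y) : ℝ)) = fun y => inner ℝ (B y) (A y) :=
    fun A B => funext fun y => real_inner_comm _ _
  rw [koszul, koszul, e1 V X, e1 W X, e1 W V,
    VectorField.mlieBracket_swap_apply (V := V) (W := X),
    VectorField.mlieBracket_swap_apply (V := V) (W := W),
    VectorField.mlieBracket_swap_apply (V := W) (W := X)]
  simp only [inner_neg_left]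
  ring

lemma koszul_add_swap : koszul X V W x + koszul W V X x = 
   2 * mvfderiv I (fun y => inner ℝ (X y) (W y)) x (V x) := by
  have e1 : ∀ A B : ∀ x : M, TangentSpace I x,
      (fun y => (inner ℝ (A y) (B y) : ℝ)) = fun y => inner ℝ (B y) (A y) :=
    fun A B => funext fun y => real_inner_comm _ _
  rw [koszul, koszul, e1 V X, e1 W X, e1 W V,
    VectorField.mlieBracket_swap_apply (V := V) (W := X),
    VectorField.mlieBracket_swap_apply (V := V) (W := W),
    VectorField.mlieBracket_swap_apply (V := W) (W := X)]
  simp only [inner_neg_left]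
  ring

instance instFiniteDimensionalTangentSpace [FiniteDimensional ℝ E] (x : M) :
    FiniteDimensional ℝ (TangentSpace I x) :=
  inferInstanceAs (FiniteDimensional ℝ E)

variable [IsManifold I ∞ M]
  [IsContMDiffRiemannianBundle I ∞ E (fun x : M => TangentSpace I x)]

lemma mdifferentiableAt_inner (hX : MDiffAt (T% X) x) (hW : MDiffAt (T% W) x) :
    MDiffAt (fun y => (inner ℝ (X y) (W y) : ℝ)) x :=
  MDifferentiableAt.inner_bundle (E := fun x : M => TangentSpace I x) (F := E) (b := fun y => y)
    hX hW

lemma mvfderiv_inner_smul_left (hf : MDiffAt f x) (hX : MDiffAt (T% X) x)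
    (hW : MDiffAt (T% W) x) (v : TangentSpace I x) :
    mvfderiv I (fun y => inner ℝ ((f • X) y) (W y)) x v =
      f x * mvfderiv I (fun y => inner ℝ (X y) (W y)) x v + inner ℝ (X x) (W x) * mvfderiv I f x v := by
  have h := mvfderiv_fun_mul hf (mdifferentiableAt_inner hX hW)
  have e : (fun y => (inner ℝ ((f • X) y) (W y) : ℝ)) = fun y => f y * inner ℝ (X y) (W y) :=
    funext fun y => by simp [inner_smul_left]
  rw [e, h]; simp

lemma mvfderiv_inner_smul_right (hf : MDiffAt f x) (hX : MDiffAt (T% X) x)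
    (hW : MDiffAt (T% W) x) (v : TangentSpace I x) :
    mvfderiv I (fun y => inner ℝ (X y) ((f • W) y)) x v =
      f x * mvfderiv I (fun y => inner ℝ (X y) (W y)) x v + inner ℝ (X x) (W x) * mvfderiv I f x v := by
  have h := mvfderiv_fun_mul hf (mdifferentiableAt_inner hX hW)
  have e : (fun y => (inner ℝ (X y) ((f • W) y) : ℝ)) = fun y => f y * inner ℝ (X y) (W y) :=
    funext fun y => by simp [inner_smul_right]
  rw [e, h]; simp

lemma mvfderiv_inner_add_left (hX : MDiffAt (T% X) x) (hY : MDiffAt (T% Y) x)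
    (hW : MDiffAt (T% W) x) (v : TangentSpace I x) :
    mvfderiv I (fun y => inner ℝ ((X + Y) y) (W y)) x v =
      mvfderiv I (fun y => inner ℝ (X y) (W y)) x v
        + mvfderiv I (fun y => inner ℝ (Y y) (W y)) x v := by
  have h := mvfderiv_fun_add (mdifferentiableAt_inner hX hW) (mdifferentiableAt_inner hY hW)
  have e : (fun y => (inner ℝ ((X + Y) y) (W y) : ℝ)) =
      fun y => inner ℝ (X y) (W y) + inner ℝ (Y y) (W y) :=
    funext fun y => by simp [inner_add_left]
  rw [e, h]; simp

lemma mvfderiv_inner_add_right (hX : MDiffAt (T% X) x) (hY : MDiffAt (T% Y) x)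
    (hW : MDiffAt (T% W) x) (v : TangentSpace I x) :
    mvfderiv I (fun y => inner ℝ (W y) ((X + Y) y)) x v =
      mvfderiv I (fun y => inner ℝ (W y) (X y)) x v
        + mvfderiv I (fun y => inner ℝ (W y) (Y y)) x v := by
  have h := mvfderiv_fun_add (mdifferentiableAt_inner hW hX) (mdifferentiableAt_inner hW hY)
  have e : (fun y => (inner ℝ (W y) ((X + Y) y) : ℝ)) =
      fun y => inner ℝ (W y) (X y) + inner ℝ (W y) (Y y) :=
    funext fun y => by simp [inner_add_right]
  rw [e, h]; simp

variable [FiniteDimensional ℝ E]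

lemma koszul_smul_third
    (hf : MDiffAt f x) (hX : MDiffAt (T% X) x) (hV : MDiffAt (T% V) x) (hW : MDiffAt (T% W) x) :
    koszul X V (f • W) x = f x * koszul X V W x := by
  rw [koszul, koszul, mvfderiv_inner_smul_left hf hW hV, mvfderiv_inner_smul_right hf hX hW,
    VectorField.mlieBracket_smul_right hf hW, VectorField.mlieBracket_smul_left hf hW]
  simp only [Pi.smul_apply', inner_smul_left, inner_smul_right, map_smul, inner_add_left,
    conj_trivial, smul_eq_mul, inner_neg_left, neg_smul]
  rw [real_inner_comm (X x) (W x)]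
  ring

lemma koszul_smul_second
    (hf : MDiffAt f x) (hX : MDiffAt (T% X) x) (hV : MDiffAt (T% V) x) (hW : MDiffAt (T% W) x) :
    koszul X (f • V) W x = f x * koszul X V W x := by
  rw [koszul, koszul, mvfderiv_inner_smul_left hf hV hX, mvfderiv_inner_smul_right hf hW hV,
    VectorField.mlieBracket_smul_right hf hV, VectorField.mlieBracket_smul_left hf hV]
  simp only [Pi.smul_apply', inner_smul_left, inner_smul_right, map_smul, inner_add_left,
    conj_trivial, smul_eq_mul, inner_neg_left, neg_smul]
  rw [real_inner_comm (W x) (V x)]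
  ring

lemma koszul_smul_first
    (hf : MDiffAt f x) (hX : MDiffAt (T% X) x) (hV : MDiffAt (T% V) x) (hW : MDiffAt (T% W) x) :
    koszul (f • X) V W x =
      f x * koszul X V W x + 2 * (mvfderiv I f x (V x) * inner ℝ (X x) (W x)) := by
  rw [koszul, koszul, mvfderiv_inner_smul_left hf hX hW, mvfderiv_inner_smul_right hf hV hX,
    VectorField.mlieBracket_smul_right hf hX, VectorField.mlieBracket_smul_left hf hX]
  simp only [Pi.smul_apply', inner_smul_left, inner_smul_right, map_smul, inner_add_left,
    conj_trivial, smul_eq_mul, inner_neg_left, neg_smul]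
  rw [real_inner_comm (V x) (X x)]
  ring

lemma koszul_add_first (hX : MDiffAt (T% X) x) (hY : MDiffAt (T% Y) x)
    (hV : MDiffAt (T% V) x) (hW : MDiffAt (T% W) x) :
    koszul (X + Y) V W x = koszul X V W x + koszul Y V W x := by
  rw [koszul, koszul, koszul, mvfderiv_inner_add_left hX hY hW, mvfderiv_inner_add_right hX hY hV,
    VectorField.mlieBracket_add_right hX hY, VectorField.mlieBracket_add_left hX hY]
  simp only [Pi.add_apply, inner_add_left, inner_add_right, map_add]
  ring

lemma koszul_add_second (hX : MDiffAt (T% X) x) (hY : MDiffAt (T% Y) x)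
    (hV : MDiffAt (T% V) x) (hW : MDiffAt (T% W) x) :
    koszul V (X + Y) W x = koszul V X W x + koszul V Y W x := by
  rw [koszul, koszul, koszul, mvfderiv_inner_add_left hX hY hV, mvfderiv_inner_add_right hX hY hW,
    VectorField.mlieBracket_add_right hX hY, VectorField.mlieBracket_add_left hX hY]
  simp only [Pi.add_apply, inner_add_left, inner_add_right, map_add]
  ring

lemma koszul_add_third (hX : MDiffAt (T% X) x) (hY : MDiffAt (T% Y) x)
    (hV : MDiffAt (T% V) x) (hW : MDiffAt (T% W) x) :
    koszul V W (X + Y) x = koszul V W X x + koszul V W Y x := by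
  rw [koszul, koszul, koszul, mvfderiv_inner_add_left hX hY hW, mvfderiv_inner_add_right hX hY hV,
    VectorField.mlieBracket_add_right hX hY, VectorField.mlieBracket_add_left hX hY]
  simp only [Pi.add_apply, inner_add_left, inner_add_right, map_add]
  ring

lemma tensorialAt_koszul_second (hX : MDiffAt (T% X) x) (hW : MDiffAt (T% W) x) :
    TensorialAt I E (fun V => koszul X V W x) x where
  smul hf hV := koszul_smul_second hf hX hV hW
  add hV hV' := koszul_add_second hV hV' hX hW

lemma tensorialAt_koszul_third (hX : MDiffAt (T% X) x) (hV : MDiffAt (T% V) x) :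
    TensorialAt I E (fun W => koszul X V W x) x where
  smul hf hW := koszul_smul_third hf hX hV hW
  add hW hW' := koszul_add_third hW hW' hX hV

open Classical in
/-- The bilinear form `(v, w) ↦ 2 ⟨∇_v X, w⟩` on `T_x M`
(the zero form if `X` is not differentiable at `x`). -/
def koszulForm (X : ∀ x : M, TangentSpace I x) (x : M) :
    TangentSpace I x →L[ℝ] TangentSpace I x →L[ℝ] ℝ :=
  if hX : MDiffAt (T% X) x then
    TensorialAt.mkHom₂ (fun V W => koszul X V W x) x
      (fun _ hW => tensorialAt_koszul_second hX hW) (fun _ hV => tensorialAt_koszul_third hX hV)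
  else 0

lemma koszulForm_apply (hX : MDiffAt (T% X) x) (hV : MDiffAt (T% V) x) (hW : MDiffAt (T% W) x) :
    koszulForm X x (V x) (W x) = koszul X V W x := by
  rw [koszulForm, dif_pos hX]
  exact TensorialAt.mkHom₂_apply _ _ hV hW

/-- `∇_v X` at `x`: the vector that represents half of the Koszul form. -/
def leviCivitaFun (X : ∀ x : M, TangentSpace I x) (x : M) :
    TangentSpace I x →L[ℝ] TangentSpace I x :=
  LinearMap.toContinuousLinearMap
    (∑ j, ((1 / 2 : ℝ) • ((koszulForm X x).flip
      (stdOrthonormalBasis ℝ (TangentSpace I x) j)).toLinearMap).smulRight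
        (stdOrthonormalBasis ℝ (TangentSpace I x) j))

lemma inner_leviCivitaFun (X : ∀ x : M, TangentSpace I x) (x : M) (v w : TangentSpace I x) :
    inner ℝ (leviCivitaFun X x v) w = (1 / 2 : ℝ) * koszulForm X x v w := by
  have h := (stdOrthonormalBasis ℝ (TangentSpace I x)).sum_repr w
  conv_rhs => rw [← h]
  simp [leviCivitaFun, sum_inner, inner_smul_left, Finset.mul_sum, 
    OrthonormalBasis.repr_apply_apply]
  exact Finset.sum_congr rfl fun j _ => by ring


/-- The Levi-Civita connection of `M`. -/
def leviCivita : CovariantDerivative I E (TangentSpace I : M → Type _) where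
  toFun := leviCivitaFun
  isCovariantDerivativeOnUniv :=
    { add := by
        intro X Y x hX hY _
        ext1 v
        refine ext_inner_right ℝ fun w => ?_
        have hv : MDiffAt (T% (FiberBundle.extend E v)) x := FiberBundle.mdifferentiableAt_extend ..
        have hw : MDiffAt (T% (FiberBundle.extend E w)) x := FiberBundle.mdifferentiableAt_extend ..
        have h := koszul_add_first hX hY hv hw
        rw [← koszulForm_apply (mdifferentiableAt_add_section hX hY) hv hw,
          ← koszulForm_apply hX hv hw, ← koszulForm_apply hY hv hw,
          FiberBundle.extend_apply_self, FiberBundle.extend_apply_self] at h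
        rw [add_apply, inner_add_left, inner_leviCivitaFun, inner_leviCivitaFun,
          inner_leviCivitaFun, h]
        ring
      leibniz := by
        intro X f x hX hf _
        ext1 v
        refine ext_inner_right ℝ fun w => ?_
        have hv : MDiffAt (T% (FiberBundle.extend E v)) x := FiberBundle.mdifferentiableAt_extend ..
        have hw : MDiffAt (T% (FiberBundle.extend E w)) x := FiberBundle.mdifferentiableAt_extend ..
        have h := koszul_smul_first hf hX hv hw
        rw [← koszulForm_apply (hf.smul_section hX) hv hw,
          ← koszulForm_apply hX hv hw,
          FiberBundle.extend_apply_self, FiberBundle.extend_apply_self] at h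
        rw [add_apply, inner_add_left, inner_leviCivitaFun, h, smul_apply, inner_smul_left,
          inner_leviCivitaFun, ContinuousLinearMap.smulRight_apply, inner_smul_left]
        simp only [conj_trivial]
        ring }

lemma inner_leviCivita (hX : MDiffAt (T% X) x) (hV : MDiffAt (T% V) x) (hW : MDiffAt (T% W) x) :
    inner ℝ (leviCivita X x (V x)) (W x) = (1 / 2 : ℝ) * koszul X V W x := by
  rw [← koszulForm_apply hX hV hW]
  exact inner_leviCivitaFun X x (V x) (W x)

/-- The Levi-Civita connection is compatible with the metric. -/
theorem leviCivita_metric (hX : MDiffAt (T% X) x) (hW : MDiffAt (T% W) x)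
    (v : TangentSpace I x) :
    mvfderiv I (fun y => inner ℝ (X y) (W y)) x v =
      inner ℝ (leviCivita X x v) (W x) + inner ℝ (X x) (leviCivita W x v) := by
  have hv : MDiffAt (T% (FiberBundle.extend E v)) x := FiberBundle.mdifferentiableAt_extend ..
  have h1 := inner_leviCivita hX hv hW
  have h2 := inner_leviCivita hW hv hX
  have h := koszul_add_swap (X := X) (V := FiberBundle.extend E v) (W := W) (x := x)
  rw [FiberBundle.extend_apply_self] at h h1 h2
  rw [real_inner_comm (leviCivita W x v) (X x), h2, h1]
  linarith

/-- The Levi-Civita connection is torsion-free. -/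
theorem leviCivita_torsion :
    (leviCivita : CovariantDerivative I E (TangentSpace I : M → Type _)).torsion = 0 := by
  rw [CovariantDerivative.torsion_eq_zero_iff]
  intro X Y x hX hY
  refine ext_inner_right ℝ fun w => ?_
  have hw : MDiffAt (T% (FiberBundle.extend E w)) x := FiberBundle.mdifferentiableAt_extend ..
  have h1 := inner_leviCivita hX hY hw
  have h2 := inner_leviCivita hY hX hw
  have h := koszul_sub_swap (X := X) (V := Y) (W := FiberBundle.extend E w) (x := x)
  rw [FiberBundle.extend_apply_self] at h h1 h2
  rw [inner_sub_left, h1, h2]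
  linarith

end LeviCivita

section Geometry

variable {n : ℕ} {M : Type*} [TopologicalSpace M] [ChartedSpace (EuclideanSpace ℝ (Fin n)) M]
  [IsManifold (𝓡 n) ∞ M]
  [RiemannianBundle (fun x : M => TangentSpace (𝓡 n) x)]

/-- Smooth vector fields. -/
def IsSmoothField (X : ∀ x : M, TangentSpace (𝓡 n) x) : Prop :=
  ContMDiff (𝓡 n) (𝓡 n).tangent ∞ (fun x => (⟨x, X x⟩ : TangentBundle (𝓡 n) M))

/-- `X` is the gradient of a smooth function. -/
def IsGradientField (X : ∀ x : M, TangentSpace (𝓡 n) x) : Prop :=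
  ∃ f : M → ℝ, ContMDiff (𝓡 n) 𝓘(ℝ, ℝ) ∞ f ∧
    ∀ (x : M) (w : TangentSpace (𝓡 n) x), inner ℝ (X x) w = mvfderiv (𝓡 n) f x w

/-- `φ` is the flow of the vector field `X`. -/
def IsFlow (X : ∀ x : M, TangentSpace (𝓡 n) x) (φ : ℝ → M → M) : Prop :=
  (∀ x, φ 0 x = x) ∧ ∀ x, IsMIntegralCurve (I := 𝓡 n) (fun t => φ t x) X

/-- Differential forms of degree `k`, without regularity. -/
abbrev DiffForm (n k : ℕ) (M : Type*) [TopologicalSpace M]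
    [ChartedSpace (EuclideanSpace ℝ (Fin n)) M] : Type _ :=
  ∀ x : M, TangentSpace (𝓡 n) x [⋀^Fin k]→ₗ[ℝ] ℝ

/-- The pullback `φ^* z`. -/
def pullback {k : ℕ} (φ : M → M) (z : DiffForm n k M) : DiffForm n k M :=
  fun x => (z (φ x)).compLinearMap (mfderiv (𝓡 n) (𝓡 n) φ x).toLinearMap

/-- The coefficients `g_{ij}` of the metric in the chart at `p`, at the point of `M` with
coordinates `u`. -/
def gram (p : M) (u : EuclideanSpace ℝ (Fin n)) : Matrix (Fin n) (Fin n) ℝ :=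
  Matrix.of fun i j =>
    inner ℝ
      (mfderiv (𝓡 n) (𝓡 n) (chartAt (EuclideanSpace ℝ (Fin n)) p).symm u
        (EuclideanSpace.single i (1 : ℝ)))
      (mfderiv (𝓡 n) (𝓡 n) (chartAt (EuclideanSpace ℝ (Fin n)) p).symm u
        (EuclideanSpace.single j (1 : ℝ)))

/-- The measure `√(det g) du` on the domain of the chart at `p`, zero outside this domain. -/
def chartVolume [MeasurableSpace M] (p : M) : Measure M :=
  (((volume : Measure (EuclideanSpace ℝ (Fin n))).restrict
      (chartAt (EuclideanSpace ℝ (Fin n)) p).target).withDensity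
        fun u => ENNReal.ofReal (Real.sqrt (gram p u).det)).map
    (chartAt (EuclideanSpace ℝ (Fin n)) p).symm

/-- The Riemannian measure. The measures in the various charts are its restrictions to
the chart domains, and it is the least measure that dominates all of them. -/
def riemVolume (n : ℕ) (M : Type*) [TopologicalSpace M]
    [ChartedSpace (EuclideanSpace ℝ (Fin n)) M]
    [RiemannianBundle (fun x : M => TangentSpace (𝓡 n) x)] [MeasurableSpace M] : Measure M :=
  ⨆ p : M, chartVolume (n := n) p

/-- `z` is a measurable section (its contraction with smooth vector fields is measurable) and
square integrable. -/
def IsL2Form [MeasurableSpace M] {k : ℕ} (z : DiffForm n k M) : Prop :=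
  (∀ Y : Fin k → ∀ x : M, TangentSpace (𝓡 n) x, (∀ i, IsSmoothField (Y i)) →
      AEStronglyMeasurable (fun x => z x (fun i => Y i x)) (riemVolume n M)) ∧
    Integrable (fun x => formInner (z x) (z x)) (riemVolume n M)

/-- `‖z‖² = ∫ |z|² dv`. -/
def normSq [MeasurableSpace M] {k : ℕ} (z : DiffForm n k M) : ℝ :=
  ∫ x, formInner (z x) (z x) ∂(riemVolume n M)

/-- For every gradient field, with flow `φ`, the function `t ↦ ‖φ_t^* z‖²` has a local minimum
at `0`. -/
def IsGradientFlowMinimal [MeasurableSpace M] {k : ℕ} (z : DiffForm n k M) : Prop :=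
  ∀ X : ∀ x : M, TangentSpace (𝓡 n) x, IsGradientField X →
    ∀ φ : ℝ → M → M, IsFlow X φ → IsLocalMin (fun t => normSq (pullback (φ t) z)) 0

variable [IsContMDiffRiemannianBundle (𝓡 n) ∞ (EuclideanSpace ℝ (Fin n))
    (fun x : M => TangentSpace (𝓡 n) x)]

/-- `∇X` at `x`, the endomorphism `v ↦ ∇_v X`. -/
def nabla (X : ∀ x : M, TangentSpace (𝓡 n) x) (x : M) :
    TangentSpace (𝓡 n) x →ₗ[ℝ] TangentSpace (𝓡 n) x :=
  (leviCivita X x).toLinearMap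

/-- `A`, the skew summand of `∇X`. -/
def skewPart (X : ∀ x : M, TangentSpace (𝓡 n) x) (x : M) :
    TangentSpace (𝓡 n) x →ₗ[ℝ] TangentSpace (𝓡 n) x :=
  (1 / 2 : ℝ) • (nabla X x - LinearMap.adjoint (nabla X x))

/-- `B`, the symmetric summand of `∇X`. -/
def symPart (X : ∀ x : M, TangentSpace (𝓡 n) x) (x : M) :
    TangentSpace (𝓡 n) x →ₗ[ℝ] TangentSpace (𝓡 n) x :=
  (1 / 2 : ℝ) • (nabla X x + LinearMap.adjoint (nabla X x))

/-- `X` is a Killing field: smooth, with `∇X` skew, that is, `B = 0`. -/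
def IsKillingField (X : ∀ x : M, TangentSpace (𝓡 n) x) : Prop :=
  IsSmoothField X ∧ ∀ x, symPart X x = 0

/-- The covariant derivative `(∇_X T) w = ∇_X (T W) - T (∇_X W)` of a field `T` of endomorphisms,
where `W` is an extension of `w` to a vector field that is smooth near `x`. -/
def covDerivEnd (T : ∀ x : M, TangentSpace (𝓡 n) x →ₗ[ℝ] TangentSpace (𝓡 n) x)
    (X : ∀ x : M, TangentSpace (𝓡 n) x) (x : M) (w : TangentSpace (𝓡 n) x) :
    TangentSpace (𝓡 n) x :=
  leviCivita (fun y => T y (FiberBundle.extend (EuclideanSpace ℝ (Fin n)) w y)) x (X x)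
    - T x (leviCivita (FiberBundle.extend (EuclideanSpace ℝ (Fin n)) w) x (X x))

/-- `∇_U ∇_V W - ∇_V ∇_U W - ∇_{[U, V]} W` for vector fields. -/
def curvatureField (U V W : ∀ x : M, TangentSpace (𝓡 n) x) (x : M) : TangentSpace (𝓡 n) x :=
  leviCivita (fun y => leviCivita W y (V y)) x (U x)
    - leviCivita (fun y => leviCivita W y (U y)) x (V x)
    - leviCivita W x (VectorField.mlieBracket (𝓡 n) U V x)

/-- The curvature tensor `R(a, b, c, d) = ⟨R(a, b) c, d⟩`, computed with extensions of the
vectors to vector fields that are smooth near `x`. For orthonormal `a, b` the number `R(a, b, b, a)`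
is the sectional curvature of the plane that they span. -/
def curvature (x : M) (a b c d : TangentSpace (𝓡 n) x) : ℝ :=
  inner ℝ
    (curvatureField (FiberBundle.extend (EuclideanSpace ℝ (Fin n)) a)
      (FiberBundle.extend (EuclideanSpace ℝ (Fin n)) b)
      (FiberBundle.extend (EuclideanSpace ℝ (Fin n)) c) x) d

/-- `∑ B^i_m c(ω^i) ĉ(ω^m)` at `x`. -/
def symOp (X : ∀ x : M, TangentSpace (𝓡 n) x) (x : M)
    (v : OrthonormalBasis (Fin n) ℝ (TangentSpace (𝓡 n) x)) :
    Module.End ℝ (Forms (TangentSpace (𝓡 n) x)) :=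
  cliffSum v fun i m => inner ℝ (v i) (symPart X x (v m))

/-- `-X^k B^j_{m;k} c(ω^j) ĉ(ω^m) + (∑ B^i_m c(ω^i) ĉ(ω^m))²` at `x`. -/
def secondVarOp₁ (X : ∀ x : M, TangentSpace (𝓡 n) x) (x : M)
    (v : OrthonormalBasis (Fin n) ℝ (TangentSpace (𝓡 n) x)) :
    Module.End ℝ (Forms (TangentSpace (𝓡 n) x)) :=
  cliffSum v (fun j m => -inner ℝ (v j) (covDerivEnd (symPart X) X x (v m)))
    + symOp X x v ^ 2

/-- `((A² + B²)^j_m + R(X, v_m, v_j, X)) c(ω^j) ĉ(ω^m) + (∑ B^i_m c(ω^i) ĉ(ω^m))²` at `x`. -/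
def secondVarOp₂ (X : ∀ x : M, TangentSpace (𝓡 n) x) (x : M)
    (v : OrthonormalBasis (Fin n) ℝ (TangentSpace (𝓡 n) x)) :
    Module.End ℝ (Forms (TangentSpace (𝓡 n) x)) :=
  cliffSum v (fun j m =>
      inner ℝ (v j) ((skewPart X x ^ 2 + symPart X x ^ 2) (v m))
        + curvature x (X x) (v m) (v j) (X x))
    + symOp X x v ^ 2

/-- The function `x ↦ ⟨z, T z⟩(x)`, whose integral is `⟨z, T z⟩_{L²}`, for a field `T` of operators
on forms. -/
def density {k : ℕ} (z : DiffForm n k M)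
    (T : ∀ x : M, Module.End ℝ (Forms (TangentSpace (𝓡 n) x))) (x : M) : ℝ :=
  formsInner (ofDegree (z x)) (T x (ofDegree (z x)))

/-- `⟨i_v z, i_w z⟩` at `x`. -/
def intInner {k : ℕ} (z : DiffForm n k M) (x : M) (v w : TangentSpace (𝓡 n) x) : ℝ :=
  formsInner (intMul v (ofDegree (z x))) (intMul w (ofDegree (z x)))

/-- `|∇_v X|² - R(X, v, v, X)` at `x`. -/
def bochnerTerm (X : ∀ x : M, TangentSpace (𝓡 n) x) (x : M) (v : TangentSpace (𝓡 n) x) : ℝ :=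
  ‖nabla X x v‖ ^ 2 - curvature x (X x) v v (X x)

end Geometry

end SecondVariation

end

open SecondVariation

open scoped Manifold ContDiff Bundle Topology
open MeasureTheory Bundle

noncomputable section

set_option linter.unusedSectionVars false

/-! The form `z` is only square integrable, so `φ_t^* z` cannot be differentiated in `t` at a fixed
point. The substitution `x = φ_t y` removes this difficulty: `‖φ_{-t}^* z‖²` is the integral over
`y` of the function `transported`, that is, the Jacobian of `φ_t` at `y` times `|φ_{-t}^* z|²` at
`φ_t y`, and this involves `z` only through its value at `y`. In an orthonormal frame at `y` it
equals `√(det Γ(t)) ⟨Γ(t)⁻¹ ζ, ζ⟩`, where `ζ` are the fixed components of `z y` and `Γ(t)` is the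
Gram matrix of the differential of `φ_t`, i.e. the pulled back metric (`transported_mul_sqrt_det`).
It is smooth in `t` however rough `z` may be.

The Lie derivative of the metric along `X` is `2B`, so `Γ'(0) = 2B`; for a gradient field `∇X = B`,
and `Γ''(0) = 2 ∇_X B + 4 B²`. Matrix calculus in a frame of eigenvectors of `B`
(`hasDerivAt_sqrt_det_mul_gramForm`) turns these into the operators of the theorem: the first
derivative is `-⟨z, (∑ B c ĉ) z⟩`, the second is the quadratic form of `secondVarOp₁`
(`LocalFlow.transported_derivatives`). The third derivative is at most a constant times `|z|²`, by
compactness in the space of pairs (point, differential). Hence the Taylor expansion may be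
integrated (`exists_expansion`, `integrable_of_expansion`), and a local minimum at `0` forces the
first variation to vanish and the second to be nonnegative (`exists_variation`).

The second inequality needs no second computation. A quadratic form sees only the symmetrized
coefficients, and after symmetrization `curvature_eq` shows that the two integrands differ by the
first variation integrand along `∇_X X` (`density_secondVarOp₂`). If `∇X` is symmetric, `∇_X X` is
the gradient of `|X|²/2`; if `∇X` is skew, it is the gradient of `-|X|²/2`. In both cases it is a
gradient field, so this difference integrates to zero. For a Killing field `secondVarOp₁` vanishes
and nothing else is left, which gives equality.

In top degree with `|z| = 1` the transported density is `1/J`, where `J` is the Jacobian. From `1/J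
≥ 2 - J` and the invariance of the total volume it follows that `z` is minimal; the contractions
`i_{v_j} z` are orthonormal, so every weight `2|i_{v_j} z|² - |z|²` is `1`. -/

namespace SecondVariation

/-! ### Exterior and interior multiplication; the norm of a form in an arbitrary basis -/

section FormAlgebra

variable {V : Type*} [NormedAddCommGroup V] [InnerProductSpace ℝ V]

lemma extMul_apply_zero (η : V →ₗ[ℝ] ℝ) (a : Forms V) : extMul η a 0 = 0 := rfl

lemma extMul_apply_succ (η : V →ₗ[ℝ] ℝ) (a : Forms V) (k : ℕ) (u : Fin (k + 1) → V) :
    extMul η a (k + 1) u =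
      ∑ i : Fin (k + 1), (-1 : ℝ) ^ (i : ℕ) * (η (u i) * a k (i.removeNth u)) := by
  have h : extMul η a (k + 1) =
      AlternatingMap.alternatizeUncurryFin (LinearMap.smulRightₗ η (a k)) := rfl
  rw [h, AlternatingMap.alternatizeUncurryFin_apply]
  refine Finset.sum_congr rfl fun i _ => ?_
  simp [zsmul_eq_mul]

lemma intMul_apply (v : V) (a : Forms V) (k : ℕ) (u : Fin k → V) :
    intMul v a k u = a (k + 1) (Matrix.vecCons v u) := rfl

/-- Moving the inserted vector from the front to slot `i` costs exactly the sign that `extMul`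
carries, so the two signs cancel. The equation `k = j + 1` and the `HEq`s allow for a degree that is
a successor only propositionally. -/
lemma alternating_map_cons_removeNth {k : ℕ} (α : V [⋀^Fin k]→ₗ[ℝ] ℝ) (i : Fin k)
    (j : ℕ) (hj : k = j + 1) (w : V) (u : Fin k → V) (β : V [⋀^Fin (j + 1)]→ₗ[ℝ] ℝ)
    (hβ : HEq α β) (u' : Fin (j + 1) → V) (hu : HEq u u') (i' : Fin (j + 1)) (hi : HEq i i') :
    (-1 : ℝ) ^ (i' : ℕ) * β (Matrix.vecCons w (i'.removeNth u')) =
      α (Function.update u i w) := by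
  subst hj
  obtain rfl := eq_of_heq hβ
  obtain rfl := eq_of_heq hu
  obtain rfl := eq_of_heq hi
  have h := AlternatingMap.map_insertNth α i w (i.removeNth u)
  have h2 : i.insertNth w (i.removeNth u) = Function.update u i w := by
    simp
  rw [h2] at h
  rw [h]
  simp [zsmul_eq_mul]

/-- The composite is the derivation extending the rank one endomorphism `η ⊗ w`: each argument in
turn is replaced by `w`, and no signs remain. -/
lemma extMul_intMul_apply (η : V →ₗ[ℝ] ℝ) (w : V) (a : Forms V) (k : ℕ) (u : Fin k → V) :
    extMul η (intMul w a) k u = ∑ i, η (u i) * a k (Function.update u i w) := by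
  cases k with
  | zero => simp [extMul_apply_zero]
  | succ k =>
    rw [extMul_apply_succ]
    refine Finset.sum_congr rfl fun i _ => ?_
    rw [intMul_apply, ← alternating_map_cons_removeNth (a (k + 1)) i k rfl w u (a (k + 1)) HEq.rfl u
      HEq.rfl i HEq.rfl]
    ring

/-- The term `i = 0` of the alternating sum evaluates `η` on `w`; the other terms form the same
derivation with the opposite sign. Together with `extMul_intMul_apply` this is the anticommutation
relation of `e` and `i`. -/
lemma intMul_extMul_apply (η : V →ₗ[ℝ] ℝ) (w : V) (a : Forms V) (k : ℕ) (u : Fin k → V) :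
    intMul w (extMul η a) k u =
      η w * a k u - ∑ i, η (u i) * a k (Function.update u i w) := by
  rw [intMul_apply, extMul_apply_succ, Fin.sum_univ_succ, sub_eq_add_neg, ← Finset.sum_neg_distrib]
  congr 1
  · have h : (0 : Fin (k + 1)).removeNth (Matrix.vecCons w u) = u := by
      ext1 i; simp [Fin.removeNth]
    rw [h]; simp
  · refine Finset.sum_congr rfl fun i _ => ?_
    cases k with
    | zero => exact i.elim0
    | succ k =>
      have h : i.succ.removeNth (Matrix.vecCons w u) = Matrix.vecCons w (i.removeNth u) := by
        ext1 j
        refine Fin.cases ?_ (fun j => ?_) j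
        · simp [Fin.removeNth]
        · simp [Fin.removeNth]
      rw [h, ← alternating_map_cons_removeNth (a (k + 1)) i k rfl w u (a (k + 1)) HEq.rfl u
        HEq.rfl i HEq.rfl]
      simp only [Matrix.cons_val_succ, Fin.val_succ]
      ring

lemma intMul_intMul_self (w : V) (a : Forms V) : intMul w (intMul w a) = 0 := by
  funext k
  ext u
  rw [intMul_apply, intMul_apply]
  exact (a (k + 2)).map_eq_zero_of_eq _ (i := 0) (j := 1) rfl (by simp)

lemma extMul_extMul_apply_eq_zero (η θ : V →ₗ[ℝ] ℝ) (a : Forms V) (k : ℕ)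
    (h : ∀ j, j + 2 = k → a j = 0) : extMul η (extMul θ a) k = 0 := by
  ext u
  match k, h with
  | 0, _ => simp [extMul_apply_zero]
  | 1, _ => rw [extMul_apply_succ]; simp [extMul_apply_zero]
  | k + 2, h =>
    rw [extMul_apply_succ]
    refine Finset.sum_eq_zero fun i _ => ?_
    rw [extMul_apply_succ, h k rfl]
    simp

/-- Of the four products, `e e` reads only the component of degree `k - 2`, which `h` kills, while
`e i` and `i e` preserve the degree. The term `i i` reads degree `k + 2` and is kept, because `a`
need not be homogeneous. -/
lemma cliff_mul_cliffHat_apply (v w : V) (a : Forms V) (k : ℕ)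
    (h : ∀ j, j + 2 = k → a j = 0) (u : Fin k → V) :
    (cliff v * cliffHat w) a k u =
      ∑ i, inner ℝ v (u i) * a k (Function.update u i w)
        + ∑ i, inner ℝ w (u i) * a k (Function.update u i v)
        - inner ℝ v w * a k u - intMul v (intMul w a) k u := by
  have e : (cliff v * cliffHat w) a = extMul (innerₛₗ ℝ v) (extMul (innerₛₗ ℝ w) a)
      + extMul (innerₛₗ ℝ v) (intMul w a) - intMul v (extMul (innerₛₗ ℝ w) a)
      - intMul v (intMul w a) := by
    simp only [cliff, cliffHat, Module.End.mul_apply, LinearMap.sub_apply, LinearMap.add_apply,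
      map_add]
    abel
  rw [e]
  simp only [Pi.sub_apply, Pi.add_apply, AlternatingMap.sub_apply, AlternatingMap.add_apply]
  rw [extMul_extMul_apply_eq_zero _ _ _ _ h, extMul_intMul_apply, intMul_extMul_apply]
  simp only [innerₛₗ_apply_apply, AlternatingMap.zero_apply, real_inner_comm v w]
  ring

lemma ofDegree_self {k : ℕ} (α : V [⋀^Fin k]→ₗ[ℝ] ℝ) : ofDegree α k = α := Pi.single_eq_same _ _

lemma ofDegree_ne {k j : ℕ} (h : j ≠ k) (α : V [⋀^Fin k]→ₗ[ℝ] ℝ) : ofDegree α j = 0 :=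
  Pi.single_eq_of_ne h _

lemma sum_inner_bilin {ι F : Type*} [Fintype ι] [AddCommGroup F] [Module ℝ F]
    (v : OrthonormalBasis ι ℝ V) (S : V →ₗ[ℝ] V) (β : V →ₗ[ℝ] V →ₗ[ℝ] F) :
    ∑ j, ∑ m, (inner ℝ (v j) (S (v m)) : ℝ) • β (v j) (v m) = ∑ m, β (S (v m)) (v m) := by
  rw [Finset.sum_comm]
  refine Finset.sum_congr rfl fun m _ => ?_
  conv_rhs => rw [← v.sum_repr (S (v m))]
  simp [v.repr_apply_apply]

/-- A bilinear expression summed against the matrix of `S` does not depend on the orthonormal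
basis. -/
lemma sum_inner_bilin_eq {ι κ F : Type*} [Fintype ι] [Fintype κ] [AddCommGroup F] [Module ℝ F]
    (v : OrthonormalBasis ι ℝ V) (w : OrthonormalBasis κ ℝ V) (S : V →ₗ[ℝ] V)
    (β : V →ₗ[ℝ] V →ₗ[ℝ] F) :
    ∑ j, ∑ m, (inner ℝ (v j) (S (v m)) : ℝ) • β (v j) (v m) =
      ∑ j, ∑ m, (inner ℝ (w j) (S (w m)) : ℝ) • β (w j) (w m) := by
  have h2 : ∀ a x : V, β a x = ∑ l, (inner ℝ (w l) x : ℝ) • β a (w l) := by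
    intro a x
    conv_lhs => rw [← w.sum_repr' x]
    simp only [map_sum, map_smul]
  rw [sum_inner_bilin, sum_inner_bilin,
    Finset.sum_congr rfl fun m _ => h2 (S (v m)) (v m), Finset.sum_comm]
  refine Finset.sum_congr rfl fun l _ => ?_
  conv_rhs =>
    arg 1
    rw [← v.sum_repr' (w l)]
  rw [map_sum, map_sum, LinearMap.sum_apply]
  refine Finset.sum_congr rfl fun m _ => ?_
  rw [map_smul, map_smul, LinearMap.smul_apply, real_inner_comm]

/-- The value of the quadratic form with Gram matrix `K` on the components of two tensors of
degree `k`. -/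
def gramForm {ι : Type*} [Fintype ι] (k : ℕ) (K : Matrix ι ι ℝ) (ζ ξ : (Fin k → ι) → ℝ) : ℝ :=
  (1 / (k.factorial : ℝ)) * ∑ I, ∑ J, (∏ a, K (I a) (J a)) * (ζ I * ξ J)

lemma multilinear_apply_sum {ι κ : Type*} [Fintype ι] {k : ℕ}
    (α : V [⋀^Fin k]→ₗ[ℝ] ℝ) (b : ι → V) (T : ι → κ → ℝ) (J : Fin k → κ) :
    α (fun a => ∑ i, T i (J a) • b i) = ∑ I : Fin k → ι, (∏ a, T (I a) (J a)) * α (fun a => b (I a)) := by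
  classical
  have h := α.toMultilinearMap.map_sum (fun a i => T i (J a) • b i)
  refine h.trans (Finset.sum_congr rfl fun I _ => ?_)
  exact (α.toMultilinearMap.map_smul_univ _ _).trans (by simp)

variable [FiniteDimensional ℝ V]

/-- If `T` holds the coordinates of an orthonormal basis with respect to `b`, the inverse Gram
matrix is `T Tᵀ`; expanding both forms in `b` produces one factor `T Tᵀ` per slot. This makes the
dependence of the norm on the metric explicit, with the components of the form held fixed. -/
lemma formInner_eq_gramForm {ι : Type*} [Fintype ι] [DecidableEq ι] (b : Module.Basis ι ℝ V) {k : ℕ}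
    (α β : V [⋀^Fin k]→ₗ[ℝ] ℝ) :
    formInner α β = gramForm k (Matrix.of fun i j => inner ℝ (b i) (b j))⁻¹
      (fun I => α fun a => b (I a)) (fun I => β fun a => b (I a)) := by
  classical
  set f := stdOrthonormalBasis ℝ V
  let T : Matrix ι (Fin (Module.finrank ℝ V)) ℝ := Matrix.of fun i j => b.repr (f j) i
  have hT : (Matrix.of fun i j => (inner ℝ (b i) (b j) : ℝ))⁻¹ = T * T.transpose := by
    refine Matrix.inv_eq_right_inv ?_
    ext i l
    have h1 : ∀ j, ∑ m, (inner ℝ (b i) (b m) : ℝ) * T m j = inner ℝ (b i) (f j) := by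
      intro j
      calc ∑ m, (inner ℝ (b i) (b m) : ℝ) * T m j = inner ℝ (b i) (∑ m, b.repr (f j) m • b m) := by
            simp only [inner_sum, inner_smul_right, T, Matrix.of_apply, mul_comm]
        _ = _ := by rw [b.sum_repr]
    rw [← Matrix.mul_assoc, Matrix.mul_apply]
    simp only [Matrix.mul_apply, Matrix.of_apply, Matrix.transpose_apply, h1]
    have h2 : ∑ j, (inner ℝ (b i) (f j) : ℝ) * T l j = b.repr (∑ j, (inner ℝ (f j) (b i) : ℝ) • f j) l := by
      simp [T, real_inner_comm]
    rw [h2, f.sum_repr' (b i)]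
    simp [Matrix.one_apply, Finsupp.single_apply]
  have hf : ∀ (γ : V [⋀^Fin k]→ₗ[ℝ] ℝ) (J : Fin k → Fin (Module.finrank ℝ V)),
      γ (fun a => f (J a)) = ∑ I : Fin k → ι, (∏ a, T (I a) (J a)) * γ (fun a => b (I a)) := by
    intro γ J
    rw [← multilinear_apply_sum γ b T J]
    congr 1
    ext1 a
    exact (b.sum_repr (f (J a))).symm
  rw [formInner, gramForm, hT]
  congr 1
  rw [Finset.sum_congr rfl fun J _ => by rw [hf α, hf β, Finset.sum_mul_sum]]
  rw [Finset.sum_comm]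
  refine Finset.sum_congr rfl fun I _ => ?_
  rw [Finset.sum_comm]
  refine Finset.sum_congr rfl fun I' _ => ?_
  simp only [Matrix.mul_apply, Matrix.transpose_apply]
  rw [Finset.prod_univ_sum, Fintype.piFinset_univ, Finset.sum_mul]
  refine Finset.sum_congr rfl fun J _ => ?_
  rw [Finset.prod_mul_distrib]
  ring

lemma gramForm_one {ι : Type*} [Fintype ι] [DecidableEq ι] (k : ℕ) (ζ ξ : (Fin k → ι) → ℝ) :
    gramForm k 1 ζ ξ = (1 / (k.factorial : ℝ)) * ∑ I, ζ I * ξ I := by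
  rw [gramForm]
  congr 1
  refine Finset.sum_congr rfl fun I _ => ?_
  rw [Finset.sum_eq_single I]
  · simp
  · intro J _ hJ
    obtain ⟨a, ha⟩ := Function.ne_iff.1 hJ
    rw [Finset.prod_eq_zero (Finset.mem_univ a), zero_mul]
    exact Matrix.one_apply_ne' ha
  · simp

lemma formInner_eq_sum {ι : Type*} [Fintype ι] (v : OrthonormalBasis ι ℝ V) {k : ℕ}
    (α β : V [⋀^Fin k]→ₗ[ℝ] ℝ) :
    formInner α β = (1 / (k.factorial : ℝ)) *
      ∑ I : Fin k → ι, α (fun a => v (I a)) * β (fun a => v (I a)) := by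
  classical
  rw [formInner_eq_gramForm v.toBasis]
  have : (Matrix.of fun i j => (inner ℝ (v.toBasis i) (v.toBasis j) : ℝ)) = 1 := by
    ext i j
    simp [Matrix.one_apply, orthonormal_iff_ite.1 v.orthonormal i j]
  rw [this, inv_one, gramForm_one]
  simp

lemma formInner_self_nonneg {k : ℕ} (α : V [⋀^Fin k]→ₗ[ℝ] ℝ) : 0 ≤ formInner α α :=
  mul_nonneg (by positivity) (Finset.sum_nonneg fun _ _ => mul_self_nonneg _)

lemma alternating_eq_zero_of_finrank_lt {k : ℕ} (hk : Module.finrank ℝ V < k)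
    (α : V [⋀^Fin k]→ₗ[ℝ] ℝ) : α = 0 := by
  ext u
  refine α.map_linearDependent u fun h => ?_
  have := h.fintype_card_le_finrank
  simp at this
  omega

/-- Degrees above the dimension are absent from the sum that defines `formsInner`, but there `α`
itself is zero. -/
lemma formsInner_ofDegree {k : ℕ} (α : V [⋀^Fin k]→ₗ[ℝ] ℝ) (b : Forms V) :
    formsInner (ofDegree α) b = formInner α (b k) := by
  have h0 : ∀ {j : ℕ} (β : V [⋀^Fin j]→ₗ[ℝ] ℝ), formInner 0 β = 0 := fun β => by
    simp [formInner]
  rw [formsInner]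
  by_cases hk : k ∈ Finset.range (Module.finrank ℝ V + 1)
  · rw [Finset.sum_eq_single k _ (fun h => absurd hk h), ofDegree_self]
    intro j _ hj
    rw [ofDegree_ne hj, h0]
  · rw [alternating_eq_zero_of_finrank_lt (by simpa [Nat.lt_succ_iff] using hk) α, h0]
    refine Finset.sum_eq_zero fun j _ => ?_
    simp [ofDegree, h0]

/-- An alternating form is bounded by its norm. -/
lemma sq_apply_le {k : ℕ} (α : V [⋀^Fin k]→ₗ[ℝ] ℝ) (u : Fin k → V) :
    α u ^ 2 ≤ (k.factorial : ℝ) * formInner α α * ∏ a, ‖u a‖ ^ 2 := by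
  set f := stdOrthonormalBasis ℝ V
  have h : α u = ∑ J : Fin k → Fin (Module.finrank ℝ V),
      (∏ a, (inner ℝ (f (J a)) (u a) : ℝ)) * α (fun a => f (J a)) := by
    have := multilinear_apply_sum α f (fun i a => (inner ℝ (f i) (u a) : ℝ)) id
    simpa only [f.sum_repr', id] using this
  -- Parseval in every slot, multiplied out: the weights in the expansion of `α u` have square sum
  -- `∏ ‖u a‖²`, and Cauchy–Schwarz applies.
  have hn : ∏ a, ‖u a‖ ^ 2 = ∑ J : Fin k → Fin (Module.finrank ℝ V),
      (∏ a, (inner ℝ (f (J a)) (u a) : ℝ)) ^ 2 := by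
    simp only [← f.sum_sq_inner_right, ← Finset.prod_pow]
    rw [Finset.prod_univ_sum, Fintype.piFinset_univ]
  have hk : (k.factorial : ℝ) * formInner α α =
      ∑ J : Fin k → Fin (Module.finrank ℝ V), α (fun a => f (J a)) ^ 2 := by
    rw [formInner, ← mul_assoc, mul_one_div_cancel (by positivity), one_mul]
    simp only [sq, f]
  rw [hn, hk, h, mul_comm (∑ J, _)]
  exact Finset.sum_mul_sq_le_sq_mul_sq _ _ _

end FormAlgebra

/-! ### Sums of `c ĉ` and their quadratic forms in components -/

section FormOperators

variable {V : Type*} [NormedAddCommGroup V] [InnerProductSpace ℝ V]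

lemma extMul_add (η θ : V →ₗ[ℝ] ℝ) : extMul (η + θ) = extMul η + extMul θ := by
  refine LinearMap.ext fun a => funext fun k => AlternatingMap.ext fun u => ?_
  cases k with
  | zero => simp [extMul_apply_zero]
  | succ k =>
    simp only [LinearMap.add_apply, Pi.add_apply, AlternatingMap.add_apply, extMul_apply_succ,
      ← Finset.sum_add_distrib]
    exact Finset.sum_congr rfl fun i _ => by ring

lemma extMul_smul (r : ℝ) (η : V →ₗ[ℝ] ℝ) : extMul (r • η) = r • extMul η := by
  refine LinearMap.ext fun a => funext fun k => AlternatingMap.ext fun u => ?_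
  cases k with
  | zero => simp [extMul_apply_zero]
  | succ k =>
    simp only [LinearMap.smul_apply, Pi.smul_apply, AlternatingMap.smul_apply, extMul_apply_succ,
      smul_eq_mul, Finset.mul_sum]
    exact Finset.sum_congr rfl fun i _ => by ring

lemma intMul_add (v w : V) : intMul (v + w) = intMul v + intMul w := by
  refine LinearMap.ext fun a => funext fun k => AlternatingMap.ext fun u => ?_
  simp only [LinearMap.add_apply, Pi.add_apply, AlternatingMap.add_apply, intMul_apply]
  exact (a (k + 1)).map_vecCons_add u v w

lemma intMul_smul (r : ℝ) (v : V) : intMul (r • v) = r • intMul v := by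
  refine LinearMap.ext fun a => funext fun k => AlternatingMap.ext fun u => ?_
  simp only [LinearMap.smul_apply, Pi.smul_apply, AlternatingMap.smul_apply, intMul_apply]
  exact (a (k + 1)).map_vecCons_smul u r v

lemma cliff_add (v w : V) : cliff (v + w) = cliff v + cliff w := by
  rw [cliff, cliff, cliff, map_add, extMul_add, intMul_add]
  exact add_sub_add_comm (extMul (innerₛₗ ℝ v)) (extMul (innerₛₗ ℝ w)) (intMul v) (intMul w)

lemma cliff_smul (r : ℝ) (v : V) : cliff (r • v) = r • cliff v := by
  rw [cliff, cliff, map_smul, extMul_smul, intMul_smul]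
  exact (smul_sub r (extMul (innerₛₗ ℝ v)) (intMul v)).symm

lemma cliffHat_add (v w : V) : cliffHat (v + w) = cliffHat v + cliffHat w := by
  rw [cliffHat, cliffHat, cliffHat, map_add, extMul_add, intMul_add, add_add_add_comm]

lemma cliffHat_smul (r : ℝ) (v : V) : cliffHat (r • v) = r • cliffHat v := by
  rw [cliffHat, cliffHat, map_smul, extMul_smul, intMul_smul, smul_add]

lemma alternating_sum_apply {ι : Type*} {k : ℕ} (s : Finset ι) (f : ι → V [⋀^Fin k]→ₗ[ℝ] ℝ)
    (u : Fin k → V) : (∑ i ∈ s, f i) u = ∑ i ∈ s, f i u := by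
  classical
  induction s using Finset.induction_on with
  | empty => simp
  | insert a s ha ih => rw [Finset.sum_insert ha, Finset.sum_insert ha, AlternatingMap.add_apply, ih]

/-- The operator is the contraction of `S` with the bilinear map `(v, w) ↦ c(v) ĉ(w)`. Hence a frame
of eigenvectors may replace the given frame. -/
lemma cliffSum_inner_eq {n : ℕ} (v w : OrthonormalBasis (Fin n) ℝ V) (S : V →ₗ[ℝ] V) :
    cliffSum v (fun j m => inner ℝ (v j) (S (v m))) =
      cliffSum w (fun j m => inner ℝ (w j) (S (w m))) := by
  refine LinearMap.ext fun a => funext fun k => AlternatingMap.ext fun u => ?_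
  let β : V →ₗ[ℝ] V →ₗ[ℝ] ℝ := LinearMap.mk₂ ℝ (fun v w => (cliff v * cliffHat w) a k u)
    (fun v v' w => by rw [cliff_add, add_mul]; rfl) (fun r v w => by rw [cliff_smul]; rfl)
    (fun v w w' => by rw [cliffHat_add, mul_add]; rfl)
    (fun r v w => by rw [cliffHat_smul, mul_smul_comm]; rfl)
  have h : ∀ v : OrthonormalBasis (Fin n) ℝ V,
      cliffSum v (fun j m => inner ℝ (v j) (S (v m))) a k u =
        ∑ j, ∑ m, (inner ℝ (v j) (S (v m)) : ℝ) • β (v j) (v m) := by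
    intro v
    simp only [cliffSum, LinearMap.sum_apply, Finset.sum_apply, LinearMap.smul_apply,
      Pi.smul_apply, alternating_sum_apply, AlternatingMap.smul_apply]
    rfl
  rw [h, h]
  exact sum_inner_bilin_eq v w S β

variable {n : ℕ} (v : OrthonormalBasis (Fin n) ℝ V) {k : ℕ}

/-- The components of an alternating form with respect to a frame. -/
def comps {ι : Type*} (v : ι → V) (α : V [⋀^Fin k]→ₗ[ℝ] ℝ) (I : Fin k → ι) : ℝ :=
  α fun a => v (I a)

/-- The contraction `⟨i_{v_j} α, i_{v_m} α⟩` in terms of the components `ζ` of `α`. -/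
def contr {ι : Type*} [Fintype ι] [DecidableEq ι] (ζ : (Fin k → ι) → ℝ) (j m : ι) : ℝ :=
  (1 / (k.factorial : ℝ)) * ∑ I, ∑ a, if I a = j then ζ I * ζ (Function.update I a m) else 0

lemma comps_update {ι : Type*} [DecidableEq ι] (v : ι → V) (α : V [⋀^Fin k]→ₗ[ℝ] ℝ)
    (I : Fin k → ι) (a : Fin k) (m : ι) :
    α (Function.update (fun a => v (I a)) a (v m)) = comps v α (Function.update I a m) := by
  rw [comps]
  congr 1
  ext1 b
  by_cases h : b = a
  · subst h; simp
  · simp [h]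

lemma cliff_mul_cliffHat_comps (α : V [⋀^Fin k]→ₗ[ℝ] ℝ) (j m : Fin n) (I : Fin k → Fin n) :
    comps v ((cliff (v j) * cliffHat (v m)) (ofDegree α) k) I =
      ∑ a, (if I a = j then comps v α (Function.update I a m) else 0)
        + ∑ a, (if I a = m then comps v α (Function.update I a j) else 0)
        - if j = m then comps v α I else 0 := by
  rw [comps, cliff_mul_cliffHat_apply _ _ _ _ (fun l hl => ofDegree_ne (by omega) α), ofDegree_self,
    intMul_apply, intMul_apply, ofDegree_ne (by omega)]
  simp only [comps_update, orthonormal_iff_ite.1 v.orthonormal, AlternatingMap.zero_apply, sub_zero,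
    ite_mul, one_mul, zero_mul, comps, eq_comm]

variable [FiniteDimensional ℝ V]

lemma formInner_comps (α β : V [⋀^Fin k]→ₗ[ℝ] ℝ) :
    formInner α β = (1 / (k.factorial : ℝ)) * ∑ I, comps v α I * comps v β I :=
  formInner_eq_sum v α β

/-- The quadratic form of `∑ S j m c(η^j) ĉ(η^m)` in terms of contractions. -/
lemma formsInner_cliffSum (S : Fin n → Fin n → ℝ) (α : V [⋀^Fin k]→ₗ[ℝ] ℝ) :
    formsInner (ofDegree α) (cliffSum v S (ofDegree α)) =
      ∑ j, ∑ m, S j m * (contr (comps v α) j m + contr (comps v α) m j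
        - if j = m then formInner α α else 0) := by
  have h : ∀ j m, formInner α ((cliff (v j) * cliffHat (v m)) (ofDegree α) k) =
      contr (comps v α) j m + contr (comps v α) m j - if j = m then formInner α α else 0 := by
    intro j m
    rw [formInner_comps v, formInner_comps v, contr, contr, ← mul_add, ← mul_ite_zero, ← mul_sub]
    congr 1
    by_cases hjm : j = m
    · subst hjm
      simp only [if_true, ← Finset.sum_add_distrib, ← Finset.sum_sub_distrib]
      refine Finset.sum_congr rfl fun I _ => ?_
      rw [cliff_mul_cliffHat_comps]
      simp only [if_true, mul_sub, mul_add, Finset.mul_sum, mul_ite, mul_zero,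
        ← Finset.sum_add_distrib]
    · simp only [if_neg hjm, sub_zero, ← Finset.sum_add_distrib]
      refine Finset.sum_congr rfl fun I _ => ?_
      rw [cliff_mul_cliffHat_comps]
      simp only [if_neg hjm, sub_zero, mul_add, Finset.mul_sum, mul_ite, mul_zero,
        ← Finset.sum_add_distrib]
  have hs : ∀ (s : Finset (Fin n)) (f : Fin n → Fin n → V [⋀^Fin k]→ₗ[ℝ] ℝ),
      formInner α (∑ j ∈ s, ∑ m, S j m • f j m) = ∑ j ∈ s, ∑ m, S j m * formInner α (f j m) := by
    intro s f
    simp only [formInner, alternating_sum_apply, AlternatingMap.smul_apply, smul_eq_mul,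
      Finset.mul_sum]
    rw [Finset.sum_comm]
    refine Finset.sum_congr rfl fun j _ => ?_
    rw [Finset.sum_comm]
    refine Finset.sum_congr rfl fun m _ => Finset.sum_congr rfl fun J _ => by ring
  rw [formsInner_ofDegree]
  have hc : cliffSum v S (ofDegree α) k =
      ∑ j, ∑ m, S j m • (cliff (v j) * cliffHat (v m)) (ofDegree α) k := by
    simp only [cliffSum, LinearMap.sum_apply, Finset.sum_apply, LinearMap.smul_apply, Pi.smul_apply]
  rw [hc, hs]
  simp only [h]

/-- The quadratic form of the square of `∑ B^i_m c(η^i) ĉ(η^m)` in a frame of eigenvectors. -/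
lemma formsInner_cliffSum_sq (β : Fin n → ℝ) (α : V [⋀^Fin k]→ₗ[ℝ] ℝ) :
    formsInner (ofDegree α)
      ((cliffSum v (fun j m => if j = m then β j else 0) ^ 2) (ofDegree α)) =
      (1 / (k.factorial : ℝ)) * ∑ I, (2 * ∑ a, β (I a) - ∑ i, β i) ^ 2 * comps v α I ^ 2 := by
  have hT : cliffSum v (fun j m => if j = m then β j else 0) =
      ∑ j, β j • (cliff (v j) * cliffHat (v j)) := by
    rw [cliffSum]
    refine Finset.sum_congr rfl fun j _ => ?_
    rw [Finset.sum_eq_single j]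
    · simp
    · intro m _ hm; simp [hm.symm]
    · simp
  -- The operator is diagonal on components: `c(v_j) ĉ(v_j)` multiplies component `I` by twice the
  -- number of slots with `I a = j`, minus one. General `η` is needed because the operator is
  -- applied twice.
  have key : ∀ (η : Forms V), (∀ j, j + 2 = k → η j = 0) → ∀ I : Fin k → Fin n,
      cliffSum v (fun j m => if j = m then β j else 0) η k (fun a => v (I a)) =
        (2 * ∑ a, β (I a) - ∑ i, β i) * η k (fun a => v (I a)) := by
    intro η hη I
    rw [hT]
    simp only [LinearMap.sum_apply, Finset.sum_apply, LinearMap.smul_apply, Pi.smul_apply,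
      alternating_sum_apply, AlternatingMap.smul_apply, smul_eq_mul]
    have h1 : ∀ j, (cliff (v j) * cliffHat (v j)) η k (fun a => v (I a)) =
        2 * (∑ a, if j = I a then η k (fun a => v (I a)) else 0) - η k (fun a => v (I a)) := by
      intro j
      rw [cliff_mul_cliffHat_apply _ _ _ _ hη, intMul_intMul_self]
      simp only [orthonormal_iff_ite.1 v.orthonormal, ite_mul, one_mul, zero_mul, if_true,
        Pi.zero_apply, AlternatingMap.zero_apply, sub_zero, two_mul]
      have : ∀ a, (if j = I a then η k (Function.update (fun a => v (I a)) a (v j)) else 0) =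
          if j = I a then η k (fun a => v (I a)) else 0 := by
        intro a
        by_cases h : j = I a
        · subst h
          rw [Function.update_eq_self a (fun a => v (I a))]
        · simp [h]
      simp only [this]
    simp only [h1, mul_sub, Finset.sum_sub_distrib, sub_mul, Finset.sum_mul, Finset.mul_sum]
    rw [Finset.sum_comm]
    congr 1
    refine Finset.sum_congr rfl fun a _ => ?_
    simp only [mul_ite, mul_zero, Finset.sum_ite_eq', Finset.mem_univ, if_true]
    ring
  rw [formsInner_ofDegree, pow_two, Module.End.mul_apply, formInner_comps v]
  congr 1
  refine Finset.sum_congr rfl fun I _ => ?_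
  rw [comps, comps, key _ _ I, key _ (fun j hj => ofDegree_ne (by omega) α) I, ofDegree_self]
  · ring
  -- The image of `α` has no component in degree `k - 2`, since both factors of each summand use the
  -- same vector and `i_v i_v = 0`.
  · intro j hj
    rw [hT]
    simp only [LinearMap.sum_apply, Finset.sum_apply, LinearMap.smul_apply, Pi.smul_apply]
    refine Finset.sum_eq_zero fun i _ => ?_
    rw [show (cliff (v i) * cliffHat (v i)) (ofDegree α) j = 0 from ?_, smul_zero]
    ext u
    rw [cliff_mul_cliffHat_apply _ _ _ _ (fun l hl => ofDegree_ne (by omega) α),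
      intMul_intMul_self, ofDegree_ne (by omega)]
    simp

/-- In `contr` all slots contribute the same sum, because the two signs from moving the vectors to
the front multiply to one. The number of slots turns `1/k!` into the factor belonging to degree `k -
1`. -/
lemma formsInner_intMul (α : V [⋀^Fin k]→ₗ[ℝ] ℝ) (j m : Fin n) :
    formsInner (intMul (v j) (ofDegree α)) (intMul (v m) (ofDegree α)) =
      contr (comps v α) j m := by
  cases k with
  | zero =>
    have h : intMul (v j) (ofDegree α) = 0 := by
      funext l; ext u; rw [intMul_apply, ofDegree_ne (by omega)]; rfl
    rw [h]
    simp [contr, formsInner, formInner]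
  | succ k =>
    have h : ∀ j, intMul (v j) (ofDegree α) = ofDegree (intMul (v j) (ofDegree α) k) := by
      intro j
      funext l
      by_cases hl : l = k
      · subst hl; rw [ofDegree_self]
      · rw [ofDegree_ne hl]; ext u; rw [intMul_apply, ofDegree_ne (by omega)]; rfl
    rw [h j, formsInner_ofDegree, formInner_comps v, contr]
    have hc : ∀ j (J : Fin k → Fin n), comps v (intMul (v j) (ofDegree α) k) J =
        comps v α (Matrix.vecCons j J) := by
      intro j J
      rw [comps, intMul_apply, ofDegree_self, comps]
      congr 1
      ext1 a
      refine Fin.cases ?_ (fun a => ?_) a <;> simp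
    have hins : ∀ j (p : Fin (k + 1)) (J : Fin k → Fin n), comps v α (p.insertNth j J) =
        (-1 : ℝ) ^ (p : ℕ) * comps v α (Matrix.vecCons j J) := by
      intro j p J
      have h1 := AlternatingMap.map_insertNth α p (v j) (fun a => v (J a))
      have h2 : p.insertNth (α := fun _ => V) (v j) (fun a => v (J a)) =
          fun a => v (p.insertNth (α := fun _ => Fin n) j J a) := by
        ext1 a
        refine Fin.succAboveCases p ?_ (fun a => ?_) a <;> simp
      have h3 : Matrix.vecCons (v j) (fun a => v (J a)) = fun a => v (Matrix.vecCons j J a) := by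
        ext1 a
        refine Fin.cases ?_ (fun a => ?_) a <;> simp
      rw [h2, h3] at h1
      rw [comps, h1, comps, zsmul_eq_mul]
      push_cast; rfl
    have hI : ∀ a : Fin (k + 1), (∑ I : Fin (k + 1) → Fin n, if I a = j then
        comps v α I * comps v α (Function.update I a m) else 0) =
        ∑ J : Fin k → Fin n, comps v α (Matrix.vecCons j J) * comps v α (Matrix.vecCons m J) := by
      intro a
      rw [← (Fin.insertNthEquiv (fun _ => Fin n) a).sum_comp, Fintype.sum_prod_type]
      have hE : ∀ x : Fin n × (Fin k → Fin n), Fin.insertNthEquiv (fun _ => Fin n) a x =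
          a.insertNth (α := fun _ => Fin n) x.1 x.2 := fun x => rfl
      simp only [hE, Fin.insertNth_apply_same, Fin.update_insertNth, hins]
      rw [Finset.sum_eq_single j]
      · simp only [if_true]
        refine Finset.sum_congr rfl fun J _ => ?_
        have : ((-1 : ℝ) ^ (a : ℕ)) * (-1 : ℝ) ^ (a : ℕ) = 1 := by
          rw [← mul_pow]; simp
        linear_combination (comps v α (Matrix.vecCons j J) * comps v α (Matrix.vecCons m J)) * this
      · intro b _ hb; simp [hb]
      · simp
    rw [Finset.sum_comm, Finset.sum_congr rfl fun a _ => hI a]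
    simp only [hc, Finset.sum_const, Finset.card_univ, Fintype.card_fin, nsmul_eq_mul,
      Nat.factorial_succ]
    push_cast
    field_simp

end FormOperators

/-! ### Derivatives of determinants, inverses and Gram forms along curves of matrices -/

section MatrixCalculus

variable {ι : Type*} [Fintype ι] [DecidableEq ι]

/-- Jacobi's formula: the product rule in the Leibniz expansion gives determinants with one column
replaced by its derivative, and by Cramer's rule these are the diagonal entries of `adj Γ · Γ'`. -/
lemma hasDerivAt_det {Γ Γ' : ℝ → Matrix ι ι ℝ} {t : ℝ}
    (h : ∀ i j, HasDerivAt (fun s => Γ s i j) (Γ' t i j) t) :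
    HasDerivAt (fun s => (Γ s).det) ((Γ t).adjugate * Γ' t).trace t := by
  have h1 : HasDerivAt (fun s => (Γ s).det) (∑ σ : Equiv.Perm ι, (σ.sign : ℤ) •
      ∑ i, (∏ j ∈ Finset.univ.erase i, Γ t (σ j) j) • Γ' t (σ i) i) t := by
    simp only [Matrix.det_apply, Units.smul_def]
    refine HasDerivAt.fun_sum fun σ _ => ?_
    simp only [zsmul_eq_mul]
    exact (HasDerivAt.fun_finsetProd (u := Finset.univ) fun i _ => h (σ i) i).const_mul _
  convert h1 using 1
  have h2 : ((Γ t).adjugate * Γ' t).trace = ∑ i, ((Γ t).updateCol i fun j => Γ' t j i).det := by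
    rw [Matrix.trace]
    refine Finset.sum_congr rfl fun i _ => ?_
    rw [← Matrix.cramer_apply, Matrix.cramer_eq_adjugate_mulVec]
    rfl
  rw [h2]
  simp only [Matrix.det_apply, Finset.smul_sum]
  rw [Finset.sum_comm]
  refine Finset.sum_congr rfl fun σ _ => Finset.sum_congr rfl fun i _ => ?_
  rw [← Finset.mul_prod_erase _ _ (Finset.mem_univ i), Units.smul_def, smul_eq_mul,
    mul_comm (∏ j ∈ _, _), Matrix.updateCol_self]
  congr 2
  refine Finset.prod_congr rfl fun j hj => ?_
  rw [Matrix.updateCol_ne (Finset.mem_erase.1 hj).1]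

/-- By Cramer's rule the entries of the inverse are quotients of determinants. Once
differentiability is known, the value of the derivative follows from differentiating `Γ⁻¹ Γ = 1`,
which is done in `hasDerivAt_inv_apply`. -/
lemma differentiableAt_inv_apply {Γ Γ' : ℝ → Matrix ι ι ℝ} {t : ℝ}
    (h : ∀ i j, HasDerivAt (fun s => Γ s i j) (Γ' t i j) t) (h0 : (Γ t).det ≠ 0) (i j : ι) :
    DifferentiableAt ℝ (fun s => (Γ s)⁻¹ i j) t := by
  simp only [Matrix.inv_def, Matrix.smul_apply, smul_eq_mul, Ring.inverse_eq_inv']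
  refine ((hasDerivAt_det h).differentiableAt.inv h0).mul ?_
  simp only [Matrix.adjugate_apply]
  have h1 : ∀ a b, HasDerivAt (fun s => (Γ s).updateRow j (Pi.single i 1) a b)
      ((fun s => (Γ' s).updateRow j 0) t a b) t := by
    intro a b
    by_cases ha : a = j
    · subst ha
      simpa using hasDerivAt_const t _
    · simpa [Matrix.updateRow_apply, ha] using h a b
  exact (hasDerivAt_det (Γ := fun s => (Γ s).updateRow j (Pi.single i 1))
    (Γ' := fun s => (Γ' s).updateRow j 0) h1).differentiableAt

lemma hasDerivAt_inv_apply {Γ Γ' : ℝ → Matrix ι ι ℝ} {t : ℝ}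
    (h : ∀ i j, HasDerivAt (fun s => Γ s i j) (Γ' t i j) t) (h0 : (Γ t).det ≠ 0) (i j : ι) :
    HasDerivAt (fun s => (Γ s)⁻¹ i j) ((-((Γ t)⁻¹ * Γ' t * (Γ t)⁻¹)) i j) t := by
  let K' : Matrix ι ι ℝ := Matrix.of fun i j => deriv (fun s => (Γ s)⁻¹ i j) t
  have hK : ∀ i j, HasDerivAt (fun s => (Γ s)⁻¹ i j) (K' i j) t := fun i j =>
    (differentiableAt_inv_apply h h0 i j).hasDerivAt
  have hu : IsUnit (Γ t).det := isUnit_iff_ne_zero.2 h0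
  have hprod : K' * Γ t + (Γ t)⁻¹ * Γ' t = 0 := by
    ext a b
    have h1 : HasDerivAt (fun s => ((Γ s)⁻¹ * Γ s) a b) ((K' * Γ t + (Γ t)⁻¹ * Γ' t) a b) t := by
      simp only [Matrix.mul_apply, Matrix.add_apply, ← Finset.sum_add_distrib]
      exact HasDerivAt.fun_sum fun l _ => (hK a l).mul (h l b)
    have h2 : (fun s => ((Γ s)⁻¹ * Γ s) a b) =ᶠ[𝓝 t] fun _ => (1 : Matrix ι ι ℝ) a b := by
      filter_upwards [(hasDerivAt_det h).continuousAt.eventually_ne h0] with s hs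
      rw [Matrix.nonsing_inv_mul _ (isUnit_iff_ne_zero.2 hs)]
    exact h1.unique ((hasDerivAt_const t _).congr_of_eventuallyEq h2)
  have : K' = -((Γ t)⁻¹ * Γ' t * (Γ t)⁻¹) := by
    have h3 : K' * Γ t * (Γ t)⁻¹ = -((Γ t)⁻¹ * Γ' t) * (Γ t)⁻¹ := by
      rw [eq_neg_of_add_eq_zero_left hprod]
    rwa [Matrix.mul_nonsing_inv_cancel_right _ _ hu, neg_mul] at h3
  rw [← this]
  exact hK i j

lemma hasDerivAt_sqrt_det {Γ Γ' : ℝ → Matrix ι ι ℝ} {t : ℝ}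
    (h : ∀ i j, HasDerivAt (fun s => Γ s i j) (Γ' t i j) t) (h0 : 0 < (Γ t).det) :
    HasDerivAt (fun s => √(Γ s).det) ((1 / 2) * (√(Γ t).det * ((Γ t)⁻¹ * Γ' t).trace)) t := by
  convert (hasDerivAt_det h).sqrt h0.ne' using 1
  rw [Matrix.inv_def, Ring.inverse_eq_inv', smul_mul_assoc, Matrix.trace_smul, smul_eq_mul]
  have := Real.mul_self_sqrt h0.le
  have h2 : √(Γ t).det ≠ 0 := (Real.sqrt_pos.2 h0).ne'
  field_simp
  rw [pow_two, this]

/-- The derivative of `gramForm` in the direction `H`. -/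
def gramFormDeriv (k : ℕ) (K H : Matrix ι ι ℝ) (ζ ξ : (Fin k → ι) → ℝ) : ℝ :=
  (1 / (k.factorial : ℝ)) * ∑ I, ∑ J,
    (∑ a, (∏ b ∈ Finset.univ.erase a, K (I b) (J b)) * H (I a) (J a)) * (ζ I * ξ J)

/-- The mixed second derivative of `gramForm` in the direction `H`. -/
def gramFormDeriv₂ (k : ℕ) (K H : Matrix ι ι ℝ) (ζ ξ : (Fin k → ι) → ℝ) : ℝ :=
  (1 / (k.factorial : ℝ)) * ∑ I, ∑ J, (∑ a, (∑ b ∈ Finset.univ.erase a,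
    (∏ c ∈ (Finset.univ.erase a).erase b, K (I c) (J c)) * H (I b) (J b)) * H (I a) (J a)) *
      (ζ I * ξ J)

omit [DecidableEq ι] in
lemma hasDerivAt_gramForm {K K' : ℝ → Matrix ι ι ℝ} {t : ℝ}
    (h : ∀ i j, HasDerivAt (fun s => K s i j) (K' t i j) t) (k : ℕ) (ζ ξ : (Fin k → ι) → ℝ) :
    HasDerivAt (fun s => gramForm k (K s) ζ ξ) (gramFormDeriv k (K t) (K' t) ζ ξ) t := by
  refine HasDerivAt.const_mul _ (HasDerivAt.fun_sum fun I _ => HasDerivAt.fun_sum fun J _ => ?_)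
  refine HasDerivAt.mul_const ?_ _
  exact HasDerivAt.fun_finsetProd fun a _ => h (I a) (J a)

omit [DecidableEq ι] in
lemma hasDerivAt_gramFormDeriv {K K' : ℝ → Matrix ι ι ℝ} {K'' : Matrix ι ι ℝ} {t : ℝ}
    (h : ∀ i j, HasDerivAt (fun s => K s i j) (K' t i j) t)
    (h' : ∀ i j, HasDerivAt (fun s => K' s i j) (K'' i j) t) (k : ℕ) (ζ ξ : (Fin k → ι) → ℝ) :
    HasDerivAt (fun s => gramFormDeriv k (K s) (K' s) ζ ξ)
      (gramFormDeriv₂ k (K t) (K' t) ζ ξ + gramFormDeriv k (K t) K'' ζ ξ) t := by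
  rw [gramFormDeriv₂, gramFormDeriv, ← mul_add]
  refine HasDerivAt.const_mul _ ?_
  simp only [← Finset.sum_add_distrib, ← add_mul]
  refine HasDerivAt.fun_sum fun I _ => HasDerivAt.fun_sum fun J _ => HasDerivAt.mul_const ?_ _
  refine HasDerivAt.fun_sum fun a _ => ?_
  refine HasDerivAt.fun_mul ?_ (h' (I a) (J a))
  exact HasDerivAt.fun_finsetProd fun b _ => h (I b) (J b)

/-- At the identity the factors of the undifferentiated slots are Kronecker deltas, so only
multi-indices `J` that agree with `I` outside one slot survive. -/
lemma gramFormDeriv_one (k : ℕ) (H : Matrix ι ι ℝ) (ζ ξ : (Fin k → ι) → ℝ) :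
    gramFormDeriv k 1 H ζ ξ = (1 / (k.factorial : ℝ)) *
      ∑ I, ∑ a, ∑ m, H (I a) m * (ζ I * ξ (Function.update I a m)) := by
  rw [gramFormDeriv]
  congr 1
  refine Finset.sum_congr rfl fun I _ => ?_
  simp only [Finset.sum_mul]
  rw [Finset.sum_comm]
  refine Finset.sum_congr rfl fun a _ => ?_
  symm
  refine Finset.sum_of_injOn (fun m => Function.update I a m) ?_ (by simp) ?_ ?_
  · intro m _ m' _ hm
    simpa using congrFun hm a
  · intro J _ hJ
    have : ∃ b, b ≠ a ∧ I b ≠ J b := by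
      by_contra! hc
      refine hJ ⟨J a, by simp, ?_⟩
      ext1 b
      by_cases hb : b = a
      · subst hb; simp
      · simp [hb, hc b hb]
    obtain ⟨b, hb, hIJ⟩ := this
    have h0 : ∏ b ∈ Finset.univ.erase a, (1 : Matrix ι ι ℝ) (I b) (J b) = 0 :=
      Finset.prod_eq_zero (Finset.mem_erase.2 ⟨hb, Finset.mem_univ b⟩) (Matrix.one_apply_ne hIJ)
    rw [h0, zero_mul, zero_mul]
  · intro m _
    have h1 : ∏ b ∈ Finset.univ.erase a,
        (1 : Matrix ι ι ℝ) (I b) (Function.update I a m b) = 1 := by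
      refine Finset.prod_eq_one fun b hb => ?_
      rw [Function.update_of_ne (Finset.mem_erase.1 hb).1, Matrix.one_apply_eq]
    rw [h1, Function.update_self, one_mul]

omit [DecidableEq ι] in
lemma sum_rotate {κ τ : Type*} [Fintype κ] [Fintype τ] (f : ι → κ → τ → ℝ) :
    ∑ j, ∑ m, ∑ I, f j m I = ∑ I, ∑ j, ∑ m, f j m I := by
  have h : ∀ j, ∑ m, ∑ I, f j m I = ∑ I, ∑ m, f j m I := fun j => Finset.sum_comm
  simp only [h]
  exact Finset.sum_comm

lemma gramFormDeriv_one_eq_contr (k : ℕ) (H : Matrix ι ι ℝ) (ζ : (Fin k → ι) → ℝ) :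
    gramFormDeriv k 1 H ζ ζ = ∑ j, ∑ m, H j m * contr ζ j m := by
  rw [gramFormDeriv_one]
  simp only [contr, Finset.mul_sum]
  conv_rhs => rw [sum_rotate]
  refine Finset.sum_congr rfl fun I _ => ?_
  conv_rhs => rw [sum_rotate]
  refine Finset.sum_congr rfl fun a _ => ?_
  rw [Finset.sum_comm]
  refine Finset.sum_congr rfl fun m _ => ?_
  rw [Finset.sum_eq_single (I a)]
  · rw [if_pos rfl]; ring
  · intro b _ hb; rw [if_neg hb.symm]; ring
  · simp

lemma sum_contr_diagonal (k : ℕ) (d : ι → ℝ) (ζ : (Fin k → ι) → ℝ) :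
    ∑ j, d j * contr ζ j j = (1 / (k.factorial : ℝ)) * ∑ I, (∑ a, d (I a)) * ζ I ^ 2 := by
  simp only [contr, Finset.mul_sum, Finset.sum_mul]
  rw [Finset.sum_comm]
  refine Finset.sum_congr rfl fun I _ => ?_
  rw [Finset.sum_comm]
  refine Finset.sum_congr rfl fun a _ => ?_
  rw [Finset.sum_eq_single (I a)]
  · rw [if_pos rfl, Function.update_eq_self]; ring
  · intro b _ hb; rw [if_neg hb.symm]; ring
  · simp

/-- Here every factor is diagonal, so `J = I`, and the sum over ordered pairs of distinct slots is
the square of the sum minus the sum of squares. -/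
lemma gramFormDeriv₂_one_diagonal (k : ℕ) (d : ι → ℝ) (ζ : (Fin k → ι) → ℝ) :
    gramFormDeriv₂ k 1 (Matrix.diagonal d) ζ ζ = (1 / (k.factorial : ℝ)) *
      ∑ I, ((∑ a, d (I a)) ^ 2 - ∑ a, d (I a) ^ 2) * ζ I ^ 2 := by
  rw [gramFormDeriv₂]
  congr 1
  refine Finset.sum_congr rfl fun I _ => ?_
  rw [Finset.sum_eq_single I]
  · have h1 : ∀ a : Fin k, (∑ b ∈ Finset.univ.erase a,
        (∏ c ∈ (Finset.univ.erase a).erase b, (1 : Matrix ι ι ℝ) (I c) (I c)) *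
          Matrix.diagonal d (I b) (I b)) * Matrix.diagonal d (I a) (I a) =
        d (I a) * (∑ b, d (I b)) - d (I a) ^ 2 := by
      intro a
      simp only [Matrix.one_apply_eq, Finset.prod_const_one, one_mul, Matrix.diagonal_apply_eq]
      rw [← Finset.add_sum_erase _ _ (Finset.mem_univ a)]
      ring
    rw [Finset.sum_congr rfl fun a _ => h1 a, Finset.sum_sub_distrib, ← Finset.sum_mul]
    ring
  · intro J _ hJ
    obtain ⟨e, he⟩ := Function.ne_iff.1 hJ.symm
    have h0 : ∀ a : Fin k, (∑ b ∈ Finset.univ.erase a,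
        (∏ c ∈ (Finset.univ.erase a).erase b, (1 : Matrix ι ι ℝ) (I c) (J c)) *
          Matrix.diagonal d (I b) (J b)) * Matrix.diagonal d (I a) (J a) = 0 := by
      intro a
      by_cases ha : e = a
      · subst ha
        rw [Matrix.diagonal_apply_ne _ he, mul_zero]
      · rw [Finset.sum_eq_zero, zero_mul]
        intro b _
        by_cases hb : e = b
        · subst hb
          rw [Matrix.diagonal_apply_ne _ he, mul_zero]
        · have h0 : ∏ c ∈ (Finset.univ.erase a).erase b, (1 : Matrix ι ι ℝ) (I c) (J c) = 0 :=
            Finset.prod_eq_zero (i := e) (by simp [ha, hb]) (Matrix.one_apply_ne he)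
          rw [h0, zero_mul]
    rw [Finset.sum_eq_zero fun a _ => h0 a, zero_mul]
  · simp

/-- First and second derivatives of `√(det Γ) ⟨Γ⁻¹ ζ, ζ⟩` along a curve of Gram matrices through
the identity whose velocity is diagonal. -/
lemma hasDerivAt_sqrt_det_mul_gramForm {Γ Γ' : ℝ → Matrix ι ι ℝ} {C : Matrix ι ι ℝ} {β : ι → ℝ}
    (h : ∀ᶠ t in 𝓝 (0 : ℝ), ∀ i j, HasDerivAt (fun s => Γ s i j) (Γ' t i j) t)
    (h' : ∀ i j, HasDerivAt (fun s => Γ' s i j)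
      (((2 : ℝ) • C + Matrix.diagonal (fun i => 4 * β i ^ 2) : Matrix ι ι ℝ) i j) 0)
    (h0 : Γ 0 = 1) (h0' : Γ' 0 = Matrix.diagonal fun i => 2 * β i)
    (k : ℕ) (ζ : (Fin k → ι) → ℝ) :
    ∃ q' : ℝ → ℝ,
      (∀ᶠ t in 𝓝 (0 : ℝ), HasDerivAt (fun s => √(Γ s).det * gramForm k (Γ s)⁻¹ ζ ζ) (q' t) t) ∧
      q' 0 = -((1 / (k.factorial : ℝ)) * ∑ I, (2 * ∑ a, β (I a) - ∑ i, β i) * ζ I ^ 2) ∧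
      HasDerivAt q' ((1 / (k.factorial : ℝ)) * ∑ I, (2 * ∑ a, β (I a) - ∑ i, β i) ^ 2 * ζ I ^ 2
        - ((∑ j, ∑ m, C j m * (2 * contr ζ j m))
          - C.trace * ((1 / (k.factorial : ℝ)) * ∑ I, ζ I ^ 2))) 0 := by
  let K : ℝ → Matrix ι ι ℝ := fun t => (Γ t)⁻¹
  let K' : ℝ → Matrix ι ι ℝ := fun t => -((Γ t)⁻¹ * Γ' t * (Γ t)⁻¹)
  have hd0 : (Γ 0).det = 1 := by rw [h0, Matrix.det_one]
  have hpos : ∀ᶠ t in 𝓝 (0 : ℝ), 0 < (Γ t).det :=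
    (hasDerivAt_det h.self_of_nhds).continuousAt.eventually_const_lt
      (show 0 < (Γ 0).det by rw [hd0]; norm_num)
  have hK : ∀ᶠ t in 𝓝 (0 : ℝ), ∀ i j, HasDerivAt (fun s => K s i j) (K' t i j) t := by
    filter_upwards [h, hpos] with t ht hp i j
    exact hasDerivAt_inv_apply ht hp.ne' i j
  let w : ℝ → ℝ := fun t => √(Γ t).det
  let w' : ℝ → ℝ := fun t => (1 / 2) * (w t * (K t * Γ' t).trace)
  have hw : ∀ᶠ t in 𝓝 (0 : ℝ), HasDerivAt w (w' t) t := by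
    filter_upwards [h, hpos] with t ht hp
    exact hasDerivAt_sqrt_det ht hp
  let D : Matrix ι ι ℝ := Matrix.diagonal fun i => 2 * β i
  let Γ'' : Matrix ι ι ℝ := (2 : ℝ) • C + Matrix.diagonal fun i => 4 * β i ^ 2
  have hK0 : K 0 = 1 := by simp [K, h0]
  have hK'0 : K' 0 = Matrix.diagonal fun i => -(2 * β i) := by
    simp [K', h0, h0', Matrix.diagonal_neg]
  have hw0 : w 0 = 1 := by simp [w, hd0]
  have hmul : ∀ {A A' B B' : ℝ → Matrix ι ι ℝ} (_ : ∀ i j, HasDerivAt (fun s => A s i j) (A' 0 i j) 0)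
      (_ : ∀ i j, HasDerivAt (fun s => B s i j) (B' 0 i j) 0) (i j : ι),
      HasDerivAt (fun s => (A s * B s) i j) ((A' 0 * B 0 + A 0 * B' 0) i j) 0 := by
    intro A A' B B' hA hB i j
    simp only [Matrix.mul_apply, Matrix.add_apply, ← Finset.sum_add_distrib]
    exact HasDerivAt.fun_sum fun l _ => (hA i l).mul (hB l j)
  have hKΓ : ∀ i j, HasDerivAt (fun s => (K s * Γ' s) i j) ((K' 0 * Γ' 0 + K 0 * Γ'') i j) 0 :=
    hmul (B' := fun _ => Γ'') hK.self_of_nhds h'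
  -- At the identity `(Γ⁻¹)'' = 2 Γ'² - Γ''`, that is, `8 β² - (2C + 4 β²)`.
  let K'' : Matrix ι ι ℝ := -((2 : ℝ) • C) + Matrix.diagonal fun i => 4 * β i ^ 2
  have hK'' : ∀ i j, HasDerivAt (fun s => K' s i j) (K'' i j) 0 := by
    intro i j
    have h2 := hmul (A' := fun _ => K' 0 * Γ' 0 + K 0 * Γ'') hKΓ hK.self_of_nhds i j
    refine h2.neg.congr_deriv ?_
    have e : K'' = -((K' 0 * Γ' 0 + K 0 * Γ'') * K 0 + K 0 * Γ' 0 * K' 0) := by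
      rw [hK0, hK'0, h0', Matrix.mul_one, Matrix.one_mul, Matrix.one_mul,
        Matrix.diagonal_mul_diagonal, Matrix.diagonal_mul_diagonal]
      ext a b
      by_cases hab : a = b
      · subst hab
        simp [K'', Γ'']; ring
      · simp [K'', Γ'', hab]
    rw [e]; rfl
  -- In `½ (w tr(K Γ'))'` the terms `-4 β²` from `K' Γ'` and `4 β²` from `Γ''` cancel, leaving `(∑
  -- β)²` and the trace of `C`.
  have hw' : HasDerivAt w' ((∑ i, β i) ^ 2 + C.trace) 0 := by
    have h1 : HasDerivAt (fun s => (K s * Γ' s).trace) (K' 0 * Γ' 0 + K 0 * Γ'').trace 0 :=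
      HasDerivAt.fun_sum fun i _ => hKΓ i i
    refine ((hw.self_of_nhds.mul h1).const_mul (1 / 2 : ℝ)).congr_deriv ?_
    simp only [w', hw0, hK0, hK'0, h0', Γ'', Matrix.diagonal_mul_diagonal,
      Matrix.trace_add, Matrix.trace_smul, Matrix.trace_diagonal, one_mul, ← Finset.mul_sum,
      smul_eq_mul, neg_mul, Finset.sum_neg_distrib]
    rw [Finset.sum_congr rfl fun i _ => show 2 * β i * (2 * β i) = 4 * β i ^ 2 by ring,
      ← Finset.mul_sum]
    ring
  let N : ℝ → ℝ := fun t => gramForm k (K t) ζ ζ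
  let N' : ℝ → ℝ := fun t => gramFormDeriv k (K t) (K' t) ζ ζ
  have hN : ∀ᶠ t in 𝓝 (0 : ℝ), HasDerivAt N (N' t) t :=
    hK.mono fun t ht => hasDerivAt_gramForm ht k ζ ζ
  have hN' := hasDerivAt_gramFormDeriv hK.self_of_nhds hK'' k ζ ζ
  have hN0 : N 0 = (1 / (k.factorial : ℝ)) * ∑ I, ζ I ^ 2 := by
    simp only [N, hK0, gramForm_one, pow_two]
  have hN'0 : N' 0 = -((1 / (k.factorial : ℝ)) * ∑ I, (2 * ∑ a, β (I a)) * ζ I ^ 2) := by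
    have : N' 0 = ∑ j, -(2 * β j) * contr ζ j j := by
      simp only [N', hK0, hK'0, gramFormDeriv_one_eq_contr]
      refine Finset.sum_congr rfl fun j _ => ?_
      rw [Finset.sum_eq_single j]
      · rw [Matrix.diagonal_apply_eq]
      · intro m _ hm; rw [Matrix.diagonal_apply_ne _ hm.symm, zero_mul]
      · simp
    rw [this, sum_contr_diagonal k (fun j => -(2 * β j))]
    simp only [Finset.sum_neg_distrib, neg_mul, mul_neg, Finset.mul_sum]
  have hw'0 : w' 0 = ∑ i, β i := by
    simp [w', hw0, hK0, h0', ← Finset.mul_sum]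
  refine ⟨fun t => w' t * N t + w t * N' t, ?_, ?_, ?_⟩
  · filter_upwards [hw, hN] with t h1 h2
    exact h1.mul h2
  · simp only [hw'0, hN0, hw0, hN'0, one_mul]
    simp only [sub_mul, Finset.sum_sub_distrib, ← Finset.mul_sum]
    ring
  · have h4 := (hw'.fun_mul hN.self_of_nhds).fun_add (hw.self_of_nhds.fun_mul hN')
    refine h4.congr_deriv ?_
    have hK''c : gramFormDeriv k 1 K'' ζ ζ = -(∑ j, ∑ m, C j m * (2 * contr ζ j m))
        + (1 / (k.factorial : ℝ)) * ∑ I, (∑ a, 4 * β (I a) ^ 2) * ζ I ^ 2 := by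
      rw [gramFormDeriv_one_eq_contr, ← sum_contr_diagonal k (fun j => 4 * β j ^ 2),
        ← Finset.sum_neg_distrib, ← Finset.sum_add_distrib]
      refine Finset.sum_congr rfl fun j _ => ?_
      have : 4 * β j ^ 2 * contr ζ j j =
          ∑ m, Matrix.diagonal (fun i => 4 * β i ^ 2) j m * contr ζ j m := by
        rw [Finset.sum_eq_single j]
        · rw [Matrix.diagonal_apply_eq]
        · intro m _ hm; rw [Matrix.diagonal_apply_ne _ hm.symm, zero_mul]
        · simp
      rw [this, ← Finset.sum_neg_distrib, ← Finset.sum_add_distrib]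
      refine Finset.sum_congr rfl fun m _ => ?_
      simp [K'']; ring
    rw [show gramFormDeriv k (K 0) (K' 0) ζ ζ = N' 0 from rfl, hN'0, hK0, hK'0, hw'0, hN0, hw0,
      hK''c, gramFormDeriv₂_one_diagonal]
    -- The square of the eigenvalue is assembled from all second order terms: pairs of distinct
    -- slots and the term `4 β²` of `K''` give `4 (∑ β(I a))²`, the product `2 w' N'` gives the
    -- mixed term, and `w''` gives `(∑ β)²`.
    have hI : ∀ I : Fin k → ι, (2 * ∑ a, β (I a) - ∑ i, β i) ^ 2 * ζ I ^ 2 =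
        (((∑ a, -(2 * β (I a))) ^ 2 - ∑ a, (-(2 * β (I a))) ^ 2) * ζ I ^ 2
          + (∑ a, 4 * β (I a) ^ 2) * ζ I ^ 2) - (∑ i, β i) * (2 * ((2 * ∑ a, β (I a)) * ζ I ^ 2))
          + (∑ i, β i) ^ 2 * ζ I ^ 2 := by
      intro I
      rw [Finset.sum_neg_distrib, ← Finset.mul_sum,
        Finset.sum_congr rfl fun a _ => show (-(2 * β (I a))) ^ 2 = 4 * β (I a) ^ 2 by ring]
      ring
    rw [Finset.sum_congr rfl fun I _ => hI I]
    simp only [Finset.sum_add_distrib, Finset.sum_sub_distrib, ← Finset.mul_sum]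
    ring

end MatrixCalculus

/-! ### Taylor expansion with an explicit remainder -/

section TaylorBound

lemma norm_sub_le_mul_abs {g g' : ℝ → ℝ} {ε C T : ℝ}
    (h : ∀ t ∈ Set.Ioo (-ε) ε, HasDerivAt g (g' t) t) (hT : T ∈ Set.Ioo (-ε) ε)
    (hC : ∀ t, |t| ≤ |T| → |g' t| ≤ C) : |g T - g 0| ≤ C * |T| := by
  have hsub : ∀ t ∈ Set.Icc (-|T|) |T|, t ∈ Set.Ioo (-ε) ε := by
    intro t ht
    have := abs_lt.2 hT
    exact ⟨by linarith [ht.1], by linarith [ht.2]⟩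
  have := Convex.norm_image_sub_le_of_norm_hasDerivWithin_le (f := g) (f' := g') (C := C)
    (s := Set.Icc (-|T|) |T|) (x := 0) (y := T)
    (fun t ht => (h t (hsub t ht)).hasDerivWithinAt) (fun t ht => hC t (abs_le.2 ht))
    (convex_Icc _ _) ⟨by simp, by simp⟩ (abs_le.1 le_rfl)
  simpa using this

/-- The mean value inequality is used three times, once per derivative; the constant `C` instead of
`C / 6` suffices. -/
lemma abs_sub_taylor_two_le {g g₁ g₂ g₃ : ℝ → ℝ} {ε C : ℝ}
    (h : ∀ t ∈ Set.Ioo (-ε) ε, HasDerivAt g (g₁ t) t)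
    (h₁ : ∀ t ∈ Set.Ioo (-ε) ε, HasDerivAt g₁ (g₂ t) t)
    (h₂ : ∀ t ∈ Set.Ioo (-ε) ε, HasDerivAt g₂ (g₃ t) t)
    (hC : ∀ t ∈ Set.Ioo (-ε) ε, |g₃ t| ≤ C) {T : ℝ} (hT : T ∈ Set.Ioo (-ε) ε) :
    |g T - g 0 - T * g₁ 0 - T ^ 2 / 2 * g₂ 0| ≤ C * |T| ^ 3 := by
  have hin : ∀ {t T : ℝ}, T ∈ Set.Ioo (-ε) ε → |t| ≤ |T| → t ∈ Set.Ioo (-ε) ε :=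
    fun hT ht => abs_lt.1 (ht.trans_lt (abs_lt.2 hT))
  have hC0 : 0 ≤ C := (abs_nonneg _).trans (hC T hT)
  have e2 : ∀ T ∈ Set.Ioo (-ε) ε, |g₂ T - g₂ 0| ≤ C * |T| := fun T hT =>
    norm_sub_le_mul_abs h₂ hT fun t ht => hC t (hin hT ht)
  have e1 : ∀ T ∈ Set.Ioo (-ε) ε, |g₁ T - g₁ 0 - T * g₂ 0| ≤ C * |T| ^ 2 := by
    intro T hT
    have := norm_sub_le_mul_abs (g := fun t => g₁ t - g₁ 0 - t * g₂ 0)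
      (g' := fun t => g₂ t - g₂ 0) (C := C * |T|)
      (fun t ht => (((h₁ t ht).sub_const _).sub ((hasDerivAt_id t).mul_const (g₂ 0))).congr_deriv
        (by ring)) hT
      (fun t ht => (e2 t (hin hT ht)).trans (by gcongr))
    convert this using 1 <;> [(congr 1; simp); ring]
  have := norm_sub_le_mul_abs (g := fun t => g t - g 0 - t * g₁ 0 - t ^ 2 / 2 * g₂ 0)
      (g' := fun t => g₁ t - g₁ 0 - t * g₂ 0) (C := C * |T| ^ 2)
      (fun t ht => ((((h t ht).sub_const _).sub ((hasDerivAt_id t).mul_const (g₁ 0))).sub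
        ((((hasDerivAt_id t).pow 2).div_const 2).mul_const (g₂ 0))).congr_deriv
        (by simp)) hT
      (fun t ht => (e1 t (hin hT ht)).trans (by gcongr))
  convert this using 1 <;> [(congr 1; simp); ring]

end TaylorBound

/-! ### Local flows in a Banach space, with their differentials -/

section LocalFlow

variable {E : Type*} [NormedAddCommGroup E] [NormedSpace ℝ E]

/-- The vector field on `E × End E` whose integral curves through `(u, 1)` are the integral curve
of `X` through `u` together with the derivative of the flow along it. -/
def variationalField (X : E → E) (p : E × (E →L[ℝ] E)) : E × (E →L[ℝ] E) :=
  (X p.1, (fderiv ℝ X p.1).comp p.2)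

lemma contDiffAt_variationalField {X : E → E} {p : E × (E →L[ℝ] E)}
    (hX : ContDiffAt ℝ ∞ X p.1) : ContDiffAt ℝ ∞ (variationalField X) p := by
  have h1 : ContDiffAt ℝ ∞ (fun q : E × (E →L[ℝ] E) => X q.1) p := hX.comp p contDiffAt_fst
  have h2 : ContDiffAt ℝ ∞ (fun q : E × (E →L[ℝ] E) => fderiv ℝ X q.1) p :=
    (hX.fderiv_right (m := ∞) (by simp)).comp p contDiffAt_fst
  exact h1.prodMk (h2.clm_comp contDiffAt_snd)

lemma hasFDerivAt_of_remainder_bound {Φ : E → E} {D : E →L[ℝ] E} {u : E} {C r : ℝ} (hr : 0 < r)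
    (h : ∀ v ∈ Metric.ball u r, ‖Φ v - Φ u - D (v - u)‖ ≤ C * ‖v - u‖ ^ 2) :
    HasFDerivAt Φ D u := by
  rw [hasFDerivAt_iff_isLittleO]
  refine (Asymptotics.IsBigO.of_bound C (g := fun v => ‖v - u‖ ^ 2) ?_).trans_isLittleO ?_
  · filter_upwards [Metric.ball_mem_nhds u hr] with v hv
    simpa using h v hv
  · exact Asymptotics.isLittleO_pow_sub_sub u (m := 2) (by norm_num)

/-- Linear estimate for a curve with `‖r'‖ ≤ K ‖r‖ + c` starting at `0`, in both time directions. -/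
lemma norm_le_of_norm_deriv_le {f f' : ℝ → E} {K c ε : ℝ} (hK : 0 ≤ K) (hc : 0 ≤ c)
    (hf : ∀ t ∈ Set.Ioo (-ε) ε, HasDerivAt f (f' t) t) (h0 : f 0 = 0)
    (bound : ∀ t ∈ Set.Ioo (-ε) ε, ‖f' t‖ ≤ K * ‖f t‖ + c) {t : ℝ} (ht : t ∈ Set.Ioo (-ε) ε) :
    ‖f t‖ ≤ c * gronwallBound 0 K 1 ε := by
  -- With initial value zero the Gronwall bound is linear in the inhomogeneity. The factor `c` is
  -- what later becomes quadratic in the displacement of the initial point.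
  have hlin : ∀ x, gronwallBound 0 K c x = c * gronwallBound 0 K 1 x := by
    intro x
    by_cases h : K = 0
    · subst h; simp [gronwallBound_K0]
    · rw [gronwallBound_of_K_ne_0 h, gronwallBound_of_K_ne_0 h]; ring
  have hpos : ∀ (g g' : ℝ → E), (∀ t ∈ Set.Ioo (-ε) ε, HasDerivAt g (g' t) t) → g 0 = 0 →
      (∀ t ∈ Set.Ioo (-ε) ε, ‖g' t‖ ≤ K * ‖g t‖ + c) → ∀ t ∈ Set.Ico 0 ε,
      ‖g t‖ ≤ c * gronwallBound 0 K 1 ε := by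
    intro g g' hg hg0 hb t ht
    have hin : ∀ s ∈ Set.Icc 0 t, s ∈ Set.Ioo (-ε) ε := fun s hs =>
      ⟨by linarith [hs.1, ht.1, ht.2], hs.2.trans_lt ht.2⟩
    have := norm_le_gronwallBound_of_norm_deriv_right_le (f := g) (f' := g') (δ := 0) (K := K)
      (ε := c) (a := 0) (b := t) (fun s hs => (hg s (hin s hs)).continuousAt.continuousWithinAt)
      (fun s hs => (hg s (hin s (Set.Ico_subset_Icc_self hs))).hasDerivWithinAt) (by simp [hg0])
      (fun s hs => hb s (hin s (Set.Ico_subset_Icc_self hs))) t ⟨ht.1, le_rfl⟩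
    rw [hlin, sub_zero] at this
    refine this.trans (mul_le_mul_of_nonneg_left ?_ hc)
    exact gronwallBound_mono le_rfl zero_le_one hK ht.2.le
  rcases le_total 0 t with h | h
  · exact hpos f f' hf h0 bound t ⟨h, ht.2⟩
  · have hneg : ∀ s ∈ Set.Ioo (-ε) ε, -s ∈ Set.Ioo (-ε) ε := fun s hs =>
      ⟨by linarith [hs.2], by linarith [hs.1]⟩
    have := hpos (fun s => f (-s)) (fun s => -f' (-s))
      (fun s hs => by
        have := (hf (-s) (hneg s hs)).scomp s (hasDerivAt_neg s)
        exact (by simpa using this : HasDerivAt (f ∘ Neg.neg) (-f' (-s)) s)) (by simpa using h0)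
      (fun s hs => by simpa using bound (-s) (hneg s hs)) (-t) ⟨by linarith, by linarith [ht.1]⟩
    simpa using this

variable [CompleteSpace E]

/-- Picard–Lindelöf for `variationalField` yields the flow together with the candidate for its
differential. The candidate is correct by Gronwall: the remainder `s_v - s_u - D_u (v - u)` starts
at zero and satisfies a linear differential inequality with inhomogeneity of order `‖v - u‖²`. The
set `W` is where the trajectories are required to stay. -/
theorem exists_local_flow {X : E → E} {u₀ : E} (hX : ContDiffAt ℝ ∞ X u₀)
    {W : Set (E × (E →L[ℝ] E))} (hW : W ∈ 𝓝 (u₀, ContinuousLinearMap.id ℝ E)) :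
    ∃ r > 0, ∃ ε > 0, ∃ R > 0, ∃ s : E → ℝ → E × (E →L[ℝ] E),
      Metric.closedBall (u₀, ContinuousLinearMap.id ℝ E) R ⊆ W ∧
      ∀ u ∈ Metric.ball u₀ r, s u 0 = (u, ContinuousLinearMap.id ℝ E) ∧
        ∀ t ∈ Set.Ioo (-ε) ε, HasDerivAt (s u) (variationalField X (s u t)) t ∧
          s u t ∈ Metric.closedBall (u₀, ContinuousLinearMap.id ℝ E) R ∧
          HasFDerivAt (fun v => (s v t).1) (s u t).2 u ∧
          ContinuousAt (fun v => s v t) u := by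
  set p₀ : E × (E →L[ℝ] E) := (u₀, ContinuousLinearMap.id ℝ E) with hp₀
  have hV : ContDiffAt ℝ ∞ (variationalField X) p₀ := contDiffAt_variationalField hX
  -- bounds for the derivatives of `X`
  have hX1 : ContDiffAt ℝ 1 (fderiv ℝ X) u₀ := hX.fderiv_right (by
    rw [one_add_one_eq_two]; exact ENat.LEInfty.out)
  obtain ⟨K₂, N, hN, hlip⟩ := hX1.exists_lipschitzOnWith
  have hdiff : ∀ᶠ u in 𝓝 u₀, DifferentiableAt ℝ X u :=
    ((hX.of_le (m := 1) (by exact_mod_cast le_top)).eventually (by simp)).mono fun u hu =>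
      hu.differentiableAt (by simp)
  have hbd : ∀ᶠ u in 𝓝 u₀, ‖fderiv ℝ X u‖ < ‖fderiv ℝ X u₀‖ + 1 :=
    hX1.continuousAt.norm.eventually_lt_const (by linarith)
  obtain ⟨R₁, hR₁, hball⟩ := Metric.mem_nhds_iff.1 (Filter.inter_mem hN (Filter.inter_mem hdiff hbd))
  obtain ⟨R₂, hR₂, hW₂⟩ := Metric.nhds_basis_closedBall.mem_iff.1 hW
  set R := min (R₁ / 2) R₂ with hR
  have hRpos : 0 < R := lt_min (by linarith) hR₂
  -- the flow
  obtain ⟨ε₀, hε₀, a, r₀, L, K, hr₀, hpl⟩ :=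
    IsPicardLindelof.of_contDiffAt_one (hV.of_le (m := 1) (by exact_mod_cast le_top))
  obtain ⟨α, hα, L', hL'⟩ := (hpl 0).exists_forall_mem_closedBall_eq_hasDerivWithinAt_lipschitzOnWith
  have hcont : ContinuousOn (Function.uncurry α)
      (Metric.closedBall p₀ r₀ ×ˢ Set.Icc (0 - ε₀) (0 + ε₀)) :=
    continuousOn_prod_of_continuousOn_lipschitzOnWith _ L'
      (fun x hx => HasDerivWithinAt.continuousOn (hα x hx).2) hL'
  have hnhds : Metric.closedBall p₀ r₀ ×ˢ Set.Icc (0 - ε₀) (0 + ε₀) ∈ 𝓝 (p₀, (0 : ℝ)) :=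
    prod_mem_nhds (Metric.closedBall_mem_nhds _ hr₀) (Icc_mem_nhds (by linarith) (by linarith))
  have hcont0 : ContinuousAt (Function.uncurry α) (p₀, 0) := hcont.continuousAt hnhds
  have hα0 : α p₀ 0 = p₀ := (hα p₀ (Metric.mem_closedBall_self hr₀.le)).1
  have hev : ∀ᶠ q in 𝓝 (p₀, (0 : ℝ)), Function.uncurry α q ∈ Metric.closedBall p₀ R :=
    hcont0.eventually_mem (by
      rw [Function.uncurry_apply_pair, hα0]
      exact Metric.closedBall_mem_nhds _ hRpos)
  -- Products carry the sup metric, so one `δ` serves both as radius for the initial points and as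
  -- time bound.
  obtain ⟨δ, hδ, hδball⟩ := Metric.mem_nhds_iff.1 (Filter.inter_mem hnhds hev)
  have hmem : ∀ u ∈ Metric.ball u₀ δ, ∀ t ∈ Set.Ioo (-δ) δ,
      ((u, ContinuousLinearMap.id ℝ E), t) ∈ Metric.ball (p₀, (0 : ℝ)) δ := by
    intro u hu t ht
    rw [Metric.mem_ball, Prod.dist_eq, Prod.dist_eq, Real.dist_eq, sub_zero]
    simp only [hp₀, dist_self]
    exact max_lt (max_lt hu hδ) (abs_lt.2 ht)
  have hδε : δ ≤ ε₀ := by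
    by_contra! hlt
    have := (hδball (hmem u₀ (Metric.mem_ball_self hδ) ((ε₀ + δ) / 2)
      ⟨by linarith, by linarith⟩)).1.2.2
    simp only at this
    linarith
  let s : E → ℝ → E × (E →L[ℝ] E) := fun u t => α (u, ContinuousLinearMap.id ℝ E) t
  have hin : ∀ u ∈ Metric.ball u₀ δ, (u, ContinuousLinearMap.id ℝ E) ∈ Metric.closedBall p₀ r₀ :=
    fun u hu => (hδball (hmem u hu 0 ⟨by linarith, hδ⟩)).1.1
  have hK : ∀ u ∈ Metric.ball u₀ δ, ∀ t ∈ Set.Ioo (-δ) δ, s u t ∈ Metric.closedBall p₀ R :=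
    fun u hu t ht => (hδball (hmem u hu t ht)).2
  have hK1 : ∀ u ∈ Metric.ball u₀ δ, ∀ t ∈ Set.Ioo (-δ) δ, (s u t).1 ∈ Metric.ball u₀ R₁ := by
    intro u hu t ht
    have h1 := hK u hu t ht
    rw [Metric.mem_closedBall, Prod.dist_eq] at h1
    rw [Metric.mem_ball]
    calc dist (s u t).1 u₀ ≤ R := (le_max_left _ _).trans h1
      _ ≤ R₁ / 2 := min_le_left _ _
      _ < R₁ := by linarith
  have hd : ∀ u ∈ Metric.ball u₀ δ, ∀ t ∈ Set.Ioo (-δ) δ,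
      HasDerivAt (s u) (variationalField X (s u t)) t := by
    intro u hu t ht
    have h1 := (hα _ (hin u hu)).2 t ⟨by linarith [ht.1], by linarith [ht.2]⟩
    exact h1.hasDerivAt (Icc_mem_nhds (by linarith [ht.1]) (by linarith [ht.2]))
  have hs0 : ∀ u ∈ Metric.ball u₀ δ, s u 0 = (u, ContinuousLinearMap.id ℝ E) :=
    fun u hu => (hα _ (hin u hu)).1
  have hsl : ∀ u ∈ Metric.ball u₀ δ, ∀ v ∈ Metric.ball u₀ δ, ∀ t ∈ Set.Ioo (-δ) δ,
      ‖(s v t).1 - (s u t).1‖ ≤ L' * ‖v - u‖ := by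
    intro u hu v hv t ht
    have h1 := (hL' t ⟨by linarith [ht.1], by linarith [ht.2]⟩).dist_le_mul _ (hin v hv) _ (hin u hu)
    rw [Prod.dist_eq, Prod.dist_eq] at h1
    simp only [dist_self, dist_eq_norm] at h1
    refine (le_max_left _ _).trans (h1.trans ?_)
    rw [max_eq_left (norm_nonneg _)]
  -- Second order estimate for `X` from the Lipschitz bound on its derivative, applied along the
  -- segment from `a` to `b`.
  have hquad : ∀ a ∈ Metric.ball u₀ R₁, ∀ b ∈ Metric.ball u₀ R₁,
      ‖X b - X a - fderiv ℝ X a (b - a)‖ ≤ K₂ * ‖b - a‖ ^ 2 := by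
    intro a ha b hb
    have hseg : segment ℝ a b ⊆ Metric.ball u₀ R₁ := (convex_ball _ _).segment_subset ha hb
    have h1 := Convex.norm_image_sub_le_of_norm_fderiv_le' (𝕜 := ℝ) (f := X)
      (φ := fderiv ℝ X a) (C := K₂ * ‖b - a‖) (s := segment ℝ a b) (x := a) (y := b)
      (fun x hx => (hball (hseg hx)).2.1) (fun x hx => ?_) (convex_segment a b)
      (left_mem_segment ℝ a b) (right_mem_segment ℝ a b)
    · rw [pow_two, ← mul_assoc]; exact h1
    · have h2 := hlip.dist_le_mul _ (hball (hseg hx)).1 _ (hball ha).1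
      rw [dist_eq_norm, dist_eq_norm] at h2
      refine h2.trans (mul_le_mul_of_nonneg_left ?_ K₂.2)
      obtain ⟨θ, hθ, rfl⟩ := (segment_eq_image_lineMap ℝ a b ▸ hx :)
      rw [AffineMap.lineMap_apply_module', add_sub_cancel_right, norm_smul]
      refine mul_le_of_le_one_left (norm_nonneg _) ?_
      rw [Real.norm_of_nonneg hθ.1]; exact hθ.2
  refine ⟨δ, hδ, δ, hδ, R, hRpos, s, ?_, fun u hu => ⟨hs0 u hu, fun t ht =>
    ⟨hd u hu t ht, hK u hu t ht, ?_, ?_⟩⟩⟩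
  · exact (Metric.closedBall_subset_closedBall (min_le_right _ _)).trans hW₂
  · obtain ⟨ρ, hρ, hρball⟩ := Metric.mem_nhds_iff.1 (Metric.isOpen_ball.mem_nhds hu)
    refine hasFDerivAt_of_remainder_bound (r := ρ)
      (C := K₂ * L' ^ 2 * gronwallBound 0 (‖fderiv ℝ X u₀‖ + 1) 1 δ) hρ fun v hv => ?_
    have hv' := hρball hv
    have h1 := norm_le_of_norm_deriv_le (K := ‖fderiv ℝ X u₀‖ + 1) (c := K₂ * (L' * ‖v - u‖) ^ 2)
      (f := fun τ => (s v τ).1 - (s u τ).1 - (s u τ).2 (v - u))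
      (f' := fun τ => X (s v τ).1 - X (s u τ).1 - fderiv ℝ X (s u τ).1 ((s u τ).2 (v - u)))
      (ε := δ) (by positivity) (by positivity) ?_ ?_ ?_ ht
    · refine h1.trans (le_of_eq (by ring))
    · intro τ hτ
      have d1 := hd v hv' τ hτ
      have d2 := hd u hu τ hτ
      have d3 : HasDerivAt (fun τ => (s u τ).2 (v - u))
          ((fderiv ℝ X (s u τ).1) ((s u τ).2 (v - u))) τ :=
        ((ContinuousLinearMap.apply ℝ E (v - u)).hasFDerivAt.comp_hasDerivAt τ
          (d2.hasFDerivAt.snd.hasDerivAt) :).congr_deriv (by simp [variationalField])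
      have d4 : HasDerivAt (fun τ => (s v τ).1) (X (s v τ).1) τ :=
        (d1.hasFDerivAt.fst.hasDerivAt).congr_deriv (by simp [variationalField])
      have d5 : HasDerivAt (fun τ => (s u τ).1) (X (s u τ).1) τ :=
        (d2.hasFDerivAt.fst.hasDerivAt).congr_deriv (by simp [variationalField])
      exact (d4.sub d5).sub d3
    · simp [hs0 u hu, hs0 v hv']
    · intro τ hτ
      -- The derivative of the remainder is linear in the remainder, up to the second order error of
      -- `X` between the two trajectories.
      have e : X (s v τ).1 - X (s u τ).1 - fderiv ℝ X (s u τ).1 ((s u τ).2 (v - u)) =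
          fderiv ℝ X (s u τ).1 ((s v τ).1 - (s u τ).1 - (s u τ).2 (v - u)) +
          (X (s v τ).1 - X (s u τ).1 - fderiv ℝ X (s u τ).1 ((s v τ).1 - (s u τ).1)) := by
        simp only [map_sub]; abel
      rw [e]
      refine (norm_add_le _ _).trans (add_le_add ?_ ?_)
      · refine (ContinuousLinearMap.le_opNorm _ _).trans ?_
        exact mul_le_mul_of_nonneg_right (hball (hK1 u hu τ hτ)).2.2.le (norm_nonneg _)
      · refine (hquad _ (hK1 u hu τ hτ) _ (hK1 v hv' τ hτ)).trans ?_
        refine mul_le_mul_of_nonneg_left ?_ K₂.2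
        exact pow_le_pow_left₀ (norm_nonneg _) (hsl u hu v hv' τ hτ) 2
  · have h1 : ContinuousOn (fun p => α p t) (Metric.closedBall p₀ r₀) :=
      (hL' t ⟨by linarith [ht.1], by linarith [ht.2]⟩).continuousOn
    have h2 : ContinuousOn (fun v => s v t) (Metric.ball u₀ δ) :=
      h1.comp (f := fun v : E => (v, ContinuousLinearMap.id ℝ E)) (by fun_prop) hin
    exact h2.continuousAt (Metric.isOpen_ball.mem_nhds hu)

end LocalFlow

/-! ### Vector fields in the coordinates of a chart -/

section Charts

variable {n : ℕ} {M : Type*} [TopologicalSpace M] [ChartedSpace (EuclideanSpace ℝ (Fin n)) M]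
  [IsManifold (𝓡 n) ∞ M]

/-- Smoothness of a vector field on a set. -/
def SmoothOn (U : Set M) (F : ∀ x : M, TangentSpace (𝓡 n) x) : Prop :=
  ContMDiffOn (𝓡 n) (𝓡 n).tangent ∞ (fun x => (⟨x, F x⟩ : TangentBundle (𝓡 n) M)) U

/-- The components of a vector field in the chart at `p`. -/
def coord (p : M) (F : ∀ x : M, TangentSpace (𝓡 n) x) (y : M) : EuclideanSpace ℝ (Fin n) :=
  mfderiv (𝓡 n) (𝓡 n) (chartAt (EuclideanSpace ℝ (Fin n)) p) y (F y)

/-- The differential of the inverse of the chart at `p`. -/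
def chartFrame (p : M) (u : EuclideanSpace ℝ (Fin n)) : EuclideanSpace ℝ (Fin n) →L[ℝ]
    TangentSpace (𝓡 n) ((chartAt (EuclideanSpace ℝ (Fin n)) p).symm u) :=
  mfderiv (𝓡 n) (𝓡 n) (chartAt (EuclideanSpace ℝ (Fin n)) p).symm u

/-- A vector field in the coordinates of the chart at `p`. -/
def fieldRep (p : M) (F : ∀ x : M, TangentSpace (𝓡 n) x) (u : EuclideanSpace ℝ (Fin n)) :
    EuclideanSpace ℝ (Fin n) :=
  coord p F ((chartAt (EuclideanSpace ℝ (Fin n)) p).symm u)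

/-- The vector field with constant components `a` in the chart at `p`. -/
def coordField (p : M) (a : EuclideanSpace ℝ (Fin n)) (y : M) : TangentSpace (𝓡 n) y :=
  FiberBundle.extend (E := fun x : M => TangentSpace (𝓡 n) x) (EuclideanSpace ℝ (Fin n)) (x := p) a y

variable {p y : M} {u : EuclideanSpace ℝ (Fin n)} {F G : ∀ x : M, TangentSpace (𝓡 n) x} {U : Set M}

lemma mdifferentiable_chartAt (p : M) :
    (chartAt (EuclideanSpace ℝ (Fin n)) p).MDifferentiable (𝓡 n) (𝓡 n) :=
  haveI : IsManifold (𝓡 n) 1 M := .of_le (n := ∞) ENat.LEInfty.out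
  mdifferentiable_chart p

/-- Smoothness of sections is formulated with the trivialization of the tangent bundle, computations
use the differential of the chart; on the chart domain they coincide. -/
lemma trivializationAt_snd_eq (hy : y ∈ (chartAt (EuclideanSpace ℝ (Fin n)) p).source)
    (w : TangentSpace (𝓡 n) y) :
    (trivializationAt (EuclideanSpace ℝ (Fin n)) (fun x : M => TangentSpace (𝓡 n) x) p
      (⟨y, w⟩ : TangentBundle (𝓡 n) M)).2 =
      mfderiv (𝓡 n) (𝓡 n) (chartAt (EuclideanSpace ℝ (Fin n)) p) y w := by
  have h := TangentBundle.continuousLinearMapAt_trivializationAt (I := 𝓡 n) hy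
  have h2 := Trivialization.continuousLinearMapAt_apply_of_mem (R := ℝ)
    (e := trivializationAt (EuclideanSpace ℝ (Fin n)) (fun x : M => TangentSpace (𝓡 n) x) p)
    (b := y) (by simpa using hy)
  rw [← h2, h]
  rfl

/-- The extension of a tangent vector at `p` is constant in the chart at `p`. The extensions inside
`curvature` and `covDerivEnd` are therefore coordinate fields, and their brackets vanish. -/
lemma coord_coordField (hy : y ∈ (chartAt (EuclideanSpace ℝ (Fin n)) p).source)
    (a : EuclideanSpace ℝ (Fin n)) : coord p (coordField p a) y = a := by
  have h1 := (trivializationAt_snd_eq (n := n) (mem_chart_source (EuclideanSpace ℝ (Fin n)) p) a)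
  have h2 : mfderiv (𝓡 n) (𝓡 n) (chartAt (EuclideanSpace ℝ (Fin n)) p) p a = a := by
    have := mfderiv_extChartAt_self (I := 𝓡 n) (x := p)
    exact congrArg (fun L => L a) this
  rw [coord, ← trivializationAt_snd_eq hy]
  have h3 := (trivializationAt (EuclideanSpace ℝ (Fin n)) (fun x : M => TangentSpace (𝓡 n) x)
    p).apply_mk_symm (b := y) (by simpa using hy) a
  have h4 : coordField p a y = (trivializationAt (EuclideanSpace ℝ (Fin n))
    (fun x : M => TangentSpace (𝓡 n) x) p).symm y a := by
    rw [coordField]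
    exact congrArg _ (h1.trans h2)
  rw [h4]
  exact congrArg Prod.snd h3

lemma smoothOn_iff_coord (hUo : IsOpen U)
    (hU : U ⊆ (chartAt (EuclideanSpace ℝ (Fin n)) p).source) :
    SmoothOn U F ↔ ContMDiffOn (𝓡 n) 𝓘(ℝ, EuclideanSpace ℝ (Fin n)) ∞ (coord p F) U := by
  have h := (trivializationAt (EuclideanSpace ℝ (Fin n)) (fun x : M => TangentSpace (𝓡 n) x)
    p).contMDiffOn_section_iff (IB := 𝓡 n) (n := ∞) (s := F) hUo (by simpa using hU)
  exact h.trans (contMDiffOn_congr fun y hy => (trivializationAt_snd_eq (hU hy) (F y)))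

lemma chartFrame_fieldRep (hu : u ∈ (chartAt (EuclideanSpace ℝ (Fin n)) p).target) :
    chartFrame p u (fieldRep p F u) = F ((chartAt (EuclideanSpace ℝ (Fin n)) p).symm u) := by
  have h := (mdifferentiable_chartAt p).symm_comp_deriv
    ((chartAt (EuclideanSpace ℝ (Fin n)) p).map_target hu)
  rw [(chartAt (EuclideanSpace ℝ (Fin n)) p).right_inv hu] at h
  exact congrArg (fun L => L (F ((chartAt (EuclideanSpace ℝ (Fin n)) p).symm u))) h

lemma coord_chartFrame (hu : u ∈ (chartAt (EuclideanSpace ℝ (Fin n)) p).target)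
    (a : EuclideanSpace ℝ (Fin n)) :
    mfderiv (𝓡 n) (𝓡 n) (chartAt (EuclideanSpace ℝ (Fin n)) p)
      ((chartAt (EuclideanSpace ℝ (Fin n)) p).symm u) (chartFrame p u a) = a :=
  congrArg (fun L => L a) ((mdifferentiable_chartAt p).comp_symm_deriv hu)

lemma coordField_symm (hu : u ∈ (chartAt (EuclideanSpace ℝ (Fin n)) p).target)
    (a : EuclideanSpace ℝ (Fin n)) :
    coordField p a ((chartAt (EuclideanSpace ℝ (Fin n)) p).symm u) = chartFrame p u a := by
  refine (mdifferentiable_chartAt p).mfderiv_injective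
    ((chartAt (EuclideanSpace ℝ (Fin n)) p).map_target hu) ?_
  rw [coord_chartFrame hu]
  exact coord_coordField ((chartAt (EuclideanSpace ℝ (Fin n)) p).map_target hu) a

lemma smoothOn_coordField (p : M) (a : EuclideanSpace ℝ (Fin n)) :
    SmoothOn (chartAt (EuclideanSpace ℝ (Fin n)) p).source (coordField p a) := by
  rw [smoothOn_iff_coord (chartAt (EuclideanSpace ℝ (Fin n)) p).open_source subset_rfl]
  exact contMDiffOn_const.congr fun y hy => coord_coordField hy a

lemma contDiffOn_fieldRep (hF : SmoothOn (chartAt (EuclideanSpace ℝ (Fin n)) p).source F) :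
    ContDiffOn ℝ ∞ (fieldRep p F) (chartAt (EuclideanSpace ℝ (Fin n)) p).target := by
  rw [smoothOn_iff_coord (chartAt (EuclideanSpace ℝ (Fin n)) p).open_source subset_rfl] at hF
  rw [← contMDiffOn_iff_contDiffOn]
  exact hF.comp (contMDiffOn_chart_symm (I := 𝓡 n) (n := ∞))
    (chartAt (EuclideanSpace ℝ (Fin n)) p).mapsTo_symm

end Charts

/-! ### Smoothness of matrix inversion; expansion in a basis that is not orthonormal -/

section MatrixSmooth

variable {ι : Type*} [Fintype ι] [DecidableEq ι]

lemma contDiff_det : ContDiff ℝ ∞ fun A : ι → ι → ℝ => (Matrix.of A).det := by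
  simp only [Matrix.det_apply, Matrix.of_apply, Units.smul_def, zsmul_eq_mul]
  fun_prop

lemma contDiffOn_inv_apply (i j : ι) :
    ContDiffOn ℝ ∞ (fun A : ι → ι → ℝ => (Matrix.of A)⁻¹ i j) {A | (Matrix.of A).det ≠ 0} := by
  simp only [Matrix.inv_def, Matrix.smul_apply, smul_eq_mul, Ring.inverse_eq_inv']
  refine (contDiff_det.contDiffOn.inv fun A hA => hA).mul ?_
  have h : ∀ A : ι → ι → ℝ, (Matrix.of A).adjugate i j =
      (Matrix.of fun a b => if a = j then (Pi.single i 1 : ι → ℝ) b else A a b).det := by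
    intro A
    rw [Matrix.adjugate_apply]
    congr 1
    ext a b
    by_cases ha : a = j
    · subst ha; simp
    · simp [Matrix.updateRow_apply, ha]
  simp only [h]
  refine ContDiff.contDiffOn (contDiff_det.comp ?_)
  refine contDiff_pi.2 fun a => contDiff_pi.2 fun b => ?_
  by_cases ha : a = j
  · simp only [ha, if_true]; exact contDiff_const
  · simp only [ha, if_false]; fun_prop

lemma basis_expansion {V : Type*} [NormedAddCommGroup V] [InnerProductSpace ℝ V]
    (b : Module.Basis ι ℝ V) (x : V) :
    x = ∑ j, (∑ i, (Matrix.of fun i j => inner ℝ (b i) (b j))⁻¹ j i * inner ℝ x (b i)) • b j := by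
  set G : Matrix ι ι ℝ := Matrix.of fun i j => inner ℝ (b i) (b j) with hG
  have hu : IsUnit G.det := isUnit_iff_ne_zero.2
    (Matrix.posDef_gram_of_linearIndependent (𝕜 := ℝ) b.linearIndependent).det_pos.ne'
  have h1 : (fun i => inner ℝ x (b i)) = G.mulVec (b.repr x) := by
    ext i
    conv_lhs => rw [← b.sum_repr x]
    simp only [sum_inner, inner_smul_left, Matrix.mulVec, dotProduct, hG, Matrix.of_apply]
    exact Finset.sum_congr rfl fun j _ => by rw [real_inner_comm]; simp; ring
  have h2 : ∀ j, ∑ i, G⁻¹ j i * inner ℝ x (b i) = b.repr x j := by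
    intro j
    have : G⁻¹.mulVec (fun i => inner ℝ x (b i)) = b.repr x := by
      rw [h1, Matrix.mulVec_mulVec, Matrix.nonsing_inv_mul _ hu, Matrix.one_mulVec]
    exact congrFun this j
  simp only [h2]
  exact (b.sum_repr x).symm

end MatrixSmooth

/-! ### Coordinate bases, directional derivatives and Lie brackets in a chart -/

section Charts

variable {n : ℕ} {M : Type*} [TopologicalSpace M] [ChartedSpace (EuclideanSpace ℝ (Fin n)) M]
  [IsManifold (𝓡 n) ∞ M]
variable {p y : M} {u : EuclideanSpace ℝ (Fin n)} {F G : ∀ x : M, TangentSpace (𝓡 n) x} {U : Set M}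

lemma chartFrame_bijective (hu : u ∈ (chartAt (EuclideanSpace ℝ (Fin n)) p).target) :
    Function.Bijective (chartFrame p u) :=
  (mdifferentiable_chartAt p).symm.mfderiv_bijective hu

/-- The coordinate basis at a point of the chart at `p`. -/
def chartBasis (hu : u ∈ (chartAt (EuclideanSpace ℝ (Fin n)) p).target) :
    Module.Basis (Fin n) ℝ
      (TangentSpace (𝓡 n) ((chartAt (EuclideanSpace ℝ (Fin n)) p).symm u)) :=
  (EuclideanSpace.basisFun (Fin n) ℝ).toBasis.map
    (LinearEquiv.ofBijective (chartFrame p u).toLinearMap (chartFrame_bijective hu))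

lemma chartBasis_apply (hu : u ∈ (chartAt (EuclideanSpace ℝ (Fin n)) p).target) (i : Fin n) :
    chartBasis hu i = chartFrame p u (EuclideanSpace.single i 1) := by
  simp [chartBasis]

lemma mvfderiv_chartFrame {f : M → ℝ} (hu : u ∈ (chartAt (EuclideanSpace ℝ (Fin n)) p).target)
    (hf : MDifferentiableAt (𝓡 n) 𝓘(ℝ, ℝ) f ((chartAt (EuclideanSpace ℝ (Fin n)) p).symm u))
    (a : EuclideanSpace ℝ (Fin n)) :
    mvfderiv (𝓡 n) f ((chartAt (EuclideanSpace ℝ (Fin n)) p).symm u) (chartFrame p u a) =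
      fderiv ℝ (fun v => f ((chartAt (EuclideanSpace ℝ (Fin n)) p).symm v)) u a := by
  have h := mfderiv_comp (I := 𝓡 n) (I' := 𝓡 n) (I'' := 𝓘(ℝ, ℝ)) u hf
    ((mdifferentiable_chartAt p).mdifferentiableAt_symm hu)
  rw [← mfderiv_eq_fderiv]
  exact (congrArg (fun L => L a) h).symm

lemma mvfderiv_field {f : M → ℝ} (hu : u ∈ (chartAt (EuclideanSpace ℝ (Fin n)) p).target)
    (hf : MDifferentiableAt (𝓡 n) 𝓘(ℝ, ℝ) f ((chartAt (EuclideanSpace ℝ (Fin n)) p).symm u)) :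
    mvfderiv (𝓡 n) f ((chartAt (EuclideanSpace ℝ (Fin n)) p).symm u)
        (F ((chartAt (EuclideanSpace ℝ (Fin n)) p).symm u)) =
      fderiv ℝ (fun v => f ((chartAt (EuclideanSpace ℝ (Fin n)) p).symm v)) u (fieldRep p F u) := by
  rw [← mvfderiv_chartFrame hu hf, chartFrame_fieldRep hu]

lemma chartFrame_inverse_apply (hu : u ∈ (chartAt (EuclideanSpace ℝ (Fin n)) p).target) :
    VectorField.mpullback 𝓘(ℝ, EuclideanSpace ℝ (Fin n)) (𝓡 n)
      (chartAt (EuclideanSpace ℝ (Fin n)) p).symm F u = fieldRep p F u := by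
  rw [VectorField.mpullback_apply, ← chartFrame_fieldRep hu (F := F)]
  have : (chartFrame p u).IsInvertible :=
    ⟨(mdifferentiable_chartAt p).symm.mfderiv hu, rfl⟩
  exact this.inverse_apply_self _

lemma mlieBracket_eq_lieBracket
    (V W : ∀ u : EuclideanSpace ℝ (Fin n), TangentSpace 𝓘(ℝ, EuclideanSpace ℝ (Fin n)) u) :
    VectorField.mlieBracket 𝓘(ℝ, EuclideanSpace ℝ (Fin n)) V W = VectorField.lieBracket ℝ V W := by
  rw [← VectorField.mlieBracketWithin_univ, VectorField.mlieBracketWithin_eq_lieBracketWithin]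
  exact VectorField.lieBracketWithin_univ

/-- Naturality of the bracket under pullback by the inverse chart, whose pullback of a field is
`fieldRep`. -/
lemma mlieBracket_chart (hF : SmoothOn (chartAt (EuclideanSpace ℝ (Fin n)) p).source F)
    (hG : SmoothOn (chartAt (EuclideanSpace ℝ (Fin n)) p).source G)
    (hu : u ∈ (chartAt (EuclideanSpace ℝ (Fin n)) p).target) :
    VectorField.mlieBracket (𝓡 n) F G ((chartAt (EuclideanSpace ℝ (Fin n)) p).symm u) =
      chartFrame p u (VectorField.lieBracket ℝ (fieldRep p F) (fieldRep p G) u) := by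
  have hs := (chartAt (EuclideanSpace ℝ (Fin n)) p).map_target hu
  have hn := (chartAt (EuclideanSpace ℝ (Fin n)) p).open_source.mem_nhds hs
  have : IsManifold (𝓡 n) (minSmoothness ℝ 2) M :=
    .of_le (n := ∞) (by simp; exact ENat.LEInfty.out)
  have : IsManifold (𝓡 n) (minSmoothness ℝ 2) (EuclideanSpace ℝ (Fin n)) :=
    .of_le (n := ∞) (by simp; exact ENat.LEInfty.out)
  have h := VectorField.mpullback_mlieBracket (I := 𝓘(ℝ, EuclideanSpace ℝ (Fin n))) (I' := 𝓡 n)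
    (f := (chartAt (EuclideanSpace ℝ (Fin n)) p).symm) (V := F) (W := G) (x₀ := u) (n := ∞)
    ((hF.contMDiffAt hn).mdifferentiableAt (by simp))
    ((hG.contMDiffAt hn).mdifferentiableAt (by simp))
    ((contMDiffOn_chart_symm (I := 𝓡 n)).contMDiffAt
      ((chartAt (EuclideanSpace ℝ (Fin n)) p).open_target.mem_nhds hu))
    (by simp; exact ENat.LEInfty.out)
  have he : ∀ H : ∀ x : M, TangentSpace (𝓡 n) x,
      VectorField.mpullback 𝓘(ℝ, EuclideanSpace ℝ (Fin n)) (𝓡 n)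
      (chartAt (EuclideanSpace ℝ (Fin n)) p).symm H =ᶠ[𝓝 u] fieldRep p H := fun H => by
    filter_upwards [(chartAt (EuclideanSpace ℝ (Fin n)) p).open_target.mem_nhds hu] with v hv
    exact chartFrame_inverse_apply hv
  rw [(he F).mlieBracket_vectorField_eq (he G), chartFrame_inverse_apply hu] at h
  exact (chartFrame_fieldRep hu (F := VectorField.mlieBracket (𝓡 n) F G)).symm.trans
    (congrArg (chartFrame p u) (h.trans (congrFun (mlieBracket_eq_lieBracket _ _) u)))

lemma fieldRep_coordField (hu : u ∈ (chartAt (EuclideanSpace ℝ (Fin n)) p).target)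
    (a : EuclideanSpace ℝ (Fin n)) : fieldRep p (coordField p a) u = a :=
  coord_coordField ((chartAt (EuclideanSpace ℝ (Fin n)) p).map_target hu) a

/-- Only the derivative of `F` survives, as the other field has constant components. In this way the
linearization of `X` in coordinates is expressed by a bracket, and then by the connection. -/
lemma mlieBracket_coordField_right
    (hF : SmoothOn (chartAt (EuclideanSpace ℝ (Fin n)) p).source F)
    (hu : u ∈ (chartAt (EuclideanSpace ℝ (Fin n)) p).target) (a : EuclideanSpace ℝ (Fin n)) :
    VectorField.mlieBracket (𝓡 n) F (coordField p a)
        ((chartAt (EuclideanSpace ℝ (Fin n)) p).symm u) =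
      -chartFrame p u (fderiv ℝ (fieldRep p F) u a) := by
  rw [mlieBracket_chart hF (smoothOn_coordField p a) hu, ← map_neg]
  have he : fieldRep p (coordField p a) =ᶠ[𝓝 u] fun _ => a := by
    filter_upwards [(chartAt (EuclideanSpace ℝ (Fin n)) p).open_target.mem_nhds hu] with v hv
    exact fieldRep_coordField hv a
  rw [VectorField.lieBracket, he.fderiv_eq, fieldRep_coordField hu]
  simp

end Charts

/-! ### The metric in coordinates -/

section Metric

variable {n : ℕ} {M : Type*} [TopologicalSpace M] [ChartedSpace (EuclideanSpace ℝ (Fin n)) M]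
  [IsManifold (𝓡 n) ∞ M]
  [RiemannianBundle (fun x : M => TangentSpace (𝓡 n) x)]
variable {p y : M} {u : EuclideanSpace ℝ (Fin n)} {F G : ∀ x : M, TangentSpace (𝓡 n) x} {U : Set M}

lemma gram_apply (hu : u ∈ (chartAt (EuclideanSpace ℝ (Fin n)) p).target) (i j : Fin n) :
    gram p u i j = inner ℝ
      (coordField p (EuclideanSpace.single i 1) ((chartAt (EuclideanSpace ℝ (Fin n)) p).symm u))
      (coordField p (EuclideanSpace.single j 1) ((chartAt (EuclideanSpace ℝ (Fin n)) p).symm u)) := by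
  rw [coordField_symm hu, coordField_symm hu]; rfl

lemma gram_eq (hu : u ∈ (chartAt (EuclideanSpace ℝ (Fin n)) p).target) :
    gram p u = Matrix.of fun i j => inner ℝ (chartBasis hu i) (chartBasis hu j) := by
  ext i j
  rw [Matrix.of_apply, chartBasis_apply, chartBasis_apply]; rfl

lemma det_gram_pos (hu : u ∈ (chartAt (EuclideanSpace ℝ (Fin n)) p).target) :
    0 < (gram p u).det := by
  rw [gram_eq hu]
  exact (Matrix.posDef_gram_of_linearIndependent (𝕜 := ℝ) (chartBasis hu).linearIndependent).det_pos

variable [IsContMDiffRiemannianBundle (𝓡 n) ∞ (EuclideanSpace ℝ (Fin n))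
    (fun x : M => TangentSpace (𝓡 n) x)]

lemma SmoothOn.inner (hF : SmoothOn U F) (hG : SmoothOn U G) :
    ContMDiffOn (𝓡 n) 𝓘(ℝ, ℝ) ∞ (fun y => (inner ℝ (F y) (G y) : ℝ)) U :=
  ContMDiffOn.inner_bundle (E := fun x : M => TangentSpace (𝓡 n) x)
    (F := EuclideanSpace ℝ (Fin n)) (b := fun y => y) hF hG

lemma contDiffOn_gram (p : M) (i j : Fin n) : ContDiffOn ℝ ∞ (fun u => gram p u i j)
    (chartAt (EuclideanSpace ℝ (Fin n)) p).target := by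
  rw [← contMDiffOn_iff_contDiffOn]
  have h := (smoothOn_coordField p (EuclideanSpace.single i (1 : ℝ))).inner
    (smoothOn_coordField p (EuclideanSpace.single j (1 : ℝ)))
  exact (h.comp (contMDiffOn_chart_symm (I := 𝓡 n) (n := ∞))
    (chartAt (EuclideanSpace ℝ (Fin n)) p).mapsTo_symm).congr fun u hu => gram_apply hu i j

/-- The components of `F` are recovered from its inner products with coordinate fields through the
inverse Gram matrix, which is smooth. Gradients, covariant derivatives and adjoints, all defined by
duality, obtain their smoothness from this. -/
lemma smoothOn_of_inner
    (hU : U ⊆ (chartAt (EuclideanSpace ℝ (Fin n)) p).source)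
    (h : ∀ i, ContMDiffOn (𝓡 n) 𝓘(ℝ, ℝ) ∞
      (fun y => (inner ℝ (F y) (coordField p (EuclideanSpace.single i (1 : ℝ)) y) : ℝ)) U) :
    SmoothOn U F := by
  let e : Fin n → ∀ y : M, TangentSpace (𝓡 n) y :=
    fun i => coordField p (EuclideanSpace.single i (1 : ℝ))
  have he : ∀ i, SmoothOn U (e i) := fun i => (smoothOn_coordField p _).mono hU
  let Γ : M → Fin n → Fin n → ℝ := fun y i j => inner ℝ (e i y) (e j y)
  have hΓ : ContMDiffOn (𝓡 n) 𝓘(ℝ, Fin n → Fin n → ℝ) ∞ Γ U :=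
    contMDiffOn_pi_space.2 fun i => contMDiffOn_pi_space.2 fun j => (he i).inner (he j)
  have hdet : ∀ y ∈ U, (Matrix.of (Γ y)).det ≠ 0 ∧
      F y = ∑ j, (∑ i, (Matrix.of (Γ y))⁻¹ j i * inner ℝ (F y) (e i y)) • e j y := by
    intro y hy
    obtain ⟨u, hu, rfl⟩ : ∃ u ∈ (chartAt (EuclideanSpace ℝ (Fin n)) p).target,
        (chartAt (EuclideanSpace ℝ (Fin n)) p).symm u = y :=
      ⟨_, (chartAt (EuclideanSpace ℝ (Fin n)) p).map_source (hU hy),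
        (chartAt (EuclideanSpace ℝ (Fin n)) p).left_inv (hU hy)⟩
    have h1 : Matrix.of (Γ ((chartAt (EuclideanSpace ℝ (Fin n)) p).symm u)) = gram p u := by
      ext i j
      rw [gram_apply hu]; rfl
    have h2 : ∀ i, e i ((chartAt (EuclideanSpace ℝ (Fin n)) p).symm u) = chartBasis hu i :=
      fun i => by rw [chartBasis_apply, ← coordField_symm hu]
    rw [h1]
    refine ⟨(det_gram_pos hu).ne', ?_⟩
    have h3 := basis_expansion (chartBasis hu) (F ((chartAt (EuclideanSpace ℝ (Fin n)) p).symm u))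
    rw [← gram_eq hu] at h3
    simp only [h2]
    exact h3
  have hinv : ∀ j i, ContMDiffOn (𝓡 n) 𝓘(ℝ, ℝ) ∞ (fun y => (Matrix.of (Γ y))⁻¹ j i) U :=
    fun j i => (contDiffOn_inv_apply j i).contMDiffOn.comp hΓ fun y hy => (hdet y hy).1
  let g : Fin n → M → ℝ := fun j y => ∑ i, (Matrix.of (Γ y))⁻¹ j i * inner ℝ (F y) (e i y)
  have hg : ∀ j, ContMDiffOn (𝓡 n) 𝓘(ℝ, ℝ) ∞ (g j) U := fun j =>
    contMDiffOn_finsetSum fun i _ => (hinv j i).mul (h i)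
  have hsum := ContMDiffOn.sum_section (s := Finset.univ) (n := ∞) (u := U) (I := 𝓡 n)
    (F := EuclideanSpace ℝ (Fin n)) (V := fun x : M => TangentSpace (𝓡 n) x)
    (t := fun j => g j • e j) fun j _ => ContMDiffOn.smul_section (hg j) (he j)
  refine hsum.congr fun y hy => ?_
  exact congrArg _ (hdet y hy).2

end Metric

/-! ### Calculus with smooth vector fields -/

section SmoothFields

variable {n : ℕ} {M : Type*} [TopologicalSpace M] [ChartedSpace (EuclideanSpace ℝ (Fin n)) M]
  [IsManifold (𝓡 n) ∞ M]
variable {p x : M} {F G V W X : ∀ x : M, TangentSpace (𝓡 n) x} {U : Set M} {f : M → ℝ}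

lemma SmoothOn.mdifferentiableAt (hF : SmoothOn U F) (hU : IsOpen U) (hx : x ∈ U) :
    MDifferentiableAt (𝓡 n) (𝓡 n).tangent (fun x => (⟨x, F x⟩ : TangentBundle (𝓡 n) M)) x :=
  (hF.contMDiffAt (hU.mem_nhds hx)).mdifferentiableAt (by simp)

lemma isSmoothField_of_source
    (h : ∀ p, SmoothOn (chartAt (EuclideanSpace ℝ (Fin n)) p).source F) : IsSmoothField F :=
  fun p => (h p).contMDiffAt ((chartAt (EuclideanSpace ℝ (Fin n)) p).open_source.mem_nhds
    (mem_chart_source _ p))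

lemma IsSmoothField.smoothOn (h : IsSmoothField F) (U : Set M) : SmoothOn U F :=
  ContMDiff.contMDiffOn h

lemma smoothOn_extend (p : M) (w : TangentSpace (𝓡 n) p) :
    SmoothOn (chartAt (EuclideanSpace ℝ (Fin n)) p).source
      (FiberBundle.extend (EuclideanSpace ℝ (Fin n)) w) :=
  smoothOn_coordField p w

lemma mlieBracket_coordField (a b : EuclideanSpace ℝ (Fin n))
    (hx : x ∈ (chartAt (EuclideanSpace ℝ (Fin n)) p).source) :
    VectorField.mlieBracket (𝓡 n) (coordField p a) (coordField p b) x = 0 := by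
  obtain ⟨u, hu, rfl⟩ : ∃ u ∈ (chartAt (EuclideanSpace ℝ (Fin n)) p).target,
      (chartAt (EuclideanSpace ℝ (Fin n)) p).symm u = x :=
    ⟨_, (chartAt (EuclideanSpace ℝ (Fin n)) p).map_source hx,
      (chartAt (EuclideanSpace ℝ (Fin n)) p).left_inv hx⟩
  refine (mlieBracket_coordField_right (smoothOn_coordField p a) hu b).trans ?_
  have he : fieldRep p (coordField p a) =ᶠ[𝓝 u] fun _ => a := by
    filter_upwards [(chartAt (EuclideanSpace ℝ (Fin n)) p).open_target.mem_nhds hu] with v hv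
    exact fieldRep_coordField hv a
  rw [he.fderiv_eq]
  simp

lemma SmoothOn.mlieBracket (hU : IsOpen U) (hF : SmoothOn U F) (hG : SmoothOn U G) :
    SmoothOn U (VectorField.mlieBracket (𝓡 n) F G) := by
  have : IsManifold (𝓡 n) (minSmoothness ℝ 2) M :=
    .of_le (n := ∞) (by simp; exact ENat.LEInfty.out)
  have : IsManifold (𝓡 n) (((⊤ : ℕ∞) : WithTop ℕ∞) + 1) M := .of_le (n := ∞) (by simp)
  intro y hy
  have h1 := hF.contMDiffAt (hU.mem_nhds hy)
  have h2 := hG.contMDiffAt (hU.mem_nhds hy)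
  exact (ContMDiffAt.mlieBracket_vectorField (m := ⊤) (n := ⊤) h1 h2 (by simp)).contMDiffWithinAt

lemma SmoothOn.mvfderiv (hU : IsOpen U) (hf : ContMDiffOn (𝓡 n) 𝓘(ℝ, ℝ) ∞ f U)
    (hF : SmoothOn U F) :
    ContMDiffOn (𝓡 n) 𝓘(ℝ, ℝ) ∞ (fun y => mvfderiv (𝓡 n) f y (F y)) U := by
  have h1 := hf.contMDiffOn_tangentMapWithin (m := ∞) (by simp) hU.uniqueMDiffOn
  have h2 := h1.comp hF (fun y hy => hy)
  have h3 := (contMDiff_snd_tangentBundle_modelSpace ℝ 𝓘(ℝ, ℝ) (n := ∞)).comp_contMDiffOn h2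
  refine h3.congr fun y hy => ?_
  have : mfderivWithin (𝓡 n) 𝓘(ℝ, ℝ) f U y = mfderiv (𝓡 n) 𝓘(ℝ, ℝ) f y :=
    mfderivWithin_of_isOpen hU hy
  exact (congrArg (fun L => L (F y)) this).symm

/-- Second derivatives of a function in the directions of coordinate fields commute. -/
lemma mvfderiv_mvfderiv_comm (hf : ContMDiffOn (𝓡 n) 𝓘(ℝ, ℝ) ∞ f
      (chartAt (EuclideanSpace ℝ (Fin n)) p).source) (a b : EuclideanSpace ℝ (Fin n)) :
    mvfderiv (𝓡 n) (fun y => mvfderiv (𝓡 n) f y (coordField p b y)) p (coordField p a p) =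
      mvfderiv (𝓡 n) (fun y => mvfderiv (𝓡 n) f y (coordField p a y)) p (coordField p b p) := by
  set c := chartAt (EuclideanSpace ℝ (Fin n)) p with hc
  have hp := mem_chart_source (EuclideanSpace ℝ (Fin n)) p
  have hu : c p ∈ c.target := c.map_source hp
  have key : ∀ a b : EuclideanSpace ℝ (Fin n),
      mvfderiv (𝓡 n) (fun y => mvfderiv (𝓡 n) f y (coordField p b y)) p (coordField p a p) =
      fderiv ℝ (fun v => fderiv ℝ (fun v => f (c.symm v)) v b) (c p) a := by
    intro a b
    have h0 := (SmoothOn.mvfderiv c.open_source hf (smoothOn_coordField p b))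
    have h1 := mvfderiv_field (p := p) (F := coordField p a) hu
      (f := fun y => mvfderiv (𝓡 n) f y (coordField p b y))
      ((h0.contMDiffAt (c.open_source.mem_nhds (c.map_target hu))).mdifferentiableAt (by simp))
    rw [← hc, c.left_inv hp] at h1
    rw [h1, fieldRep_coordField hu a]
    have he : (fun v => mvfderiv (𝓡 n) f (c.symm v) (coordField p b (c.symm v))) =ᶠ[𝓝 (c p)]
        fun v => fderiv ℝ (fun v => f (c.symm v)) v b := by
      filter_upwards [c.open_target.mem_nhds hu] with v hv
      have h2 := mvfderiv_field (p := p) (F := coordField p b) hv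
        ((hf.contMDiffAt (c.open_source.mem_nhds (c.map_target hv))).mdifferentiableAt (by simp))
      rw [h2, fieldRep_coordField hv b]
    rw [he.fderiv_eq]
  have hfc : ContDiffAt ℝ ∞ (fun v => f (c.symm v)) (c p) := by
    have := (hf.comp (contMDiffOn_chart_symm (I := 𝓡 n) (n := ∞)) c.mapsTo_symm)
    exact (contMDiffOn_iff_contDiffOn.1 this).contDiffAt (c.open_target.mem_nhds hu)
  have hd : DifferentiableAt ℝ (fderiv ℝ fun v => f (c.symm v)) (c p) :=
    (hfc.fderiv_right (m := ∞) (by simp)).differentiableAt (by simp)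
  have hsymm := hfc.isSymmSndFDerivAt (by simp; exact ENat.LEInfty.out)
  rw [key, key, fderiv_clm_apply hd (differentiableAt_const _),
    fderiv_clm_apply hd (differentiableAt_const _)]
  simpa using hsymm a b

lemma SmoothOn.add (hV : SmoothOn U V) (hW : SmoothOn U W) : SmoothOn U fun y => V y + W y :=
  ContMDiffOn.add_section hV hW

lemma SmoothOn.sub (hV : SmoothOn U V) (hW : SmoothOn U W) : SmoothOn U fun y => V y - W y :=
  ContMDiffOn.sub_section hV hW

lemma SmoothOn.const_smul (hV : SmoothOn U V) (a : ℝ) : SmoothOn U fun y => a • V y :=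
  ContMDiffOn.const_smul_section hV

lemma mvfderiv_congr {f g : M → ℝ} (h : f =ᶠ[𝓝 x] g) :
    mvfderiv (𝓡 n) f x = mvfderiv (𝓡 n) g x := by
  ext v
  have h1 : mfderiv (𝓡 n) 𝓘(ℝ, ℝ) f x v = mfderiv (𝓡 n) 𝓘(ℝ, ℝ) g x v :=
    congrArg (fun L : TangentSpace (𝓡 n) x →L[ℝ] ℝ => L v) h.mfderiv_eq
  exact h1

lemma mvfderiv_const_mul {f : M → ℝ} (hf : MDifferentiableAt (𝓡 n) 𝓘(ℝ, ℝ) f x) (r : ℝ)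
    (v : TangentSpace (𝓡 n) x) :
    mvfderiv (𝓡 n) (fun y => r * f y) x v = r * mvfderiv (𝓡 n) f x v := by
  have h := congrArg (fun L => L v) (mvfderiv_fun_mul (mdifferentiableAt_const (c := r)) hf)
  rw [mvfderiv_const] at h
  simpa using h

end SmoothFields

/-! ### Smoothness and torsion of the Levi-Civita connection -/

section Connection

variable {n : ℕ} {M : Type*} [TopologicalSpace M] [ChartedSpace (EuclideanSpace ℝ (Fin n)) M]
  [IsManifold (𝓡 n) ∞ M]
  [RiemannianBundle (fun x : M => TangentSpace (𝓡 n) x)]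
  [IsContMDiffRiemannianBundle (𝓡 n) ∞ (EuclideanSpace ℝ (Fin n))
    (fun x : M => TangentSpace (𝓡 n) x)]
variable {p x : M} {F G V W X : ∀ x : M, TangentSpace (𝓡 n) x} {U : Set M}

lemma SmoothOn.koszul (hU : IsOpen U) (hX : SmoothOn U X) (hV : SmoothOn U V)
    (hW : SmoothOn U W) : ContMDiffOn (𝓡 n) 𝓘(ℝ, ℝ) ∞ (koszul X V W) U := by
  have h1 := SmoothOn.mvfderiv hU (hX.inner hW) hV
  have h2 := SmoothOn.mvfderiv hU (hW.inner hV) hX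
  have h3 := SmoothOn.mvfderiv hU (hV.inner hX) hW
  have h4 := (SmoothOn.mlieBracket hU hV hX).inner hW
  have h5 := (SmoothOn.mlieBracket hU hX hW).inner hV
  have h6 := (SmoothOn.mlieBracket hU hW hV).inner hX
  exact ((((h1.add h2).sub h3).add h4).sub h5).add h6

lemma SmoothOn.leviCivita (hU : IsOpen U) (hX : SmoothOn U X) (hV : SmoothOn U V) :
    SmoothOn U (fun y => SecondVariation.leviCivita X y (V y)) := by
  intro q hq
  set O := U ∩ (chartAt (EuclideanSpace ℝ (Fin n)) q).source
  have hO : IsOpen O := hU.inter (chartAt (EuclideanSpace ℝ (Fin n)) q).open_source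
  have hqO : q ∈ O := ⟨hq, mem_chart_source _ q⟩
  have : SmoothOn O (fun y => SecondVariation.leviCivita X y (V y)) := by
    refine smoothOn_of_inner (p := q) Set.inter_subset_right fun i => ?_
    have he : SmoothOn O _ := (smoothOn_coordField q (EuclideanSpace.single i (1 : ℝ))).mono
      (Set.inter_subset_right : O ⊆ _)
    have hX' : SmoothOn O X := hX.mono Set.inter_subset_left
    have hV' : SmoothOn O V := hV.mono Set.inter_subset_left
    have hk := SmoothOn.koszul hO hX' hV' he
    refine (contMDiffOn_const (c := (1 / 2 : ℝ)).mul hk).congr fun y hy => ?_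
    exact inner_leviCivita (hX'.mdifferentiableAt hO hy) (hV'.mdifferentiableAt hO hy)
      (he.mdifferentiableAt hO hy)
  exact (this.contMDiffAt (hO.mem_nhds hqO)).contMDiffWithinAt

lemma leviCivita_sub_leviCivita
    (hV : MDifferentiableAt (𝓡 n) (𝓡 n).tangent (fun x => (⟨x, V x⟩ : TangentBundle (𝓡 n) M)) x)
    (hW : MDifferentiableAt (𝓡 n) (𝓡 n).tangent (fun x => (⟨x, W x⟩ : TangentBundle (𝓡 n) M)) x) :
    leviCivita W x (V x) - leviCivita V x (W x) = VectorField.mlieBracket (𝓡 n) V W x :=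
  (CovariantDerivative.torsion_eq_zero_iff _).1 leviCivita_torsion hV hW

end Connection

/-! ### Fields of endomorphisms and their covariant derivatives -/

section Endomorphisms

variable {n : ℕ} {M : Type*} [TopologicalSpace M] [ChartedSpace (EuclideanSpace ℝ (Fin n)) M]
  [IsManifold (𝓡 n) ∞ M]
  [RiemannianBundle (fun x : M => TangentSpace (𝓡 n) x)]
  [IsContMDiffRiemannianBundle (𝓡 n) ∞ (EuclideanSpace ℝ (Fin n))
    (fun x : M => TangentSpace (𝓡 n) x)]
variable {p x : M} {D F G V W X : ∀ x : M, TangentSpace (𝓡 n) x} {U : Set M}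
  {S T : ∀ x : M, TangentSpace (𝓡 n) x →ₗ[ℝ] TangentSpace (𝓡 n) x}

/-- Fields of endomorphisms that map smooth vector fields to smooth vector fields. -/
def SmoothEndOn (U : Set M) (T : ∀ x : M, TangentSpace (𝓡 n) x →ₗ[ℝ] TangentSpace (𝓡 n) x) :
    Prop :=
  ∀ O ⊆ U, IsOpen O → ∀ V, SmoothOn O V → SmoothOn O fun y => T y (V y)

lemma metric_on (hU : IsOpen U) (hV : SmoothOn U V) (hW : SmoothOn U W) (hx : x ∈ U)
    (v : TangentSpace (𝓡 n) x) :
    mvfderiv (𝓡 n) (fun y => inner ℝ (V y) (W y)) x v =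
      inner ℝ (leviCivita V x v) (W x) + inner ℝ (V x) (leviCivita W x v) :=
  leviCivita_metric (hV.mdifferentiableAt hU hx) (hW.mdifferentiableAt hU hx) v

lemma smoothEndOn_nabla (hX : SmoothOn U X) : SmoothEndOn U (nabla X) :=
  fun _ hOU hO _ hV => SmoothOn.leviCivita hO (hX.mono hOU) hV

lemma SmoothEndOn.adjoint (hT : SmoothEndOn U T) :
    SmoothEndOn U fun y => LinearMap.adjoint (T y) := by
  intro O hOU hO V hV q hq
  set O' := O ∩ (chartAt (EuclideanSpace ℝ (Fin n)) q).source
  have hO' : IsOpen O' := hO.inter (chartAt (EuclideanSpace ℝ (Fin n)) q).open_source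
  have hqO : q ∈ O' := ⟨hq, mem_chart_source _ q⟩
  have : SmoothOn O' (fun y => LinearMap.adjoint (T y) (V y)) := by
    refine smoothOn_of_inner (p := q) Set.inter_subset_right fun i => ?_
    have he : SmoothOn O' _ := (smoothOn_coordField q (EuclideanSpace.single i (1 : ℝ))).mono
      (Set.inter_subset_right : O' ⊆ _)
    have hV' : SmoothOn O' V := hV.mono Set.inter_subset_left
    refine (hV'.inner (hT O' (Set.inter_subset_left.trans hOU) hO' _ he)).congr fun y hy => ?_
    rw [LinearMap.adjoint_inner_left]
  exact (this.contMDiffAt (hO'.mem_nhds hqO)).contMDiffWithinAt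

lemma smoothEndOn_symPart (hX : SmoothOn U X) : SmoothEndOn U (symPart X) := by
  intro O hOU hO V hV
  have h1 := smoothEndOn_nabla hX O hOU hO V hV
  have h2 := (smoothEndOn_nabla hX).adjoint O hOU hO V hV
  exact (h1.add h2).const_smul (1 / 2)

lemma two_inner_symPart (X : ∀ x : M, TangentSpace (𝓡 n) x) (x : M)
    (v w : TangentSpace (𝓡 n) x) :
    inner ℝ (nabla X x v) w + inner ℝ v (nabla X x w) = 2 * inner ℝ (symPart X x v) w := by
  rw [symPart, LinearMap.smul_apply, LinearMap.add_apply, inner_smul_left, inner_add_left,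
    LinearMap.adjoint_inner_left]
  simp

lemma symPart_symm (X : ∀ x : M, TangentSpace (𝓡 n) x) (x : M) (v w : TangentSpace (𝓡 n) x) :
    inner ℝ (symPart X x v) w = inner ℝ v (symPart X x w) := by
  have h1 := two_inner_symPart X x v w
  have h2 := two_inner_symPart X x w v
  rw [real_inner_comm, real_inner_comm (nabla X x v)] at h2
  rw [real_inner_comm (symPart X x w)]
  linarith

lemma nabla_eq (X : ∀ x : M, TangentSpace (𝓡 n) x) (x : M) :
    nabla X x = skewPart X x + symPart X x := by
  rw [skewPart, symPart]; module

lemma skewPart_skew (X : ∀ x : M, TangentSpace (𝓡 n) x) (x : M) (v w : TangentSpace (𝓡 n) x) :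
    inner ℝ (skewPart X x v) w = -inner ℝ v (skewPart X x w) := by
  have h := two_inner_symPart X x v w
  rw [nabla_eq, LinearMap.add_apply, LinearMap.add_apply, inner_add_left, inner_add_right,
    ← symPart_symm] at h
  linarith

/-- If the symmetric summand of `T` is `S`, the symmetric summand of `∇_X T` is `∇_X S`. -/
lemma inner_covDerivEnd_add_swap (hU : IsOpen U) (hx : x ∈ U) (hT : SmoothEndOn U T)
    (hS : SmoothEndOn U S)
    (h : ∀ y ∈ U, ∀ v w, inner ℝ (T y v) w + inner ℝ v (T y w) = 2 * inner ℝ (S y v) w)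
    (X : ∀ x : M, TangentSpace (𝓡 n) x) (w w' : TangentSpace (𝓡 n) x) :
    inner ℝ (covDerivEnd T X x w) w' + inner ℝ w (covDerivEnd T X x w') =
      2 * inner ℝ (covDerivEnd S X x w) w' := by
  set O := U ∩ (chartAt (EuclideanSpace ℝ (Fin n)) x).source
  have hO : IsOpen O := hU.inter (chartAt (EuclideanSpace ℝ (Fin n)) x).open_source
  have hxO : x ∈ O := ⟨hx, mem_chart_source _ x⟩
  set e := FiberBundle.extend (E := fun x : M => TangentSpace (𝓡 n) x)
    (EuclideanSpace ℝ (Fin n)) w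
  set e' := FiberBundle.extend (E := fun x : M => TangentSpace (𝓡 n) x)
    (EuclideanSpace ℝ (Fin n)) w'
  have he : SmoothOn O e := (smoothOn_extend x w).mono Set.inter_subset_right
  have he' : SmoothOn O e' := (smoothOn_extend x w').mono Set.inter_subset_right
  have hOU : O ⊆ U := Set.inter_subset_left
  have hex : e x = w := FiberBundle.extend_apply_self ..
  have hex' : e' x = w' := FiberBundle.extend_apply_self ..
  have m1 := metric_on hO (hT O hOU hO e he) he' hxO (X x)
  have m2 := metric_on hO he (hT O hOU hO e' he') hxO (X x)
  have m3 := metric_on hO (hS O hOU hO e he) he' hxO (X x)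
  have d1 : MDifferentiableAt (𝓡 n) 𝓘(ℝ, ℝ) (fun y => (inner ℝ (T y (e y)) (e' y) : ℝ)) x :=
    mdifferentiableAt_inner ((hT O hOU hO e he).mdifferentiableAt hO hxO)
      (he'.mdifferentiableAt hO hxO)
  have d2 : MDifferentiableAt (𝓡 n) 𝓘(ℝ, ℝ) (fun y => (inner ℝ (e y) (T y (e' y)) : ℝ)) x :=
    mdifferentiableAt_inner (he.mdifferentiableAt hO hxO)
      ((hT O hOU hO e' he').mdifferentiableAt hO hxO)
  have d3 : MDifferentiableAt (𝓡 n) 𝓘(ℝ, ℝ) (fun y => (inner ℝ (S y (e y)) (e' y) : ℝ)) x :=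
    mdifferentiableAt_inner ((hS O hOU hO e he).mdifferentiableAt hO hxO)
      (he'.mdifferentiableAt hO hxO)
  -- The hypothesis for the extensions `e`, `e'` is differentiated along `X`. The terms with
  -- derivatives of `e` and `e'` cancel because they are themselves instances of the hypothesis,
  -- namely `p1` and `p2`.
  have hev : (fun y => (inner ℝ (T y (e y)) (e' y) : ℝ) + inner ℝ (e y) (T y (e' y))) =ᶠ[𝓝 x]
      fun y => inner ℝ (S y (e y)) (e' y) + inner ℝ (S y (e y)) (e' y) := by
    filter_upwards [hU.mem_nhds hx] with y hy
    rw [h y hy]; ring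
  have h1 := mvfderiv_congr (n := n) hev
  rw [mvfderiv_fun_add d1 d2, mvfderiv_fun_add d3 d3] at h1
  have h2 := congrArg (fun L => L (X x)) h1
  simp only [add_apply] at h2
  rw [m1, m2, m3] at h2
  have p1 := h x hx (leviCivita e x (X x)) w'
  have p2 := h x hx w (leviCivita e' x (X x))
  simp only [covDerivEnd, inner_sub_left, inner_sub_right]
  rw [hex, hex'] at h2
  simp only [e, e'] at h2 p1 p2 ⊢
  linarith

/-- `∇_v (T D) = T (∇_v D)` at a zero of `D`. -/
lemma leviCivita_end_of_eq_zero (hU : IsOpen U) (hx : x ∈ U) (hT : SmoothEndOn U T)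
    (hD : SmoothOn U D) (h0 : D x = 0) (v : TangentSpace (𝓡 n) x) :
    leviCivita (fun y => T y (D y)) x v = T x (leviCivita D x v) := by
  refine ext_inner_right ℝ fun w => ?_
  set O := U ∩ (chartAt (EuclideanSpace ℝ (Fin n)) x).source
  have hO : IsOpen O := hU.inter (chartAt (EuclideanSpace ℝ (Fin n)) x).open_source
  have hxO : x ∈ O := ⟨hx, mem_chart_source _ x⟩
  have hOU : O ⊆ U := Set.inter_subset_left
  set e := FiberBundle.extend (E := fun x : M => TangentSpace (𝓡 n) x)
    (EuclideanSpace ℝ (Fin n)) w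
  have he : SmoothOn O e := (smoothOn_extend x w).mono Set.inter_subset_right
  have hex : e x = w := FiberBundle.extend_apply_self ..
  have hD' : SmoothOn O D := hD.mono hOU
  have m1 := metric_on hO (hT O hOU hO D hD') he hxO v
  have m2 := metric_on hO hD' (hT.adjoint O hOU hO e he) hxO v
  -- With `T` moved to the other side, every term except the one with `∇_v D` contains `D x = 0` as
  -- a factor; no derivative of `T` is left.
  have heq : (fun y => (inner ℝ (T y (D y)) (e y) : ℝ)) =
      fun y => inner ℝ (D y) (LinearMap.adjoint (T y) (e y)) :=
    funext fun y => (LinearMap.adjoint_inner_right _ _ _).symm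
  rw [heq, m2] at m1
  simp only [h0, map_zero, inner_zero_left, add_zero, hex, LinearMap.adjoint_inner_right] at m1
  exact m1.symm

end Endomorphisms

/-! ### Gradient fields and Killing fields -/

section Gradients

variable {n : ℕ} {M : Type*} [TopologicalSpace M] [ChartedSpace (EuclideanSpace ℝ (Fin n)) M]
  [IsManifold (𝓡 n) ∞ M]
  [RiemannianBundle (fun x : M => TangentSpace (𝓡 n) x)]
  [IsContMDiffRiemannianBundle (𝓡 n) ∞ (EuclideanSpace ℝ (Fin n))
    (fun x : M => TangentSpace (𝓡 n) x)]
variable {p x : M} {D F G V W W' X : ∀ x : M, TangentSpace (𝓡 n) x} {U : Set M}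

lemma IsGradientField.isSmoothField (hX : IsGradientField X) : IsSmoothField X := by
  obtain ⟨f, hf, h⟩ := hX
  refine isSmoothField_of_source fun p => smoothOn_of_inner (p := p) subset_rfl fun i => ?_
  refine (SmoothOn.mvfderiv (chartAt (EuclideanSpace ℝ (Fin n)) p).open_source hf.contMDiffOn
    (smoothOn_coordField p (EuclideanSpace.single i (1 : ℝ)))).congr fun y _ => ?_
  exact h y _

/-- Symmetry of the Hessian: second derivatives of `f` along coordinate fields commute, and the
correction terms agree because the connection has no torsion and the coordinate fields commute. -/
lemma IsGradientField.nabla_symm (hX : IsGradientField X) (v w : TangentSpace (𝓡 n) x) :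
    inner ℝ (nabla X x v) w = inner ℝ v (nabla X x w) := by
  have hs := hX.isSmoothField
  obtain ⟨f, hf, h⟩ := hX
  set S := (chartAt (EuclideanSpace ℝ (Fin n)) x).source
  have hS : IsOpen S := (chartAt (EuclideanSpace ℝ (Fin n)) x).open_source
  have hxS : x ∈ S := mem_chart_source _ x
  have hXS : SmoothOn S X := hs.smoothOn S
  have hv := smoothOn_extend x v
  have hw := smoothOn_extend x w
  have m1 := metric_on hS hXS hw hxS v
  have m2 := metric_on hS hXS hv hxS w
  have c := mvfderiv_mvfderiv_comm (p := x) hf.contMDiffOn v w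
  have t := leviCivita_sub_leviCivita (hv.mdifferentiableAt hS hxS) (hw.mdifferentiableAt hS hxS)
  have b := mlieBracket_coordField v w hxS
  have e1 : coordField x v x = v := FiberBundle.extend_apply_self ..
  have e2 : coordField x w x = w := FiberBundle.extend_apply_self ..
  have f1 : (fun y => (inner ℝ (X y) (FiberBundle.extend (EuclideanSpace ℝ (Fin n)) v y) : ℝ)) =
      fun y => mvfderiv (𝓡 n) f y (coordField x v y) := funext fun y => h y _
  have f2 : (fun y => (inner ℝ (X y) (FiberBundle.extend (EuclideanSpace ℝ (Fin n)) w y) : ℝ)) =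
      fun y => mvfderiv (𝓡 n) f y (coordField x w y) := funext fun y => h y _
  rw [f2] at m1
  rw [f1] at m2
  rw [e1, e2] at c
  rw [FiberBundle.extend_apply_self] at m1 m2 t
  rw [FiberBundle.extend_apply_self] at t
  have t' : leviCivita (FiberBundle.extend (EuclideanSpace ℝ (Fin n)) w) x v -
    leviCivita (FiberBundle.extend (EuclideanSpace ℝ (Fin n)) v) x w = 0 := t.trans b
  have t'' : (inner ℝ (X x) (leviCivita (FiberBundle.extend (EuclideanSpace ℝ (Fin n)) w) x v) : ℝ)
    = inner ℝ (X x) (leviCivita (FiberBundle.extend (EuclideanSpace ℝ (Fin n)) v) x w) := by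
    rw [sub_eq_zero.1 t']
  have c1 := m1.symm.trans (c.trans m2)
  rw [real_inner_comm (nabla X x w) v]
  simp only [nabla, ContinuousLinearMap.coe_coe]
  linarith

lemma IsGradientField.symPart_eq (hX : IsGradientField X) : symPart X x = nabla X x := by
  refine LinearMap.ext fun v => ext_inner_right ℝ fun w => ?_
  have h := two_inner_symPart X x v w
  rw [← hX.nabla_symm] at h
  linarith

/-- Multiples of `∇|X|²` are gradient fields. -/
lemma IsSmoothField.isGradientField_of_inner (hX : IsSmoothField X) (r : ℝ)
    (h : ∀ x w, (inner ℝ (F x) w : ℝ) = r * inner ℝ (X x) (nabla X x w)) : IsGradientField F := by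
  have hXU : SmoothOn Set.univ X := hX.smoothOn _
  refine ⟨fun y => (r / 2) * inner ℝ (X y) (X y), ?_, fun x w => ?_⟩
  · exact contMDiffOn_univ.1 (contMDiffOn_const.mul (hXU.inner hXU))
  · have m := metric_on isOpen_univ hXU hXU (Set.mem_univ x) w
    have d : MDifferentiableAt (𝓡 n) 𝓘(ℝ, ℝ) (fun y => (inner ℝ (X y) (X y) : ℝ)) x :=
      mdifferentiableAt_inner (hXU.mdifferentiableAt isOpen_univ (Set.mem_univ x))
        (hXU.mdifferentiableAt isOpen_univ (Set.mem_univ x))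
    rw [mvfderiv_const_mul d, m, h, real_inner_comm (X x) (leviCivita X x w)]
    simp only [nabla, ContinuousLinearMap.coe_coe]
    ring

/-- For symmetric `∇X` the field `∇_X X` is the gradient of `|X|²/2`, hence an admissible direction
for the first variation. -/
lemma IsGradientField.nabla_self (hX : IsGradientField X) :
    IsGradientField fun y => nabla X y (X y) :=
  hX.isSmoothField.isGradientField_of_inner 1 fun x w => by rw [hX.nabla_symm, one_mul]

lemma IsKillingField.nabla_skew (hX : IsKillingField X) (v w : TangentSpace (𝓡 n) x) :
    inner ℝ (nabla X x v) w = -inner ℝ v (nabla X x w) := by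
  have h := two_inner_symPart X x v w
  rw [hX.2 x, LinearMap.zero_apply, inner_zero_left] at h
  linarith

/-- Skewness of `∇X` reverses the sign of the potential to `-|X|²/2`. A hypothesis about gradient
fields thus has consequences for Killing fields. -/
lemma IsKillingField.nabla_self (hX : IsKillingField X) :
    IsGradientField fun y => nabla X y (X y) :=
  hX.1.isGradientField_of_inner (-1) fun x w => by rw [hX.nabla_skew, neg_one_mul]

end Gradients

/-! ### Curvature in terms of the covariant derivative of `∇X` -/

section Curvature

variable {n : ℕ} {M : Type*} [TopologicalSpace M] [ChartedSpace (EuclideanSpace ℝ (Fin n)) M]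
  [IsManifold (𝓡 n) ∞ M]
  [RiemannianBundle (fun x : M => TangentSpace (𝓡 n) x)]
  [IsContMDiffRiemannianBundle (𝓡 n) ∞ (EuclideanSpace ℝ (Fin n))
    (fun x : M => TangentSpace (𝓡 n) x)]
variable {p x : M} {D F G V W W' X : ∀ x : M, TangentSpace (𝓡 n) x} {U : Set M}

lemma leviCivita_fun_add
    (hV : MDifferentiableAt (𝓡 n) (𝓡 n).tangent (fun x => (⟨x, V x⟩ : TangentBundle (𝓡 n) M)) x)
    (hW : MDifferentiableAt (𝓡 n) (𝓡 n).tangent (fun x => (⟨x, W x⟩ : TangentBundle (𝓡 n) M)) x)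
    (v : TangentSpace (𝓡 n) x) :
    leviCivita (fun y => V y + W y) x v = leviCivita V x v + leviCivita W x v :=
  congrArg (fun L : TangentSpace (𝓡 n) x →L[ℝ] TangentSpace (𝓡 n) x => L v)
    (leviCivita.isCovariantDerivativeOnUniv.add hV hW (Set.mem_univ x))

/-- The curvature operator of coordinate fields is skew. -/
lemma inner_curvatureField_coordField (a b : EuclideanSpace ℝ (Fin n))
    (hW : SmoothOn (chartAt (EuclideanSpace ℝ (Fin n)) p).source W)
    (hW' : SmoothOn (chartAt (EuclideanSpace ℝ (Fin n)) p).source W') :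
    (inner ℝ (curvatureField (coordField p a) (coordField p b) W p) (W' p) : ℝ) =
      -inner ℝ (W p) (curvatureField (coordField p a) (coordField p b) W' p) := by
  set S := (chartAt (EuclideanSpace ℝ (Fin n)) p).source
  have hS : IsOpen S := (chartAt (EuclideanSpace ℝ (Fin n)) p).open_source
  have hp : p ∈ S := mem_chart_source _ p
  have key : ∀ a b : EuclideanSpace ℝ (Fin n),
      mvfderiv (𝓡 n) (fun y => mvfderiv (𝓡 n) (fun y => (inner ℝ (W y) (W' y) : ℝ)) y
        (coordField p b y)) p (coordField p a p) =
      inner ℝ (leviCivita (fun y => leviCivita W y (coordField p b y)) p (coordField p a p)) (W' p)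
        + inner ℝ (leviCivita W p (coordField p b p)) (leviCivita W' p (coordField p a p))
        + (inner ℝ (leviCivita W p (coordField p a p)) (leviCivita W' p (coordField p b p))
        + inner ℝ (W p)
          (leviCivita (fun y => leviCivita W' y (coordField p b y)) p (coordField p a p))) := by
    intro a b
    have hb := smoothOn_coordField p b
    have h1 : SmoothOn S _ := SmoothOn.leviCivita hS hW hb
    have h2 : SmoothOn S _ := SmoothOn.leviCivita hS hW' hb
    have he : (fun y => mvfderiv (𝓡 n) (fun y => (inner ℝ (W y) (W' y) : ℝ)) y
        (coordField p b y)) =ᶠ[𝓝 p] fun y =>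
        (inner ℝ (leviCivita W y (coordField p b y)) (W' y) : ℝ) +
          inner ℝ (W y) (leviCivita W' y (coordField p b y)) := by
      filter_upwards [hS.mem_nhds hp] with y hy using metric_on hS hW hW' hy _
    have d1 : MDifferentiableAt (𝓡 n) 𝓘(ℝ, ℝ)
        (fun y => (inner ℝ (leviCivita W y (coordField p b y)) (W' y) : ℝ)) p :=
      mdifferentiableAt_inner (h1.mdifferentiableAt hS hp) (hW'.mdifferentiableAt hS hp)
    have d2 : MDifferentiableAt (𝓡 n) 𝓘(ℝ, ℝ)
        (fun y => (inner ℝ (W y) (leviCivita W' y (coordField p b y)) : ℝ)) p :=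
      mdifferentiableAt_inner (hW.mdifferentiableAt hS hp) (h2.mdifferentiableAt hS hp)
    have h3 := mvfderiv_congr (n := n) he
    rw [mvfderiv_fun_add d1 d2] at h3
    have h4 := congrArg (fun L => L (coordField p a p)) h3
    simp only [add_apply] at h4
    rw [metric_on hS h1 hW' hp, metric_on hS hW h2 hp] at h4
    exact h4
  have hf := hW.inner hW'
  -- The mixed products of first derivatives are symmetric in `a` and `b` and cancel; what remains
  -- is the sum of the two curvature terms.
  have hc := mvfderiv_mvfderiv_comm (p := p) hf a b
  rw [key a b, key b a] at hc
  have hbr := mlieBracket_coordField a b hp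
  simp only [curvatureField, hbr, map_zero, sub_zero, inner_sub_left, inner_sub_right]
  linarith

/-- `R(X, w) X = (∇_X N) w - ∇_w ∇_X X + N² w` for `N = ∇X`. -/
lemma curvature_eq (hX : IsSmoothField X) (w w' : TangentSpace (𝓡 n) x) :
    curvature x (X x) w w' (X x) = -inner ℝ (covDerivEnd (nabla X) X x w) w'
      + inner ℝ (nabla (fun y => nabla X y (X y)) x w) w'
      - inner ℝ (nabla X x (nabla X x w)) w' := by
  set S := (chartAt (EuclideanSpace ℝ (Fin n)) x).source
  have hS : IsOpen S := (chartAt (EuclideanSpace ℝ (Fin n)) x).open_source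
  have hxS : x ∈ S := mem_chart_source _ x
  have hXS : SmoothOn S X := hX.smoothOn S
  set U : ∀ y : M, TangentSpace (𝓡 n) y := coordField x (X x) with hU
  set V : ∀ y : M, TangentSpace (𝓡 n) y := coordField x w with hV
  have hUx : U x = X x := FiberBundle.extend_apply_self ..
  have hVx : V x = w := FiberBundle.extend_apply_self ..
  have hUS : SmoothOn S U := smoothOn_coordField x _
  have hVS : SmoothOn S V := smoothOn_coordField x _
  have hN := smoothEndOn_nabla hXS
  have hNX : SmoothOn S _ := hN S subset_rfl hS X hXS
  have hDS : SmoothOn S _ := hUS.sub hXS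
  have hND : SmoothOn S _ := hN S subset_rfl hS _ hDS
  -- Skewness in the last two arguments transfers the curvature operator from the extension of `w'`
  -- to the field `X` itself.
  have h1 := inner_curvatureField_coordField (p := x) (X x) w (smoothOn_coordField x w') hXS
  have hc : curvature x (X x) w w' (X x) = inner ℝ (curvatureField U V (coordField x w') x) (X x) :=
    rfl
  have hw' : coordField x w' x = w' := FiberBundle.extend_apply_self ..
  rw [hw'] at h1
  -- The constant extension `U` and the field `X` agree only at `x`. Their difference contributes `N
  -- (∇_w U - N w)` to `∇_w (N U)`, where `N = ∇X`; the term with `∇_w U` cancels because `U` and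
  -- `V` commute, and the other one is the `N²` of the formula.
  have hD0 : U x - X x = 0 := by rw [hUx, sub_self]
  have h2 := leviCivita_end_of_eq_zero hS hxS hN hDS hD0 w
  have e1 : leviCivita (fun y => U y - X y) x w = leviCivita U x w - leviCivita X x w := by
    have h := leviCivita_fun_add (hDS.mdifferentiableAt hS hxS) (hXS.mdifferentiableAt hS hxS) w
    simp only [sub_add_cancel] at h
    rw [h, add_sub_cancel_right]
  have e2 : leviCivita (fun y => leviCivita X y (U y)) x w =
      leviCivita (fun y => nabla X y (U y - X y)) x w +
        leviCivita (fun y => nabla X y (X y)) x w := by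
    have h := leviCivita_fun_add (hND.mdifferentiableAt hS hxS) (hNX.mdifferentiableAt hS hxS) w
    simp only [← map_add, sub_add_cancel] at h
    exact h
  have t := leviCivita_sub_leviCivita (hUS.mdifferentiableAt hS hxS)
    (hVS.mdifferentiableAt hS hxS)
  have hbr : VectorField.mlieBracket (𝓡 n) U V x = 0 := mlieBracket_coordField (X x) w hxS
  rw [hbr, sub_eq_zero, hUx, hVx] at t
  have e3 : covDerivEnd (nabla X) X x w =
      leviCivita (fun y => nabla X y (V y)) x (X x) - nabla X x (leviCivita V x (X x)) := rfl
  have e4 : curvatureField U V X x = covDerivEnd (nabla X) X x w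
      - nabla (fun y => nabla X y (X y)) x w + nabla X x (nabla X x w) := by
    have e5 : curvatureField U V X x = leviCivita (fun y => nabla X y (V y)) x (X x)
        - leviCivita (fun y => leviCivita X y (U y)) x w := by
      rw [curvatureField, hbr, map_zero, sub_zero, hUx, hVx]; rfl
    rw [e5, e2, h2, e1, e3, map_sub, t]
    change _ - (nabla X x (leviCivita U x w) - nabla X x (nabla X x w) + nabla _ x w) = _
    abel
  rw [hc, h1, e4, inner_add_right, inner_sub_right, real_inner_comm w', real_inner_comm w',
    real_inner_comm w']
  ring

end Curvature

/-! ### Comparison of the two second variation operators -/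

section SecondVariationOperators

variable {n : ℕ} {M : Type*} [TopologicalSpace M] [ChartedSpace (EuclideanSpace ℝ (Fin n)) M]
  [IsManifold (𝓡 n) ∞ M]
  [RiemannianBundle (fun x : M => TangentSpace (𝓡 n) x)]
  [IsContMDiffRiemannianBundle (𝓡 n) ∞ (EuclideanSpace ℝ (Fin n))
    (fun x : M => TangentSpace (𝓡 n) x)]
variable {p x : M} {D F G V W W' X : ∀ x : M, TangentSpace (𝓡 n) x} {U : Set M}

lemma inner_covDerivEnd_symPart_comm (hX : IsSmoothField X) (w w' : TangentSpace (𝓡 n) x) :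
    (inner ℝ (covDerivEnd (symPart X) X x w) w' : ℝ) =
      inner ℝ w (covDerivEnd (symPart X) X x w') := by
  have hB := smoothEndOn_symPart (hX.smoothOn Set.univ)
  have h := inner_covDerivEnd_add_swap isOpen_univ (Set.mem_univ x) hB hB
    (fun y _ v w => by rw [← symPart_symm]; ring) X w w'
  linarith

/-- The symmetrization of `A² + B² + R(X, ·, ·, X)` is `∇(∇_X X) - ∇_X B`. -/
lemma sq_add_curvature_symm (hX : IsSmoothField X) (w w' : TangentSpace (𝓡 n) x) :
    (inner ℝ w' ((skewPart X x ^ 2 + symPart X x ^ 2) w) + curvature x (X x) w w' (X x))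
      + (inner ℝ w ((skewPart X x ^ 2 + symPart X x ^ 2) w') + curvature x (X x) w' w (X x)) =
    -2 * inner ℝ w' (covDerivEnd (symPart X) X x w)
      + 2 * inner ℝ w' (symPart (fun y => nabla X y (X y)) x w) := by
  have hXU := hX.smoothOn Set.univ
  have h1 := inner_covDerivEnd_add_swap isOpen_univ (Set.mem_univ x) (smoothEndOn_nabla hXU)
    (smoothEndOn_symPart hXU) (fun y _ v w => two_inner_symPart X y v w) X w w'
  have h2 := two_inner_symPart (fun y => nabla X y (X y)) x w w'
  -- In `(A + B)² = A² + B² + (AB + BA)` the last summand is skew, since `A` is skew and `B`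
  -- symmetric. Symmetrization removes it, which `a1` to `a4` express.
  have a1 := skewPart_skew X x (symPart X x w) w'
  have a2 := symPart_symm X x (skewPart X x w') w
  have a3 := skewPart_skew X x (symPart X x w') w
  have a4 := symPart_symm X x (skewPart X x w) w'
  have e : ∀ u : TangentSpace (𝓡 n) x, nabla X x (nabla X x u) =
      skewPart X x (skewPart X x u) + symPart X x (symPart X x u)
        + (skewPart X x (symPart X x u) + symPart X x (skewPart X x u)) := by
    intro u
    rw [nabla_eq]
    simp only [LinearMap.add_apply, map_add]
    abel
  rw [curvature_eq hX, curvature_eq hX, e, e]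
  simp only [pow_two, LinearMap.add_apply, Module.End.mul_apply, inner_add_left, inner_add_right]
  have c := fun u u' : TangentSpace (𝓡 n) x => real_inner_comm u u'
  linarith [c w' (skewPart X x (skewPart X x w)), c w' (symPart X x (symPart X x w)),
    c w (skewPart X x (skewPart X x w')), c w (symPart X x (symPart X x w')),
    c (skewPart X x w') (symPart X x w), c (skewPart X x w) (symPart X x w'),
    c w (covDerivEnd (nabla X) X x w'), c w (nabla (fun y => nabla X y (X y)) x w'),
    c w' (covDerivEnd (symPart X) X x w), c w' (symPart (fun y => nabla X y (X y)) x w)]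

lemma formsInner_ofDegree_add {E : Type*} [NormedAddCommGroup E] [InnerProductSpace ℝ E]
    [FiniteDimensional ℝ E] {k : ℕ} (α : E [⋀^Fin k]→ₗ[ℝ] ℝ) (a b : Forms E) :
    formsInner (ofDegree α) (a + b) = formsInner (ofDegree α) a + formsInner (ofDegree α) b := by
  simp only [formsInner_ofDegree, formInner, Pi.add_apply, AlternatingMap.add_apply, mul_add,
    Finset.sum_add_distrib]

/-- The matrix of contractions paired with the coefficients is symmetric in `j`, `m`, so the
quadratic form does not see the skew part of `S`. -/
lemma formsInner_cliffSum_congr {E : Type*} [NormedAddCommGroup E] [InnerProductSpace ℝ E]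
    [FiniteDimensional ℝ E] {n k : ℕ} (v : OrthonormalBasis (Fin n) ℝ E)
    (α : E [⋀^Fin k]→ₗ[ℝ] ℝ) {S T : Fin n → Fin n → ℝ}
    (h : ∀ j m, S j m + S m j = T j m + T m j) :
    formsInner (ofDegree α) (cliffSum v S (ofDegree α)) =
      formsInner (ofDegree α) (cliffSum v T (ofDegree α)) := by
  have key : ∀ S : Fin n → Fin n → ℝ, 2 * formsInner (ofDegree α) (cliffSum v S (ofDegree α)) =
      ∑ j, ∑ m, (S j m + S m j) * (contr (comps v α) j m + contr (comps v α) m j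
        - if j = m then formInner α α else 0) := by
    intro S
    rw [two_mul]
    nth_rw 2 [formsInner_cliffSum]
    rw [Finset.sum_comm, formsInner_cliffSum, ← Finset.sum_add_distrib]
    refine Finset.sum_congr rfl fun j _ => ?_
    rw [← Finset.sum_add_distrib]
    refine Finset.sum_congr rfl fun m _ => ?_
    simp only [eq_comm (a := m) (b := j)]
    ring
  have := key S
  rw [Finset.sum_congr rfl fun j _ => Finset.sum_congr rfl fun m _ => by rw [h j m],
    ← key T] at this
  linarith

lemma cliffSum_add {E : Type*} [NormedAddCommGroup E] [InnerProductSpace ℝ E]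
    {n : ℕ} (v : OrthonormalBasis (Fin n) ℝ E) (S T : Fin n → Fin n → ℝ) :
    cliffSum v (fun j m => S j m + T j m) = cliffSum v S + cliffSum v T := by
  simp only [cliffSum, add_smul, Finset.sum_add_distrib]

variable {k : ℕ} (z : DiffForm n k M)

/-- The two second variation integrands differ by the first variation along `∇_X X`. -/
lemma density_secondVarOp₂ (hX : IsSmoothField X)
    (v : ∀ x : M, OrthonormalBasis (Fin n) ℝ (TangentSpace (𝓡 n) x)) (x : M) :
    density z (fun x => secondVarOp₂ X x (v x)) x = density z (fun x => secondVarOp₁ X x (v x)) x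
      + density z (fun x => symOp (fun y => nabla X y (X y)) x (v x)) x := by
  have h : formsInner (ofDegree (z x)) (cliffSum (v x) (fun j m =>
      inner ℝ (v x j) ((skewPart X x ^ 2 + symPart X x ^ 2) (v x m))
        + curvature x (X x) (v x m) (v x j) (X x)) (ofDegree (z x))) =
      formsInner (ofDegree (z x)) (cliffSum (v x) (fun j m =>
        -inner ℝ (v x j) (covDerivEnd (symPart X) X x (v x m))
        + inner ℝ (v x j) (symPart (fun y => nabla X y (X y)) x (v x m))) (ofDegree (z x))) := by
    refine formsInner_cliffSum_congr _ _ fun j m => ?_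
    have h1 := sq_add_curvature_symm hX (v x m) (v x j)
    have h2 := inner_covDerivEnd_symPart_comm hX (v x m) (v x j)
    have h3 := symPart_symm (fun y => nabla X y (X y)) x (v x m) (v x j)
    rw [real_inner_comm] at h2 h3
    linarith
  rw [density, density, density, secondVarOp₂, secondVarOp₁, LinearMap.add_apply,
    LinearMap.add_apply, formsInner_ofDegree_add, formsInner_ofDegree_add, h, cliffSum_add,
    LinearMap.add_apply, formsInner_ofDegree_add, symOp, symOp]
  ring

lemma cliffSum_zero {E : Type*} [NormedAddCommGroup E] [InnerProductSpace ℝ E]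
    {n : ℕ} (v : OrthonormalBasis (Fin n) ℝ E) : cliffSum v (fun _ _ => 0) = 0 := by
  simp [cliffSum]

lemma IsKillingField.symOp_eq_zero (hX : IsKillingField X)
    (v : OrthonormalBasis (Fin n) ℝ (TangentSpace (𝓡 n) x)) : symOp X x v = 0 := by
  rw [symOp, hX.2 x]
  simpa using cliffSum_zero v

lemma IsKillingField.secondVarOp₁_eq_zero (hX : IsKillingField X)
    (v : OrthonormalBasis (Fin n) ℝ (TangentSpace (𝓡 n) x)) : secondVarOp₁ X x v = 0 := by
  have h : ∀ w, covDerivEnd (symPart X) X x w = 0 := by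
    intro w
    have h0 : (fun y => symPart X y (FiberBundle.extend (EuclideanSpace ℝ (Fin n)) w y)) = 0 := by
      funext y
      rw [hX.2 y]; rfl
    rw [covDerivEnd, h0, CovariantDerivative.zero, hX.2 x]
    simp
  rw [secondVarOp₁, hX.symOp_eq_zero]
  simp only [h, inner_zero_right, neg_zero, cliffSum_zero]
  simp

lemma formsInner_ofDegree_zero {E : Type*} [NormedAddCommGroup E] [InnerProductSpace ℝ E]
    [FiniteDimensional ℝ E] {k : ℕ} (α : E [⋀^Fin k]→ₗ[ℝ] ℝ) :
    formsInner (ofDegree α) 0 = 0 := by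
  simp [formsInner_ofDegree, formInner]

lemma IsKillingField.density_secondVarOp₂ (hX : IsKillingField X)
    (v : ∀ x : M, OrthonormalBasis (Fin n) ℝ (TangentSpace (𝓡 n) x)) (x : M) :
    density z (fun x => secondVarOp₂ X x (v x)) x =
      density z (fun x => symOp (fun y => nabla X y (X y)) x (v x)) x := by
  rw [SecondVariation.density_secondVarOp₂ z hX.1]
  simp only [density, hX.secondVarOp₁_eq_zero, LinearMap.zero_apply, formsInner_ofDegree_zero, zero_add]

/-- With orthogonal contractions only the diagonal coefficients enter. Since `A = ∇X` is skew and `B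
= 0`, the diagonal entries of `A²` are `-|∇_{v_j} X|²`. -/
lemma IsKillingField.density_eq_sum_bochnerTerm (hX : IsKillingField X)
    (v : ∀ x : M, OrthonormalBasis (Fin n) ℝ (TangentSpace (𝓡 n) x)) (x : M)
    (h : ∀ j m, j ≠ m → intInner z x (v x j) (v x m) = 0) :
    density z (fun x => secondVarOp₂ X x (v x)) x =
      -∑ j, bochnerTerm X x (v x j) *
        (2 * intInner z x (v x j) (v x j) - formInner (z x) (z x)) := by
  have h' : ∀ j m, contr (comps (v x) (z x)) j m =
      if j = m then intInner z x (v x j) (v x j) else 0 := by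
    intro j m
    rw [← formsInner_intMul]
    split_ifs with hjm
    · rw [← hjm]; rfl
    · exact h j m hjm
  simp only [density, secondVarOp₂, hX.symOp_eq_zero, ne_eq, OfNat.ofNat_ne_zero,
    not_false_eq_true, zero_pow, add_zero, formsInner_cliffSum, h']
  rw [← Finset.sum_neg_distrib]
  refine Finset.sum_congr rfl fun j _ => ?_
  rw [Finset.sum_eq_single j (fun m _ hm => by simp [hm, hm.symm]) (by simp)]
  have hA : skewPart X x = nabla X x := by
    have := nabla_eq X x
    rw [hX.2 x, add_zero] at this
    exact this.symm
  have hn : (inner ℝ (v x j) ((skewPart X x ^ 2 + symPart X x ^ 2) (v x j)) : ℝ) =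
      -‖nabla X x (v x j)‖ ^ 2 := by
    rw [hA, hX.2 x, ← real_inner_self_eq_norm_sq, hX.nabla_skew, neg_neg, pow_two, pow_two,
      mul_zero, add_zero, Module.End.mul_apply]
  rw [hn, bochnerTerm]
  simp only [if_true]
  ring

end SecondVariationOperators

/-! ### The Lie derivative of a bilinear form along a flow, in coordinates -/

section LieDerivative

variable {n : ℕ} {M : Type*} [TopologicalSpace M] [ChartedSpace (EuclideanSpace ℝ (Fin n)) M]
  [IsManifold (𝓡 n) ∞ M]
  [RiemannianBundle (fun x : M => TangentSpace (𝓡 n) x)]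

/-- The bilinear form `⟨T ·, ·⟩` in the coordinates of the chart at `p`. -/
def formRep (T : ∀ x : M, TangentSpace (𝓡 n) x →ₗ[ℝ] TangentSpace (𝓡 n) x) (p : M)
    (u : EuclideanSpace ℝ (Fin n)) :
    EuclideanSpace ℝ (Fin n) →ₗ[ℝ] EuclideanSpace ℝ (Fin n) →ₗ[ℝ] ℝ :=
  (innerₗ (TangentSpace (𝓡 n) ((chartAt (EuclideanSpace ℝ (Fin n)) p).symm u))).compl₁₂
    ((T _).comp (chartFrame p u).toLinearMap) (chartFrame p u).toLinearMap

variable {p x : M} {W X : ∀ x : M, TangentSpace (𝓡 n) x} {U : Set M}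
  {T : ∀ x : M, TangentSpace (𝓡 n) x →ₗ[ℝ] TangentSpace (𝓡 n) x}
  {u : EuclideanSpace ℝ (Fin n)}

lemma formRep_apply (a b : EuclideanSpace ℝ (Fin n)) :
    formRep T p u a b = inner ℝ (T _ (chartFrame p u a)) (chartFrame p u b) := rfl

lemma bilin_eq_sum (β : EuclideanSpace ℝ (Fin n) →ₗ[ℝ] EuclideanSpace ℝ (Fin n) →ₗ[ℝ] ℝ)
    (a b : EuclideanSpace ℝ (Fin n)) :
    β a b = ∑ i, ∑ j, a i * b j *
      β (EuclideanSpace.single i (1 : ℝ)) (EuclideanSpace.single j (1 : ℝ)) := by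
  have h : ∀ a : EuclideanSpace ℝ (Fin n), a = ∑ i, a i • EuclideanSpace.single i (1 : ℝ) := by
    intro a
    simpa using ((EuclideanSpace.basisFun (Fin n) ℝ).sum_repr a).symm
  conv_lhs => rw [h a, h b]
  simp only [map_sum, map_smul, LinearMap.sum_apply, LinearMap.smul_apply, smul_eq_mul,
    Finset.mul_sum]
  rw [Finset.sum_comm]
  exact Finset.sum_congr rfl fun i _ => Finset.sum_congr rfl fun j _ => by ring

variable [IsContMDiffRiemannianBundle (𝓡 n) ∞ (EuclideanSpace ℝ (Fin n))
    (fun x : M => TangentSpace (𝓡 n) x)]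

lemma contDiffOn_formRep (hT : SmoothEndOn (chartAt (EuclideanSpace ℝ (Fin n)) p).source T)
    (a b : EuclideanSpace ℝ (Fin n)) :
    ContDiffOn ℝ ∞ (fun u => formRep T p u a b)
      (chartAt (EuclideanSpace ℝ (Fin n)) p).target := by
  set c := chartAt (EuclideanSpace ℝ (Fin n)) p with hc
  have h1 : SmoothOn c.source _ := hT c.source subset_rfl c.open_source _ (smoothOn_coordField p a)
  have h2 := (h1.inner (smoothOn_coordField p b)).comp
    (contMDiffOn_chart_symm (I := 𝓡 n) (n := ∞)) c.mapsTo_symm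
  refine (contMDiffOn_iff_contDiffOn.1 h2).congr fun v hv => ?_
  rw [formRep_apply, ← coordField_symm hv, ← coordField_symm hv]
  rfl

lemma covDerivEnd_apply (hU : IsOpen U) (hx : x ∈ U) (hT : SmoothEndOn U T) (hW : SmoothOn U W)
    (X : ∀ x : M, TangentSpace (𝓡 n) x) :
    covDerivEnd T X x (W x) =
      leviCivita (fun y => T y (W y)) x (X x) - T x (leviCivita W x (X x)) := by
  set O := U ∩ (chartAt (EuclideanSpace ℝ (Fin n)) x).source
  have hO : IsOpen O := hU.inter (chartAt (EuclideanSpace ℝ (Fin n)) x).open_source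
  have hxO : x ∈ O := ⟨hx, mem_chart_source _ x⟩
  have hOU : O ⊆ U := Set.inter_subset_left
  set e := FiberBundle.extend (E := fun x : M => TangentSpace (𝓡 n) x)
    (EuclideanSpace ℝ (Fin n)) (W x) with he'
  have he : SmoothOn O e := (smoothOn_extend x (W x)).mono Set.inter_subset_right
  have hex : e x = W x := FiberBundle.extend_apply_self ..
  have hWO : SmoothOn O W := hW.mono hOU
  have hD : SmoothOn O _ := hWO.sub he
  have hTO : SmoothEndOn O T := fun O' h => hT O' (h.trans hOU)
  have hTD : SmoothOn O _ := hTO O subset_rfl hO _ hD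
  have hTe : SmoothOn O _ := hTO O subset_rfl hO _ he
  have h0 : W x - e x = 0 := by rw [hex, sub_self]
  have h1 := leviCivita_end_of_eq_zero hO hxO hTO hD h0 (X x)
  have h2 := leviCivita_fun_add (hD.mdifferentiableAt hO hxO) (he.mdifferentiableAt hO hxO) (X x)
  have h3 := leviCivita_fun_add (hTD.mdifferentiableAt hO hxO) (hTe.mdifferentiableAt hO hxO)
    (X x)
  simp only [← map_add, sub_add_cancel] at h2 h3
  rw [h2, h3, h1, map_add, covDerivEnd]
  abel

/-- The Lie derivative of the bilinear form `⟨T ·, ·⟩` along `X`, in coordinates. -/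
lemma lie_formRep (hX : SmoothOn (chartAt (EuclideanSpace ℝ (Fin n)) p).source X)
    (hT : SmoothEndOn (chartAt (EuclideanSpace ℝ (Fin n)) p).source T)
    (hu : u ∈ (chartAt (EuclideanSpace ℝ (Fin n)) p).target) (a b : EuclideanSpace ℝ (Fin n)) :
    fderiv ℝ (fun v => formRep T p v a b) u (fieldRep p X u)
      + formRep T p u (fderiv ℝ (fieldRep p X) u a) b
      + formRep T p u a (fderiv ℝ (fieldRep p X) u b) =
    inner ℝ (covDerivEnd T X _ (chartFrame p u a)) (chartFrame p u b)
      + inner ℝ (T _ (nabla X _ (chartFrame p u a))) (chartFrame p u b)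
      + inner ℝ (T _ (chartFrame p u a)) (nabla X _ (chartFrame p u b)) := by
  set c := chartAt (EuclideanSpace ℝ (Fin n)) p with hc
  have hS : IsOpen c.source := c.open_source
  have hy : c.symm u ∈ c.source := c.map_target hu
  have hea : SmoothOn c.source _ := smoothOn_coordField p a
  have heb : SmoothOn c.source _ := smoothOn_coordField p b
  have hTa : SmoothOn c.source _ := hT c.source subset_rfl hS _ hea
  have h1 : fderiv ℝ (fun v => formRep T p v a b) u (fieldRep p X u) =
      mvfderiv (𝓡 n) (fun y => (inner ℝ (T y (coordField p a y)) (coordField p b y) : ℝ))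
        (c.symm u) (X (c.symm u)) := by
    rw [mvfderiv_field hu (((hTa.inner heb).contMDiffAt (hS.mem_nhds hy)).mdifferentiableAt
      (by simp))]
    have he : (fun v => formRep T p v a b) =ᶠ[𝓝 u] fun v =>
        (inner ℝ (T (c.symm v) (coordField p a (c.symm v))) (coordField p b (c.symm v)) : ℝ) := by
      filter_upwards [c.open_target.mem_nhds hu] with v hv
      rw [formRep_apply, coordField_symm hv, coordField_symm hv]
    rw [he.fderiv_eq]
  -- The left side is minus the bracket of `X` with the coordinate field of `a`, and vanishing
  -- torsion rewrites this bracket by covariant derivatives.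
  have h2 : ∀ a : EuclideanSpace ℝ (Fin n), chartFrame p u (fderiv ℝ (fieldRep p X) u a) =
      nabla X _ (chartFrame p u a) - leviCivita (coordField p a) (c.symm u) (X (c.symm u)) := by
    intro a
    have hea : SmoothOn c.source _ := smoothOn_coordField p a
    have t := leviCivita_sub_leviCivita (hX.mdifferentiableAt hS hy) (hea.mdifferentiableAt hS hy)
    have b := mlieBracket_coordField_right hX hu a
    have t' := t.trans b
    rw [coordField_symm hu] at t'
    rw [← neg_sub]
    exact (neg_eq_iff_eq_neg.2 t').symm
  have h3 := covDerivEnd_apply hS hy hT hea X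
  rw [coordField_symm hu] at h3
  rw [h1, metric_on hS hTa heb hy, formRep_apply, formRep_apply, h2, h2, h3, coordField_symm hu,
    coordField_symm hu]
  simp only [map_sub, inner_sub_left, inner_sub_right]
  ring

/-- The derivative of `⟨T ·, ·⟩` along solutions of the variational equation. -/
lemma hasDerivAt_formRep (hX : SmoothOn (chartAt (EuclideanSpace ℝ (Fin n)) p).source X)
    (hT : SmoothEndOn (chartAt (EuclideanSpace ℝ (Fin n)) p).source T)
    {γ : ℝ → EuclideanSpace ℝ (Fin n) × (EuclideanSpace ℝ (Fin n) →L[ℝ] EuclideanSpace ℝ (Fin n))}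
    {t : ℝ} (hγ : HasDerivAt γ (variationalField (fieldRep p X) (γ t)) t)
    (hu : (γ t).1 ∈ (chartAt (EuclideanSpace ℝ (Fin n)) p).target)
    (a b : EuclideanSpace ℝ (Fin n)) :
    HasDerivAt (fun τ => formRep T p (γ τ).1 ((γ τ).2 a) ((γ τ).2 b))
      (inner ℝ (covDerivEnd T X _ (chartFrame p (γ t).1 ((γ t).2 a)))
          (chartFrame p (γ t).1 ((γ t).2 b))
        + inner ℝ (T _ (nabla X _ (chartFrame p (γ t).1 ((γ t).2 a))))
          (chartFrame p (γ t).1 ((γ t).2 b))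
        + inner ℝ (T _ (chartFrame p (γ t).1 ((γ t).2 a)))
          (nabla X _ (chartFrame p (γ t).1 ((γ t).2 b)))) t := by
  set c := chartAt (EuclideanSpace ℝ (Fin n)) p with hc
  rw [← lie_formRep hX hT hu]
  have hd : ∀ i j : Fin n, DifferentiableAt ℝ (fun v => formRep T p v
      (EuclideanSpace.single i (1 : ℝ)) (EuclideanSpace.single j (1 : ℝ))) (γ t).1 := fun i j =>
    ((contDiffOn_formRep hT _ _).contDiffAt (c.open_target.mem_nhds hu)).differentiableAt (by simp)
  have h1 : HasDerivAt (fun τ => (γ τ).1) (fieldRep p X (γ t).1) t := hγ.fst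
  have h1' : HasDerivAt (fun τ => (γ τ).2) ((fderiv ℝ (fieldRep p X) (γ t).1).comp (γ t).2) t :=
    hγ.snd
  have h2 : ∀ a, HasDerivAt (fun τ => (γ τ).2 a) (fderiv ℝ (fieldRep p X) (γ t).1 ((γ t).2 a)) t :=
    fun a => ((ContinuousLinearMap.apply ℝ (EuclideanSpace ℝ (Fin n)) a).hasFDerivAt.comp_hasDerivAt
      t h1')
  have h2' : ∀ a i, HasDerivAt (fun τ => ((γ τ).2 a) i)
      (fderiv ℝ (fieldRep p X) (γ t).1 ((γ t).2 a) i) t := fun a i =>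
    ((EuclideanSpace.proj (𝕜 := ℝ) i).hasFDerivAt.comp_hasDerivAt t (h2 a))
  have h5 : ∀ i j, HasDerivAt (fun τ => formRep T p (γ τ).1 (EuclideanSpace.single i (1 : ℝ))
      (EuclideanSpace.single j (1 : ℝ))) (fderiv ℝ (fun v => formRep T p v
      (EuclideanSpace.single i (1 : ℝ)) (EuclideanSpace.single j (1 : ℝ))) (γ t).1
      (fieldRep p X (γ t).1)) t := fun i j => by
    have := HasFDerivAt.comp_hasDerivAt (f := fun τ => (γ τ).1) t (hd i j).hasFDerivAt h1
    exact this
  -- Expanded in the standard basis, the expression is a sum of products of scalar functions of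
  -- time, to which the ordinary product rule applies.
  have h3 : HasDerivAt (fun τ => ∑ i, ∑ j, (γ τ).2 a i * (γ τ).2 b j *
      formRep T p (γ τ).1 (EuclideanSpace.single i (1 : ℝ)) (EuclideanSpace.single j (1 : ℝ))) _ t :=
    HasDerivAt.fun_sum fun i _ => HasDerivAt.fun_sum fun j _ =>
      ((h2' a i).mul (h2' b j)).mul (h5 i j)
  have h4 : fderiv ℝ (fun v => formRep T p v ((γ t).2 a) ((γ t).2 b)) (γ t).1 =
      ∑ i, ∑ j, ((γ t).2 a i * (γ t).2 b j) • fderiv ℝ (fun v => formRep T p v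
      (EuclideanSpace.single i (1 : ℝ)) (EuclideanSpace.single j (1 : ℝ))) (γ t).1 := by
    simp_rw [fun v => bilin_eq_sum (formRep T p v) ((γ t).2 a) ((γ t).2 b)]
    rw [fderiv_fun_sum fun i _ => DifferentiableAt.fun_sum fun j _ => (hd i j).const_mul _]
    refine Finset.sum_congr rfl fun i _ => ?_
    rw [fderiv_fun_sum fun j _ => (hd i j).const_mul _]
    refine Finset.sum_congr rfl fun j _ => ?_
    rw [fderiv_const_mul (hd i j)]
  simp_rw [fun τ => bilin_eq_sum (formRep T p (γ τ).1) ((γ τ).2 a) ((γ τ).2 b)]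
  refine h3.congr_deriv ?_
  rw [h4, bilin_eq_sum _ _ ((γ t).2 b), bilin_eq_sum _ ((γ t).2 a)]
  simp only [sum_apply, smul_apply, smul_eq_mul, ← Finset.sum_add_distrib]
  refine Finset.sum_congr rfl fun i _ => Finset.sum_congr rfl fun j _ => ?_
  rw [Pi.mul_apply]
  ring

end LieDerivative

/-! ### The volume factor of a linear map -/

section Jacobian

variable {V V' : Type*} [NormedAddCommGroup V] [InnerProductSpace ℝ V] [FiniteDimensional ℝ V]
  [NormedAddCommGroup V'] [InnerProductSpace ℝ V'] [FiniteDimensional ℝ V']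

/-- The factor by which `L` changes the volume. -/
def jac (L : V →ₗ[ℝ] V') : ℝ := Real.sqrt (LinearMap.det (LinearMap.adjoint L ∘ₗ L))

lemma jac_nonneg (L : V →ₗ[ℝ] V') : 0 ≤ jac L := Real.sqrt_nonneg _

lemma det_bilin_comp {F : Type*} [AddCommGroup F] [Module ℝ F] {ι : Type*} [Fintype ι]
    [DecidableEq ι] (b : Module.Basis ι ℝ F) (β : F →ₗ[ℝ] F →ₗ[ℝ] ℝ) (S T : F →ₗ[ℝ] F) :
    (Matrix.of fun i j => β (S (b i)) (T (b j))).det =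
      LinearMap.det S * LinearMap.det T * (Matrix.of fun i j => β (b i) (b j)).det := by
  have h := congrArg Matrix.det (LinearMap.toMatrix₂_compl₁₂ b b b b β S T)
  rw [Matrix.det_mul, Matrix.det_mul, Matrix.det_transpose, LinearMap.det_toMatrix,
    LinearMap.det_toMatrix] at h
  have h1 : LinearMap.toMatrix₂ b b (β.compl₁₂ S T) =
      Matrix.of fun i j => β (S (b i)) (T (b j)) := by
    ext i j
    rw [LinearMap.toMatrix₂_apply]; rfl
  have h2 : LinearMap.toMatrix₂ b b β = Matrix.of fun i j => β (b i) (b j) := by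
    ext i j
    rw [LinearMap.toMatrix₂_apply]; rfl
  rw [h1, h2] at h
  rw [h]
  ring

lemma det_gram_nonneg {ι : Type*} [Fintype ι] [DecidableEq ι] (b : ι → V) :
    0 ≤ (Matrix.of fun i j => (inner ℝ (b i) (b j) : ℝ)).det :=
  (Matrix.posSemidef_gram ℝ b).det_nonneg

/-- The Gram matrix of the images is that of the form `⟨L* L ·, ·⟩` in the basis `b`, so its
determinant acquires the factor `det (L* L)`. -/
lemma sqrt_det_gram_map {ι : Type*} [Fintype ι] [DecidableEq ι] (b : Module.Basis ι ℝ V)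
    (L : V →ₗ[ℝ] V') :
    Real.sqrt (Matrix.of fun i j => (inner ℝ (L (b i)) (L (b j)) : ℝ)).det =
      jac L * Real.sqrt (Matrix.of fun i j => (inner ℝ (b i) (b j) : ℝ)).det := by
  have h := det_bilin_comp b (innerₗ V) (LinearMap.adjoint L ∘ₗ L) LinearMap.id
  simp only [innerₗ_apply_apply, LinearMap.comp_apply, LinearMap.adjoint_inner_left,
    LinearMap.id_apply, LinearMap.det_id, mul_one] at h
  rw [h, jac, Real.sqrt_mul' _ (det_gram_nonneg b)]

end Jacobian

/-! ### The Riemannian measure and its change of variables between charts -/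

section Volume

variable {n : ℕ} {M : Type*} [TopologicalSpace M] [ChartedSpace (EuclideanSpace ℝ (Fin n)) M]
  [IsManifold (𝓡 n) ∞ M]
  [RiemannianBundle (fun x : M => TangentSpace (𝓡 n) x)]
variable {p q y : M} {u : EuclideanSpace ℝ (Fin n)} {A : Set M} {ψ : M → M}

/-- The differential of the chart at `p`. -/
def chartCoframe (p y : M) : TangentSpace (𝓡 n) y →L[ℝ] EuclideanSpace ℝ (Fin n) :=
  mfderiv (𝓡 n) (𝓡 n) (chartAt (EuclideanSpace ℝ (Fin n)) p) y

lemma chartCoframe_chartFrame (hu : u ∈ (chartAt (EuclideanSpace ℝ (Fin n)) p).target)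
    (a : EuclideanSpace ℝ (Fin n)) : chartCoframe p _ (chartFrame p u a) = a :=
  coord_chartFrame hu a

lemma chartFrame_chartCoframe (hu : u ∈ (chartAt (EuclideanSpace ℝ (Fin n)) p).target)
    (a : TangentSpace (𝓡 n) ((chartAt (EuclideanSpace ℝ (Fin n)) p).symm u)) :
    chartFrame p u (chartCoframe p _ a) = a := by
  obtain ⟨a', rfl⟩ := (chartFrame_bijective hu).2 a
  rw [chartCoframe_chartFrame hu]

lemma inner_eq_formRep (hy : y ∈ (chartAt (EuclideanSpace ℝ (Fin n)) p).source)
    (a b : TangentSpace (𝓡 n) y) :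
    (inner ℝ a b : ℝ) = formRep (fun _ => LinearMap.id) p (chartAt (EuclideanSpace ℝ (Fin n)) p y)
      (chartCoframe p y a) (chartCoframe p y b) := by
  obtain ⟨u, hu, rfl⟩ : ∃ u ∈ (chartAt (EuclideanSpace ℝ (Fin n)) p).target,
      (chartAt (EuclideanSpace ℝ (Fin n)) p).symm u = y :=
    ⟨_, (chartAt (EuclideanSpace ℝ (Fin n)) p).map_source hy,
      (chartAt (EuclideanSpace ℝ (Fin n)) p).left_inv hy⟩
  rw [(chartAt (EuclideanSpace ℝ (Fin n)) p).right_inv hu, formRep_apply,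
    chartFrame_chartCoframe hu, chartFrame_chartCoframe hu]
  rfl

lemma gram_eq_formRep : gram p u = Matrix.of fun i j => formRep (fun _ => LinearMap.id) p u
    ((EuclideanSpace.basisFun (Fin n) ℝ).toBasis i)
    ((EuclideanSpace.basisFun (Fin n) ℝ).toBasis j) := by
  ext i j
  simp [formRep_apply]
  rfl

/-- The Jacobian of a map in terms of its representation in charts. -/
lemma jac_mul_sqrt_det_gram {y' : M} (hu : u ∈ (chartAt (EuclideanSpace ℝ (Fin n)) p).target)
    (hq : y' ∈ (chartAt (EuclideanSpace ℝ (Fin n)) q).source)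
    (L : TangentSpace (𝓡 n) ((chartAt (EuclideanSpace ℝ (Fin n)) p).symm u) →L[ℝ]
      TangentSpace (𝓡 n) y') :
    jac L.toLinearMap * Real.sqrt (gram p u).det =
      |((chartCoframe q y').comp (L.comp (chartFrame p u))).det| *
        Real.sqrt (gram q (chartAt (EuclideanSpace ℝ (Fin n)) q y')).det := by
  rw [gram_eq hu, ← sqrt_det_gram_map, gram_eq_formRep, ← Real.sqrt_sq_eq_abs,
    ← Real.sqrt_mul (sq_nonneg _)]
  set Ψ := (chartCoframe q y').comp (L.comp (chartFrame p u))
  have h := det_bilin_comp (EuclideanSpace.basisFun (Fin n) ℝ).toBasis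
    (formRep (fun _ => LinearMap.id) q (chartAt (EuclideanSpace ℝ (Fin n)) q y'))
      Ψ.toLinearMap Ψ.toLinearMap
  rw [ContinuousLinearMap.det, pow_two, ← h]
  congr 3
  ext i j
  simp only [ContinuousLinearMap.coe_coe]
  rw [inner_eq_formRep hq, chartBasis_apply, chartBasis_apply]
  simp [Ψ]

variable [MeasurableSpace M] [BorelSpace M]

lemma measurableSet_target_inter (p : M) (hA : MeasurableSet A) :
    MeasurableSet ((chartAt (EuclideanSpace ℝ (Fin n)) p).target ∩
      (chartAt (EuclideanSpace ℝ (Fin n)) p).symm ⁻¹' A) := by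
  classical
  set c := chartAt (EuclideanSpace ℝ (Fin n)) p
  have h := ContinuousOn.measurable_piecewise (f := c.symm) (g := fun _ => p) c.continuousOn_symm
    continuousOn_const c.open_target.measurableSet
  have h2 := c.open_target.measurableSet.inter (h hA)
  convert h2 using 1
  ext u
  simp only [Set.mem_inter_iff, Set.mem_preimage]
  exact and_congr_right fun hu => by rw [Set.piecewise_eq_of_mem _ _ _ hu]

lemma chartVolume_apply (p : M) (hA : MeasurableSet A) :
    chartVolume (n := n) p A = ∫⁻ u in (chartAt (EuclideanSpace ℝ (Fin n)) p).target ∩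
      (chartAt (EuclideanSpace ℝ (Fin n)) p).symm ⁻¹' A,
        ENNReal.ofReal (Real.sqrt (gram p u).det) := by
  set c := chartAt (EuclideanSpace ℝ (Fin n)) p with hc
  have hm : AEMeasurable c.symm ((volume : Measure (EuclideanSpace ℝ (Fin n))).restrict c.target) :=
    c.continuousOn_symm.aemeasurable c.open_target.measurableSet
  rw [chartVolume, Measure.map_apply_of_aemeasurable (hm.mono_ac
    (withDensity_absolutelyContinuous _ _)) hA, withDensity_apply',
    Measure.restrict_restrict' c.open_target.measurableSet, Set.inter_comm]

variable [IsContMDiffRiemannianBundle (𝓡 n) ∞ (EuclideanSpace ℝ (Fin n))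
    (fun x : M => TangentSpace (𝓡 n) x)]

lemma continuousOn_sqrt_det_gram (p : M) : ContinuousOn (fun u => Real.sqrt (gram p u).det)
    (chartAt (EuclideanSpace ℝ (Fin n)) p).target := by
  have h : ContinuousOn (fun u => (gram p u).det)
      (chartAt (EuclideanSpace ℝ (Fin n)) p).target := by
    simp only [Matrix.det_apply]
    exact continuousOn_finsetSum _ fun σ _ => continuousOn_const.smul
      (continuousOn_finsetProd _ fun i _ => (contDiffOn_gram p _ _).continuousOn)
  exact h.sqrt

lemma setLIntegral_chartVolume (p : M) (hA : MeasurableSet A) {f : M → ENNReal}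
    (hf : Measurable f) :
    ∫⁻ y in A, f y ∂chartVolume (n := n) p = ∫⁻ u in (chartAt (EuclideanSpace ℝ (Fin n)) p).target ∩
      (chartAt (EuclideanSpace ℝ (Fin n)) p).symm ⁻¹' A,
        ENNReal.ofReal (Real.sqrt (gram p u).det) *
          f ((chartAt (EuclideanSpace ℝ (Fin n)) p).symm u) := by
  set c := chartAt (EuclideanSpace ℝ (Fin n)) p with hc
  have hm : AEMeasurable c.symm ((volume : Measure (EuclideanSpace ℝ (Fin n))).restrict c.target) :=
    c.continuousOn_symm.aemeasurable c.open_target.measurableSet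
  have hw : AEMeasurable (fun u => ENNReal.ofReal (Real.sqrt (gram p u).det))
      ((volume : Measure (EuclideanSpace ℝ (Fin n))).restrict c.target) :=
    ((continuousOn_sqrt_det_gram p).aemeasurable c.open_target.measurableSet).ennreal_ofReal
  rw [← lintegral_indicator hA, chartVolume,
    lintegral_map' (hf.indicator hA).aemeasurable (hm.mono_ac
    (withDensity_absolutelyContinuous _ _)), lintegral_withDensity_eq_lintegral_mul₀ hw
    (g := fun u => A.indicator f (c.symm u)) ((hf.indicator hA).comp_aemeasurable hm), ← lintegral_indicator c.open_target.measurableSet,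
    ← lintegral_indicator (measurableSet_target_inter p hA)]
  refine lintegral_congr fun u => ?_
  by_cases h1 : u ∈ c.target <;> by_cases h2 : c.symm u ∈ A <;> simp [Set.indicator, h1, h2, ← hc]

/-- Change of variables between two charts. -/
lemma chartVolume_image (hAp : A ⊆ (chartAt (EuclideanSpace ℝ (Fin n)) p).source)
    (hAq : ψ '' A ⊆ (chartAt (EuclideanSpace ℝ (Fin n)) q).source) (hA : MeasurableSet A)
    (hψA : MeasurableSet (ψ '' A)) (hinj : Set.InjOn ψ A)
    (hψ : ∀ y ∈ A, MDifferentiableAt (𝓡 n) (𝓡 n) ψ y)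
    (hJ : Measurable fun y => jac (mfderiv (𝓡 n) (𝓡 n) ψ y).toLinearMap) :
    chartVolume (n := n) q (ψ '' A) =
      ∫⁻ y in A, ENNReal.ofReal (jac (mfderiv (𝓡 n) (𝓡 n) ψ y).toLinearMap)
        ∂chartVolume (n := n) p := by
  set c := chartAt (EuclideanSpace ℝ (Fin n)) p with hc
  set d := chartAt (EuclideanSpace ℝ (Fin n)) q with hd
  rw [setLIntegral_chartVolume p hA hJ.ennreal_ofReal, chartVolume_apply q hψA]
  have himg : d.target ∩ d.symm ⁻¹' (ψ '' A) =
      (fun u => d (ψ (c.symm u))) '' (c.target ∩ c.symm ⁻¹' A) := by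
    rw [← d.image_eq_target_inter_inv_preimage hAq, ← c.image_eq_target_inter_inv_preimage hAp,
      Set.image_image, Set.image_image]
    exact Set.image_congr fun y hy => by rw [c.left_inv (hAp hy)]
  have hder : ∀ u ∈ c.target ∩ c.symm ⁻¹' A, HasFDerivAt (fun u => d (ψ (c.symm u)))
      ((chartCoframe q (ψ (c.symm u))).comp ((mfderiv (𝓡 n) (𝓡 n) ψ (c.symm u)).comp
        (chartFrame p u))) u := by
    intro u hu
    have h1 := ((mdifferentiable_chartAt p).mdifferentiableAt_symm hu.1).hasMFDerivAt
    have h2 := (hψ _ hu.2).hasMFDerivAt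
    have h3 := ((mdifferentiable_chartAt q).mdifferentiableAt
      (hAq (Set.mem_image_of_mem ψ hu.2))).hasMFDerivAt
    exact hasMFDerivAt_iff_hasFDerivAt.1 (h3.comp u (h2.comp u h1))
  rw [himg, lintegral_image_eq_lintegral_abs_det_fderiv_mul volume
    (measurableSet_target_inter p hA) (fun u hu => (hder u hu).hasFDerivWithinAt)]
  · refine setLIntegral_congr_fun (measurableSet_target_inter p hA) fun u hu => ?_
    have h := jac_mul_sqrt_det_gram (q := q) hu.1 (hAq (Set.mem_image_of_mem ψ hu.2))
      (mfderiv (𝓡 n) (𝓡 n) ψ (c.symm u))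
    simp only []
    rw [← ENNReal.ofReal_mul (abs_nonneg _), ← ENNReal.ofReal_mul (Real.sqrt_nonneg _), ← h,
      mul_comm]
  · intro u hu v hv huv
    have h1 := d.injOn (hAq (Set.mem_image_of_mem ψ hu.2)) (hAq (Set.mem_image_of_mem ψ hv.2)) huv
    exact c.symm.injOn hu.1 hv.1 (hinj hu.2 hv.2 h1)

lemma jac_id {V : Type*} [NormedAddCommGroup V] [InnerProductSpace ℝ V] [FiniteDimensional ℝ V] :
    jac (LinearMap.id : V →ₗ[ℝ] V) = 1 := by
  rw [jac, LinearMap.comp_id]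
  have : LinearMap.adjoint (LinearMap.id : V →ₗ[ℝ] V) = LinearMap.id :=
    ((LinearMap.eq_adjoint_iff _ _).2 fun x y => rfl).symm
  rw [this, LinearMap.det_id, Real.sqrt_one]

/-- Change of variables for the identity map, viewed in two different charts. -/
lemma chartVolume_eq (hp : A ⊆ (chartAt (EuclideanSpace ℝ (Fin n)) p).source)
    (hq : A ⊆ (chartAt (EuclideanSpace ℝ (Fin n)) q).source) (hA : MeasurableSet A) :
    chartVolume (n := n) q A = chartVolume (n := n) p A := by
  have hj : ∀ y : M, jac (mfderiv (𝓡 n) (𝓡 n) (id : M → M) y).toLinearMap = 1 := by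
    intro y
    rw [mfderiv_id]
    exact jac_id
  have h := chartVolume_image (ψ := id) hp (by simpa using hq) hA (by simpa using hA)
    Function.injective_id.injOn (fun y _ => mdifferentiableAt_id) (by simp only [hj]; fun_prop)
  simp only [hj] at h
  simpa using h

/-- For the upper bound, the chart measure at `p` plus the restriction of the supremum to the
complement of the chart domain dominates every chart measure, hence the supremum; on `A` the second
summand is zero. -/
lemma riemVolume_apply (hp : A ⊆ (chartAt (EuclideanSpace ℝ (Fin n)) p).source)
    (hA : MeasurableSet A) : riemVolume n M A = chartVolume (n := n) p A := by
  set S := (chartAt (EuclideanSpace ℝ (Fin n)) p).source with hS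
  have hSm : MeasurableSet S := (chartAt (EuclideanSpace ℝ (Fin n)) p).open_source.measurableSet
  refine le_antisymm ?_ (le_iSup (fun p : M => chartVolume (n := n) p) p A)
  have hle : riemVolume n M ≤ chartVolume (n := n) p + (riemVolume n M).restrict Sᶜ := by
    refine iSup_le fun q => Measure.le_iff.2 fun B hB => ?_
    set S' := (chartAt (EuclideanSpace ℝ (Fin n)) q).source with hS'
    have hSm' : MeasurableSet S' :=
      (chartAt (EuclideanSpace ℝ (Fin n)) q).open_source.measurableSet
    rw [← measure_inter_add_sdiff B hSm, Measure.add_apply, Measure.restrict_apply hB]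
    refine add_le_add ?_ (le_iSup (fun p : M => chartVolume (n := n) p) q _)
    have h0 : chartVolume (n := n) q (B ∩ S) = chartVolume (n := n) q (B ∩ S ∩ S') := by
      rw [chartVolume_apply q (hB.inter hSm), chartVolume_apply q ((hB.inter hSm).inter hSm')]
      congr 2
      ext u
      simp only [Set.mem_inter_iff, Set.mem_preimage]
      exact ⟨fun h => ⟨h.1, h.2, (chartAt (EuclideanSpace ℝ (Fin n)) q).map_target h.1⟩,
        fun h => ⟨h.1, h.2.1⟩⟩
    rw [h0, chartVolume_eq (p := p) (Set.inter_subset_left.trans Set.inter_subset_right)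
      Set.inter_subset_right ((hB.inter hSm).inter hSm')]
    exact measure_mono (Set.inter_subset_left.trans Set.inter_subset_left)
  refine (hle A).trans ?_
  rw [Measure.add_apply, Measure.restrict_apply hA, Set.inter_comm,
    Set.disjoint_iff_inter_eq_empty.1 (Set.disjoint_compl_left_iff_subset.2 hp), measure_empty, add_zero]

end Volume

/-! ### Change of variables on a compact manifold -/

section ChangeOfVariables

lemma exists_finite_cover {M : Type*} [TopologicalSpace M] [CompactSpace M] {O : M → Set M} (hO : ∀ y, IsOpen (O y)) (hy : ∀ y, y ∈ O y) :
    ∃ t : Finset M, ⋃ y : t, O y = Set.univ := by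
  obtain ⟨t, ht⟩ := isCompact_univ.elim_finite_subcover O hO
    fun y _ => Set.mem_iUnion.2 ⟨y, hy y⟩
  refine ⟨t, Set.univ_subset_iff.1 (ht.trans ?_)⟩
  intro x hx
  simpa using hx

variable {n : ℕ} {M : Type*} [TopologicalSpace M] [ChartedSpace (EuclideanSpace ℝ (Fin n)) M]
  [IsManifold (𝓡 n) ∞ M]
  [RiemannianBundle (fun x : M => TangentSpace (𝓡 n) x)]
  [IsContMDiffRiemannianBundle (𝓡 n) ∞ (EuclideanSpace ℝ (Fin n))
    (fun x : M => TangentSpace (𝓡 n) x)]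
  [MeasurableSpace M] [BorelSpace M]

lemma riemVolume_restrict {p : M} {S : Set M} (hS : MeasurableSet S)
    (hp : S ⊆ (chartAt (EuclideanSpace ℝ (Fin n)) p).source) :
    (riemVolume n M).restrict S = (chartVolume (n := n) p).restrict S := by
  ext B hB
  rw [Measure.restrict_apply hB, Measure.restrict_apply hB,
    riemVolume_apply (Set.inter_subset_right.trans hp) (hB.inter hS)]

variable [CompactSpace M]

variable {ψ : M ≃ₜ M}

/-- Change of variables for the Riemannian measure. -/
lemma map_withDensity_jac (hψ : ∀ y, MDifferentiableAt (𝓡 n) (𝓡 n) ψ y)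
    (hJ : Measurable fun y => jac (mfderiv (𝓡 n) (𝓡 n) ψ y).toLinearMap) :
    ((riemVolume n M).withDensity fun y =>
      ENNReal.ofReal (jac (mfderiv (𝓡 n) (𝓡 n) ψ y).toLinearMap)).map ψ = riemVolume n M := by
  have key : (riemVolume n M).map ψ.symm = (riemVolume n M).withDensity fun y =>
      ENNReal.ofReal (jac (mfderiv (𝓡 n) (𝓡 n) ψ y).toLinearMap) := by
    -- On each `S y` both the points and their images lie in a single chart domain. By compactness
    -- finitely many of these sets cover `M`, and equality of measures may be checked on each of
    -- them.
    let S : M → Set M := fun y => (chartAt (EuclideanSpace ℝ (Fin n)) y).source ∩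
      ψ ⁻¹' (chartAt (EuclideanSpace ℝ (Fin n)) (ψ y)).source
    have hS : ∀ y, IsOpen (S y) := fun y =>
      (chartAt (EuclideanSpace ℝ (Fin n)) y).open_source.inter
        ((chartAt (EuclideanSpace ℝ (Fin n)) (ψ y)).open_source.preimage ψ.continuous)
    obtain ⟨t, ht⟩ := exists_finite_cover hS fun y =>
      ⟨mem_chart_source _ y, mem_chart_source _ (ψ y)⟩
    refine (Measure.ext_iff_of_iUnion_eq_univ ht).2 fun y => Measure.ext fun B hB => ?_
    have hBS : MeasurableSet (B ∩ S y) := hB.inter (hS y).measurableSet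
    have himg : ψ.symm ⁻¹' (B ∩ S y) = ψ '' (B ∩ S y) := by
      rw [← ψ.image_eq_preimage_symm]
    have hm : MeasurableSet (ψ '' (B ∩ S y)) := himg ▸ ψ.symm.continuous.measurable hBS
    have h1 : B ∩ S y ⊆ (chartAt (EuclideanSpace ℝ (Fin n)) (y : M)).source :=
      Set.inter_subset_right.trans Set.inter_subset_left
    have h2 : ψ '' (B ∩ S y) ⊆ (chartAt (EuclideanSpace ℝ (Fin n)) (ψ y)).source := by
      rintro _ ⟨x, hx, rfl⟩
      exact hx.2.2
    rw [Measure.restrict_apply hB, Measure.restrict_apply hB, withDensity_apply _ hBS,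
      Measure.map_apply ψ.symm.continuous.measurable hBS, himg, riemVolume_apply h2 hm,
      chartVolume_image h1 h2 hBS hm ψ.injective.injOn (fun y _ => hψ y) hJ,
      riemVolume_restrict hBS h1]
  rw [← key, Measure.map_map ψ.continuous.measurable ψ.symm.continuous.measurable]
  simp

/-- No measurability of `h` is required, because the homeomorphism `ψ` is a measurable embedding.
The lemma can therefore be applied before the transported density is known to be measurable. -/
lemma integral_comp_mul_jac (hψ : ∀ y, MDifferentiableAt (𝓡 n) (𝓡 n) ψ y)
    (hJ : Measurable fun y => jac (mfderiv (𝓡 n) (𝓡 n) ψ y).toLinearMap) (h : M → ℝ) :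
    ∫ y, h y ∂riemVolume n M =
      ∫ y, jac (mfderiv (𝓡 n) (𝓡 n) ψ y).toLinearMap * h (ψ y) ∂riemVolume n M := by
  conv_lhs => rw [← map_withDensity_jac hψ hJ]
  rw [ψ.measurableEmbedding.integral_map, integral_withDensity_eq_integral_toReal_smul
    hJ.ennreal_ofReal (by simp)]
  refine integral_congr_ae (.of_forall fun y => ?_)
  simp only [ENNReal.toReal_ofReal (jac_nonneg _), smul_eq_mul]

end ChangeOfVariables

/-! ### Derivatives of functions along integral curves -/

section DerivativesAlongCurves

variable {S : Type*} [NormedAddCommGroup S] [NormedSpace ℝ S] {V : S → S} {W K : Set S}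

lemma exists_derivative_along (hW : IsOpen W) (hV : ContDiffOn ℝ ∞ V W) {f : S → ℝ}
    (hf : ContDiffOn ℝ ∞ f W) :
    ∃ f₁ : S → ℝ, ContDiffOn ℝ ∞ f₁ W ∧ ∀ (γ : ℝ → S) (t : ℝ), HasDerivAt γ (V (γ t)) t →
      γ t ∈ W → HasDerivAt (fun τ => f (γ τ)) (f₁ (γ t)) t := by
  refine ⟨fun s => fderiv ℝ f s (V s), ?_, fun γ t hγ ht => ?_⟩
  · exact (hf.fderiv_of_isOpen hW (m := ∞) (by simp)).clm_apply hV
  · exact ((hf.contDiffAt (hW.mem_nhds ht)).differentiableAt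
      (by simp)).hasFDerivAt.comp_hasDerivAt t hγ

/-- Each derivative along the curves is again a function on the ambient space, smooth on `W`.
Boundedness on the compact set `K` thus gives one constant for all curves and times. -/
lemma exists_three_derivatives_along (hW : IsOpen W) (hV : ContDiffOn ℝ ∞ V W) {f : S → ℝ}
    (hf : ContDiffOn ℝ ∞ f W) (hK : IsCompact K) (hKW : K ⊆ W) :
    ∃ f₁ f₂ f₃ : S → ℝ, ∃ C : ℝ, (∀ s ∈ K, |f s| ≤ C ∧ |f₃ s| ≤ C) ∧
      ∀ (γ : ℝ → S) (t : ℝ), HasDerivAt γ (V (γ t)) t → γ t ∈ W →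
        HasDerivAt (fun τ => f (γ τ)) (f₁ (γ t)) t ∧
        HasDerivAt (fun τ => f₁ (γ τ)) (f₂ (γ t)) t ∧
        HasDerivAt (fun τ => f₂ (γ τ)) (f₃ (γ t)) t := by
  obtain ⟨f₁, h₁, d₁⟩ := exists_derivative_along hW hV hf
  obtain ⟨f₂, h₂, d₂⟩ := exists_derivative_along hW hV h₁
  obtain ⟨f₃, h₃, d₃⟩ := exists_derivative_along hW hV h₂
  obtain ⟨C, hC⟩ := hK.exists_bound_of_continuousOn (hf.continuousOn.mono hKW)
  obtain ⟨C', hC'⟩ := hK.exists_bound_of_continuousOn (h₃.continuousOn.mono hKW)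
  exact ⟨f₁, f₂, f₃, max C C', fun s hs => ⟨(hC s hs).trans (le_max_left _ _),
    (hC' s hs).trans (le_max_right _ _)⟩, fun γ t hγ ht => ⟨d₁ γ t hγ ht, d₂ γ t hγ ht,
      d₃ γ t hγ ht⟩⟩

end DerivativesAlongCurves

/-! ### The transported density -/

section Transport

lemma jac_mul_formInner {V V' : Type*} [NormedAddCommGroup V] [InnerProductSpace ℝ V]
    [FiniteDimensional ℝ V] [NormedAddCommGroup V'] [InnerProductSpace ℝ V']
    [FiniteDimensional ℝ V'] {ι : Type*} [Fintype ι] [DecidableEq ι] (b : Module.Basis ι ℝ V)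
    (L : V ≃ₗ[ℝ] V') {k : ℕ} (α : V' [⋀^Fin k]→ₗ[ℝ] ℝ) :
    jac L.toLinearMap * formInner α α *
        Real.sqrt (Matrix.of fun i j => (inner ℝ (b i) (b j) : ℝ)).det =
      Real.sqrt (Matrix.of fun i j => (inner ℝ (L (b i)) (L (b j)) : ℝ)).det *
        gramForm k (Matrix.of fun i j => (inner ℝ (L (b i)) (L (b j)) : ℝ))⁻¹
          (fun I => α fun a => L (b (I a))) (fun I => α fun a => L (b (I a))) := by
  have h := formInner_eq_gramForm (b.map L) α α
  simp only [Module.Basis.map_apply] at h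
  rw [← h, mul_right_comm]
  exact congrArg (· * formInner α α) (sqrt_det_gram_map b L.toLinearMap).symm

variable {n : ℕ} {M : Type*} [TopologicalSpace M] [ChartedSpace (EuclideanSpace ℝ (Fin n)) M]
  [IsManifold (𝓡 n) ∞ M]
  [RiemannianBundle (fun x : M => TangentSpace (𝓡 n) x)]
variable {k : ℕ} {z : DiffForm n k M} {φ : ℝ → M → M} {t : ℝ} {y : M} {f g : M → M}

/-- The density of `φ_{-t}^* z` at `φ_t y`, per volume at `y`. -/
def transported (z : DiffForm n k M) (φ : ℝ → M → M) (t : ℝ) (y : M) : ℝ :=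
  jac (mfderiv (𝓡 n) (𝓡 n) (φ t) y).toLinearMap *
    formInner (pullback (φ (-t)) z (φ t y)) (pullback (φ (-t)) z (φ t y))

lemma mfderiv_comp_eq_self (hgf : g ∘ f = id) (hf : MDifferentiableAt (𝓡 n) (𝓡 n) f y)
    (hg : MDifferentiableAt (𝓡 n) (𝓡 n) g (f y)) (v : TangentSpace (𝓡 n) y) :
    (mfderiv (𝓡 n) (𝓡 n) g (f y) (mfderiv (𝓡 n) (𝓡 n) f y v) : EuclideanSpace ℝ (Fin n)) = v := by
  have h1 := mfderiv_comp y hg hf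
  have h2 : ∀ h : M → M, h = id → (mfderiv (𝓡 n) (𝓡 n) h y v : EuclideanSpace ℝ (Fin n)) = v := by
    rintro h rfl
    exact congrArg (fun L => L v) (mfderiv_id (I := 𝓡 n) (x := y))
  have h3 := h2 _ hgf
  exact (congrArg (fun L => L v) h1).symm.trans h3

/-- Evaluated on transported vectors, the pulled back form is just the original form at `y`. Hence
no derivative of `z` appears when the time varies. -/
lemma pullback_apply_mfderiv (hgf : g ∘ f = id) (hf : MDifferentiableAt (𝓡 n) (𝓡 n) f y)
    (hg : MDifferentiableAt (𝓡 n) (𝓡 n) g (f y)) (v : Fin k → TangentSpace (𝓡 n) y) :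
    pullback g z (f y) (fun a => mfderiv (𝓡 n) (𝓡 n) f y (v a)) = z y v := by
  -- The points `g (f y)` and `y` are equal only propositionally, so the vectors are compared in the
  -- model space, to which all tangent spaces unfold.
  have h : ∀ (x : M) (_ : x = y) (w : Fin k → EuclideanSpace ℝ (Fin n)) (_ : ∀ a, w a = v a),
      z x w = z y v := by
    rintro x rfl w hw
    exact congrArg _ (funext hw)
  exact h _ (congrFun hgf y) _ fun a => mfderiv_comp_eq_self hgf hf hg (v a)

/-- The density of the transported form in terms of the Gram matrix of the differential. -/
lemma transported_mul_sqrt_det {ι : Type*} [Fintype ι] [DecidableEq ι]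
    (b : Module.Basis ι ℝ (TangentSpace (𝓡 n) y)) (hφ : φ (-t) ∘ φ t = id)
    (h1 : MDifferentiableAt (𝓡 n) (𝓡 n) (φ t) y)
    (h2 : MDifferentiableAt (𝓡 n) (𝓡 n) (φ (-t)) (φ t y)) {Γ : Matrix ι ι ℝ}
    (hΓ : ∀ i j, (inner ℝ (mfderiv (𝓡 n) (𝓡 n) (φ t) y (b i))
      (mfderiv (𝓡 n) (𝓡 n) (φ t) y (b j)) : ℝ) = Γ i j) :
    transported z φ t y * Real.sqrt (Matrix.of fun i j => (inner ℝ (b i) (b j) : ℝ)).det =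
      Real.sqrt Γ.det * gramForm k Γ⁻¹ (comps b (z y)) (comps b (z y)) := by
  have hinj : Function.Injective (mfderiv (𝓡 n) (𝓡 n) (φ t) y).toLinearMap := by
    rw [← LinearMap.ker_eq_bot, LinearMap.ker_eq_bot']
    intro v hv
    have h := mfderiv_comp_eq_self hφ h1 h2 v
    have hv' : mfderiv (𝓡 n) (𝓡 n) (φ t) y v = 0 := hv
    rw [hv', map_zero] at h
    exact h.symm
  let L := LinearMap.linearEquivOfInjective _ hinj rfl
  have hL : ∀ v, L v = mfderiv (𝓡 n) (𝓡 n) (φ t) y v := fun v => rfl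
  have h := jac_mul_formInner b L (pullback (φ (-t)) z (φ t y))
  have hΓ' : (Matrix.of fun i j => (inner ℝ (L (b i)) (L (b j)) : ℝ)) = Γ := by
    ext i j
    exact hΓ i j
  have hζ : (fun I : Fin k → ι => pullback (φ (-t)) z (φ t y) fun a => L (b (I a))) =
      comps b (z y) := by
    funext I
    exact pullback_apply_mfderiv hφ h1 h2 fun a => b (I a)
  rw [hΓ', hζ] at h
  exact h

end Transport

/-! ### The Gram matrix as a function of point and differential -/

section VariationalGram

variable {n : ℕ} {M : Type*} [TopologicalSpace M] [ChartedSpace (EuclideanSpace ℝ (Fin n)) M]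
  [IsManifold (𝓡 n) ∞ M]
  [RiemannianBundle (fun x : M => TangentSpace (𝓡 n) x)]
  [IsContMDiffRiemannianBundle (𝓡 n) ∞ (EuclideanSpace ℝ (Fin n))
    (fun x : M => TangentSpace (𝓡 n) x)]

/-- Points together with endomorphisms of the tangent space, in coordinates. -/
abbrev PhaseSpace (n : ℕ) : Type :=
  EuclideanSpace ℝ (Fin n) × (EuclideanSpace ℝ (Fin n) →L[ℝ] EuclideanSpace ℝ (Fin n))

/-- The Gram matrix of the images of the standard basis vectors. -/
def pullGram (p : M) (s : PhaseSpace n) : Matrix (Fin n) (Fin n) ℝ :=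
  Matrix.of fun i j => formRep (fun _ => LinearMap.id) p s.1
    (s.2 (EuclideanSpace.single i (1 : ℝ))) (s.2 (EuclideanSpace.single j (1 : ℝ)))

/-- The domain on which the Gram matrix is nondegenerate. -/
def gramDomain (p : M) : Set (PhaseSpace n) :=
  {s | s.1 ∈ (chartAt (EuclideanSpace ℝ (Fin n)) p).target ∧ 0 < (pullGram p s).det}

variable {p : M} {s : PhaseSpace n}

lemma smoothEndOn_id (U : Set M) : SmoothEndOn (n := n) U fun _ : M => LinearMap.id :=
  fun _ _ _ _ hV => hV

lemma pullGram_id (u : EuclideanSpace ℝ (Fin n)) :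
    pullGram p (u, ContinuousLinearMap.id ℝ _) = gram p u := by
  rw [gram_eq_formRep]
  ext i j
  simp [pullGram]

lemma contDiffOn_pullGram (p : M) : ContDiffOn ℝ ∞ (fun s i j => pullGram p s i j)
    {s : PhaseSpace n | s.1 ∈ (chartAt (EuclideanSpace ℝ (Fin n)) p).target} := by
  refine contDiffOn_pi.2 fun i => contDiffOn_pi.2 fun j => ?_
  have h : ∀ s : PhaseSpace n, pullGram p s i j = ∑ l, ∑ m,
      (s.2 (EuclideanSpace.single i (1 : ℝ))) l * (s.2 (EuclideanSpace.single j (1 : ℝ))) m *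
        formRep (fun _ => LinearMap.id) p s.1 (EuclideanSpace.single l (1 : ℝ))
          (EuclideanSpace.single m (1 : ℝ)) := fun s =>
    bilin_eq_sum (formRep (fun _ : M => LinearMap.id) p s.1) _ _
  simp_rw [h]
  have h1 : ∀ i l : Fin n, ContDiff ℝ ∞ fun s : PhaseSpace n =>
      (s.2 (EuclideanSpace.single i (1 : ℝ))) l := fun i l =>
    (EuclideanSpace.proj (𝕜 := ℝ) l).contDiff.comp
      (contDiff_snd.clm_apply contDiff_const)
  refine ContDiffOn.sum fun l _ => ContDiffOn.sum fun m _ => ?_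
  exact ((h1 i l).mul (h1 j m)).contDiffOn.mul
    ((contDiffOn_formRep (smoothEndOn_id _) _ _).comp contDiff_fst.contDiffOn fun s hs => hs)

lemma isOpen_gramDomain (p : M) : IsOpen (gramDomain (n := n) p) := by
  have hO : IsOpen {s : PhaseSpace n | s.1 ∈ (chartAt (EuclideanSpace ℝ (Fin n)) p).target} :=
    (chartAt (EuclideanSpace ℝ (Fin n)) p).open_target.preimage continuous_fst
  have h : ContinuousOn (fun s => (pullGram p s).det)
      {s : PhaseSpace n | s.1 ∈ (chartAt (EuclideanSpace ℝ (Fin n)) p).target} :=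
    (contDiff_det.comp_contDiffOn (contDiffOn_pullGram p)).continuousOn
  exact h.isOpen_inter_preimage hO isOpen_Ioi

lemma gramDomain_subset (p : M) : gramDomain (n := n) p ⊆
    {s | s.1 ∈ (chartAt (EuclideanSpace ℝ (Fin n)) p).target} := fun _ hs => hs.1

lemma mem_gramDomain {u : EuclideanSpace ℝ (Fin n)}
    (hu : u ∈ (chartAt (EuclideanSpace ℝ (Fin n)) p).target) :
    (u, ContinuousLinearMap.id ℝ _) ∈ gramDomain p :=
  ⟨hu, by rw [pullGram_id]; exact det_gram_pos hu⟩

lemma contDiffOn_sqrt_det_pullGram (p : M) :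
    ContDiffOn ℝ ∞ (fun s => Real.sqrt (pullGram p s).det) (gramDomain (n := n) p) :=
  ((contDiff_det.comp_contDiffOn (contDiffOn_pullGram p)).mono (gramDomain_subset p)).sqrt
    fun _ hs => hs.2.ne'

/-- The coefficients of the transported density. -/
def pullCoeff (p : M) {k : ℕ} (I J : Fin k → Fin n) (s : PhaseSpace n) : ℝ :=
  Real.sqrt (pullGram p s).det * ∏ a, (pullGram p s)⁻¹ (I a) (J a)

lemma contDiffOn_pullCoeff (p : M) {k : ℕ} (I J : Fin k → Fin n) :
    ContDiffOn ℝ ∞ (pullCoeff p I J) (gramDomain (n := n) p) := by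
  refine (contDiffOn_sqrt_det_pullGram p).mul (contDiffOn_prod fun a _ => ?_)
  exact (contDiffOn_inv_apply (I a) (J a)).comp
    ((contDiffOn_pullGram p).mono (gramDomain_subset p)) fun s hs => hs.2.ne'

lemma contDiffOn_variationalField {X : ∀ x : M, TangentSpace (𝓡 n) x}
    (hX : SmoothOn (chartAt (EuclideanSpace ℝ (Fin n)) p).source X) :
    ContDiffOn ℝ ∞ (variationalField (fieldRep p X)) (gramDomain (n := n) p) :=
  fun _ hs => (contDiffAt_variationalField ((contDiffOn_fieldRep hX).contDiffAt
    ((chartAt (EuclideanSpace ℝ (Fin n)) p).open_target.mem_nhds hs.1))).contDiffWithinAt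

end VariationalGram

/-! ### Flows on the manifold and their local descriptions -/

section Flow

variable {n : ℕ} {M : Type*} [TopologicalSpace M] [T2Space M]
  [ChartedSpace (EuclideanSpace ℝ (Fin n)) M]
  [IsManifold (𝓡 n) ∞ M]
variable {X : ∀ x : M, TangentSpace (𝓡 n) x} {φ : ℝ → M → M}

lemma IsSmoothField.contMDiff_one (hX : IsSmoothField X) :
    ContMDiff (𝓡 n) (𝓡 n).tangent 1 (fun x => (⟨x, X x⟩ : TangentBundle (𝓡 n) M)) :=
  ContMDiff.of_le (n := ∞) hX ENat.LEInfty.out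

/-- Both sides are integral curves in `s` through the same point, and integral curves are unique. -/
lemma IsFlow.comp (hX : IsSmoothField X) (hφ : IsFlow X φ) (s t : ℝ) : φ s ∘ φ t = φ (s + t) := by
  have : IsManifold (𝓡 n) 1 M := .of_le (n := ∞) ENat.LEInfty.out
  funext x
  have h := isMIntegralCurve_Ioo_eq_of_contMDiff_boundaryless (t₀ := 0) hX.contMDiff_one
    (hφ.2 (φ t x)) ((hφ.2 x).comp_add t) (by simp [hφ.1])
  exact congrFun h s

lemma IsFlow.neg_comp (hX : IsSmoothField X) (hφ : IsFlow X φ) (t : ℝ) : φ (-t) ∘ φ t = id := by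
  rw [hφ.comp hX, neg_add_cancel]
  exact funext hφ.1

variable (X) in
/-- The flow of `X` near `p`, with its differential, in the chart at `p`. -/
structure LocalFlow [RiemannianBundle (fun x : M => TangentSpace (𝓡 n) x)] (p : M) where
  nhd : Set M
  time : ℝ
  compact : Set (PhaseSpace n)
  curve : M → ℝ → PhaseSpace n
  isOpen_nhd : IsOpen nhd
  mem_nhd : p ∈ nhd
  nhd_subset : nhd ⊆ (chartAt (EuclideanSpace ℝ (Fin n)) p).source
  time_pos : 0 < time
  isCompact : IsCompact compact
  compact_subset : compact ⊆ gramDomain p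
  curve_zero : ∀ y ∈ nhd, curve y 0 =
    (chartAt (EuclideanSpace ℝ (Fin n)) p y, ContinuousLinearMap.id ℝ _)
  curve_mem : ∀ y ∈ nhd, ∀ t ∈ Set.Ioo (-time) time, curve y t ∈ compact
  hasDerivAt : ∀ y ∈ nhd, ∀ t ∈ Set.Ioo (-time) time,
    HasDerivAt (curve y) (variationalField (fieldRep p X) (curve y t)) t
  isMIntegralCurveOn : ∀ y ∈ nhd, IsMIntegralCurveOn (I := 𝓡 n)
    (fun t => (chartAt (EuclideanSpace ℝ (Fin n)) p).symm (curve y t).1) X (Set.Ioo (-time) time)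
  continuousAt : ∀ y ∈ nhd, ∀ t ∈ Set.Ioo (-time) time, ContinuousAt (fun y => curve y t) y
  hasMFDerivAt : ∀ y ∈ nhd, ∀ t ∈ Set.Ioo (-time) time,
    HasMFDerivAt (𝓡 n) 𝓘(ℝ, EuclideanSpace ℝ (Fin n)) (fun y => (curve y t).1) y
      ((curve y t).2.comp (chartCoframe p y))

variable [RiemannianBundle (fun x : M => TangentSpace (𝓡 n) x)]
  [IsContMDiffRiemannianBundle (𝓡 n) ∞ (EuclideanSpace ℝ (Fin n))
    (fun x : M => TangentSpace (𝓡 n) x)]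

/-- The flow in the Banach space, with `gramDomain p` as the set in which trajectories stay: the
Gram matrix is then nondegenerate along them. The closed ball containing them is compact, as the
phase space has finite dimension. -/
lemma exists_localFlow (hX : IsSmoothField X) (p : M) : Nonempty (LocalFlow X p) := by
  set c := chartAt (EuclideanSpace ℝ (Fin n)) p with hc
  have hp : p ∈ c.source := mem_chart_source _ p
  have hu : c p ∈ c.target := c.map_source hp
  have hXr : ContDiffOn ℝ ∞ (fieldRep p X) c.target := contDiffOn_fieldRep (hX.smoothOn _)
  obtain ⟨r, hr, ε, hε, R, hR, s, hsub, h⟩ := exists_local_flow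
    (hXr.contDiffAt (c.open_target.mem_nhds hu))
    ((isOpen_gramDomain (n := n) p).mem_nhds (mem_gramDomain hu))
  have hcb : ∀ y ∈ c.source ∩ c ⁻¹' Metric.ball (c p) r, c y ∈ Metric.ball (c p) r :=
    fun y hy => hy.2
  refine ⟨⟨c.source ∩ c ⁻¹' Metric.ball (c p) r, ε, Metric.closedBall _ R, fun y => s (c y),
    c.isOpen_inter_preimage Metric.isOpen_ball, ⟨hp, Metric.mem_ball_self hr⟩,
    Set.inter_subset_left, hε, isCompact_closedBall _ _, hsub, fun y hy => (h _ hy.2).1,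
    fun y hy t ht => ((h _ hy.2).2 t ht).2.1, fun y hy t ht => ((h _ hy.2).2 t ht).1,
    fun y hy t ht => ?_, fun y hy t ht => ?_, fun y hy t ht => ?_⟩⟩
  · have h1 := ((h _ hy.2).2 t ht).1
    have hm := hsub ((h _ hy.2).2 t ht).2.1
    have h2 : HasDerivAt (fun τ => (s (c y) τ).1) (fieldRep p X (s (c y) t).1) t := h1.fst
    have h3 := ((mdifferentiable_chartAt p).mdifferentiableAt_symm hm.1).hasMFDerivAt
    have h4 := h3.comp t (hasMFDerivAt_iff_hasFDerivAt.2 h2.hasFDerivAt)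
    refine HasMFDerivAt.hasMFDerivWithinAt (h4.congr_mfderiv ?_)
    refine ContinuousLinearMap.ext fun a => ?_
    have h5 := chartFrame_fieldRep (F := X) hm.1
    have h6 : ∀ a : ℝ, chartFrame p (s (c y) t).1 (a • fieldRep p X (s (c y) t).1) =
        a • X (c.symm (s (c y) t).1) := fun a => by rw [map_smul, h5]
    exact h6 a
  · have h1 := ((h _ hy.2).2 t ht).2.2.2
    exact ContinuousAt.comp (f := c) (g := fun v => s v t) h1 (c.continuousAt hy.1)
  · have h1 := ((h _ hy.2).2 t ht).2.2.1
    have h2 := ((mdifferentiable_chartAt p).mdifferentiableAt hy.1).hasMFDerivAt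
    exact (hasMFDerivAt_iff_hasFDerivAt.2 h1).comp y h2

end Flow

/-! ### The flow, its Jacobian and the transported density in coordinates -/

section LocalFlow

variable {n : ℕ} {M : Type*} [TopologicalSpace M] [T2Space M]
  [ChartedSpace (EuclideanSpace ℝ (Fin n)) M]
  [IsManifold (𝓡 n) ∞ M]
  [RiemannianBundle (fun x : M => TangentSpace (𝓡 n) x)]
variable {X : ∀ x : M, TangentSpace (𝓡 n) x} {φ : ℝ → M → M} {p y : M} {t : ℝ}

lemma finrank_tangentSpace (y : M) : Module.finrank ℝ (TangentSpace (𝓡 n) y) = n :=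
  finrank_euclideanSpace_fin

lemma chartCoframe_injective (hy : y ∈ (chartAt (EuclideanSpace ℝ (Fin n)) p).source) :
    Function.Injective (chartCoframe (n := n) p y) :=
  (mdifferentiable_chartAt p).mfderiv_injective hy

/-- The coordinate basis at a point of the chart at `p`. -/
def coordBasis (hy : y ∈ (chartAt (EuclideanSpace ℝ (Fin n)) p).source) :
    Module.Basis (Fin n) ℝ (TangentSpace (𝓡 n) y) :=
  (EuclideanSpace.basisFun (Fin n) ℝ).toBasis.map
    (LinearMap.linearEquivOfInjective (chartCoframe (n := n) p y).toLinearMap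
      (chartCoframe_injective hy) rfl).symm

lemma chartCoframe_coordBasis (hy : y ∈ (chartAt (EuclideanSpace ℝ (Fin n)) p).source)
    (i : Fin n) : chartCoframe p y (coordBasis hy i) = EuclideanSpace.single i (1 : ℝ) := by
  have h := LinearEquiv.apply_symm_apply
    (LinearMap.linearEquivOfInjective (chartCoframe (n := n) p y).toLinearMap
      (chartCoframe_injective hy) rfl) (EuclideanSpace.single i (1 : ℝ))
  rw [coordBasis, Module.Basis.map_apply, OrthonormalBasis.coe_toBasis,
    EuclideanSpace.basisFun_apply]
  exact h

lemma coordBasis_apply (hy : y ∈ (chartAt (EuclideanSpace ℝ (Fin n)) p).source)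
    (i : Fin n) : coordBasis hy i = coordField p (EuclideanSpace.single i (1 : ℝ)) y :=
  chartCoframe_injective hy ((chartCoframe_coordBasis hy i).trans (coord_coordField hy _).symm)

variable (Λ : LocalFlow X p)

lemma LocalFlow.zero_mem : (0 : ℝ) ∈ Set.Ioo (-Λ.time) Λ.time :=
  ⟨neg_lt_zero.2 Λ.time_pos, Λ.time_pos⟩

lemma LocalFlow.curve_mem_target (hy : y ∈ Λ.nhd) (ht : t ∈ Set.Ioo (-Λ.time) Λ.time) :
    (Λ.curve y t).1 ∈ (chartAt (EuclideanSpace ℝ (Fin n)) p).target :=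
  (Λ.compact_subset (Λ.curve_mem y hy t ht)).1

/-- Uniqueness of integral curves identifies any given global flow with the local construction, so
the differentiability of the latter passes to the former. -/
lemma LocalFlow.flow_eq (hX : IsSmoothField X) (hφ : IsFlow X φ) (hy : y ∈ Λ.nhd)
    (ht : t ∈ Set.Ioo (-Λ.time) Λ.time) :
    φ t y = (chartAt (EuclideanSpace ℝ (Fin n)) p).symm (Λ.curve y t).1 := by
  have : IsManifold (𝓡 n) 1 M := .of_le (n := ∞) ENat.LEInfty.out
  refine isMIntegralCurveOn_Ioo_eqOn_of_contMDiff_boundaryless Λ.zero_mem hX.contMDiff_one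
    ((hφ.2 y).isMIntegralCurveOn _) (Λ.isMIntegralCurveOn y hy) ?_ ht
  rw [hφ.1, Λ.curve_zero y hy,
    (chartAt (EuclideanSpace ℝ (Fin n)) p).left_inv (Λ.nhd_subset hy)]

lemma LocalFlow.flow_mem_source (hX : IsSmoothField X) (hφ : IsFlow X φ) (hy : y ∈ Λ.nhd)
    (ht : t ∈ Set.Ioo (-Λ.time) Λ.time) :
    φ t y ∈ (chartAt (EuclideanSpace ℝ (Fin n)) p).source := by
  rw [Λ.flow_eq hX hφ hy ht]
  exact (chartAt (EuclideanSpace ℝ (Fin n)) p).map_target (Λ.curve_mem_target hy ht)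

lemma LocalFlow.chart_flow (hX : IsSmoothField X) (hφ : IsFlow X φ) (hy : y ∈ Λ.nhd)
    (ht : t ∈ Set.Ioo (-Λ.time) Λ.time) :
    chartAt (EuclideanSpace ℝ (Fin n)) p (φ t y) = (Λ.curve y t).1 := by
  rw [Λ.flow_eq hX hφ hy ht]
  exact (chartAt (EuclideanSpace ℝ (Fin n)) p).right_inv (Λ.curve_mem_target hy ht)

lemma LocalFlow.mdifferentiableAt (hX : IsSmoothField X) (hφ : IsFlow X φ) (hy : y ∈ Λ.nhd)
    (ht : t ∈ Set.Ioo (-Λ.time) Λ.time) : MDifferentiableAt (𝓡 n) (𝓡 n) (φ t) y := by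
  have h1 := (mdifferentiable_chartAt p).mdifferentiableAt_symm (Λ.curve_mem_target hy ht)
  have h2 := (Λ.hasMFDerivAt y hy t ht).mdifferentiableAt
  refine (h1.comp y h2).congr_of_eventuallyEq ?_
  filter_upwards [Λ.isOpen_nhd.mem_nhds hy] with x hx using Λ.flow_eq hX hφ hx ht

lemma LocalFlow.chartCoframe_mfderiv (hX : IsSmoothField X) (hφ : IsFlow X φ) (hy : y ∈ Λ.nhd)
    (ht : t ∈ Set.Ioo (-Λ.time) Λ.time) (v : TangentSpace (𝓡 n) y) :
    chartCoframe p (φ t y) (mfderiv (𝓡 n) (𝓡 n) (φ t) y v) =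
      (Λ.curve y t).2 (chartCoframe p y v) := by
  have h1 := ((mdifferentiable_chartAt p).mdifferentiableAt
    (Λ.flow_mem_source hX hφ hy ht)).hasMFDerivAt.comp y
      (Λ.mdifferentiableAt hX hφ hy ht).hasMFDerivAt
  have h2 := (Λ.hasMFDerivAt y hy t ht).congr_of_eventuallyEq
    (f₁ := chartAt (EuclideanSpace ℝ (Fin n)) p ∘ φ t) (by
      filter_upwards [Λ.isOpen_nhd.mem_nhds hy] with x hx using Λ.chart_flow hX hφ hx ht)
  exact congrArg (fun L => L v) (hasMFDerivAt_unique h1 h2)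

/-- The metric pulled back by the flow, in coordinates. -/
lemma LocalFlow.inner_mfderiv (hX : IsSmoothField X) (hφ : IsFlow X φ) (hy : y ∈ Λ.nhd)
    (ht : t ∈ Set.Ioo (-Λ.time) Λ.time) (v w : TangentSpace (𝓡 n) y) :
    (inner ℝ (mfderiv (𝓡 n) (𝓡 n) (φ t) y v) (mfderiv (𝓡 n) (𝓡 n) (φ t) y w) : ℝ) =
      formRep (fun _ => LinearMap.id) p (Λ.curve y t).1 ((Λ.curve y t).2 (chartCoframe p y v))
        ((Λ.curve y t).2 (chartCoframe p y w)) := by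
  rw [inner_eq_formRep (Λ.flow_mem_source hX hφ hy ht), Λ.chartCoframe_mfderiv hX hφ hy ht,
    Λ.chartCoframe_mfderiv hX hφ hy ht, Λ.chart_flow hX hφ hy ht]

lemma LocalFlow.inner_mfderiv_coordBasis (hX : IsSmoothField X) (hφ : IsFlow X φ)
    (hy : y ∈ Λ.nhd) (ht : t ∈ Set.Ioo (-Λ.time) Λ.time) (i j : Fin n) :
    (inner ℝ (mfderiv (𝓡 n) (𝓡 n) (φ t) y (coordBasis (Λ.nhd_subset hy) i))
      (mfderiv (𝓡 n) (𝓡 n) (φ t) y (coordBasis (Λ.nhd_subset hy) j)) : ℝ) =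
      pullGram p (Λ.curve y t) i j := by
  rw [Λ.inner_mfderiv hX hφ hy ht, chartCoframe_coordBasis, chartCoframe_coordBasis]
  rfl

lemma LocalFlow.inner_coordBasis (hy : y ∈ Λ.nhd) (i j : Fin n) :
    (inner ℝ (coordBasis (Λ.nhd_subset hy) i) (coordBasis (Λ.nhd_subset hy) j) : ℝ) =
      pullGram p (Λ.curve y 0) i j := by
  rw [inner_eq_formRep (Λ.nhd_subset hy), chartCoframe_coordBasis, chartCoframe_coordBasis,
    Λ.curve_zero y hy]
  rfl

lemma LocalFlow.det_pos (hy : y ∈ Λ.nhd) (ht : t ∈ Set.Ioo (-Λ.time) Λ.time) :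
    0 < (pullGram p (Λ.curve y t)).det :=
  (Λ.compact_subset (Λ.curve_mem y hy t ht)).2

lemma LocalFlow.jac_eq (hX : IsSmoothField X) (hφ : IsFlow X φ)
    (hy : y ∈ Λ.nhd) (ht : t ∈ Set.Ioo (-Λ.time) Λ.time) :
    jac (mfderiv (𝓡 n) (𝓡 n) (φ t) y).toLinearMap =
      Real.sqrt (pullGram p (Λ.curve y t)).det / Real.sqrt (pullGram p (Λ.curve y 0)).det := by
  have h := sqrt_det_gram_map (coordBasis (Λ.nhd_subset hy))
    (mfderiv (𝓡 n) (𝓡 n) (φ t) y).toLinearMap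
  have h1 : (Matrix.of fun i j => (inner ℝ (coordBasis (Λ.nhd_subset hy) i)
      (coordBasis (Λ.nhd_subset hy) j) : ℝ)) = pullGram p (Λ.curve y 0) := by
    ext i j
    exact Λ.inner_coordBasis hy i j
  have h2 : (Matrix.of fun i j => (inner ℝ
      ((mfderiv (𝓡 n) (𝓡 n) (φ t) y).toLinearMap (coordBasis (Λ.nhd_subset hy) i))
      ((mfderiv (𝓡 n) (𝓡 n) (φ t) y).toLinearMap (coordBasis (Λ.nhd_subset hy) j)) : ℝ)) =
      pullGram p (Λ.curve y t) := by
    ext i j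
    exact Λ.inner_mfderiv_coordBasis hX hφ hy ht i j
  rw [h1, h2] at h
  rw [h, mul_div_cancel_right₀]
  exact (Real.sqrt_pos.2 (Λ.det_pos hy Λ.zero_mem)).ne'

variable [IsContMDiffRiemannianBundle (𝓡 n) ∞ (EuclideanSpace ℝ (Fin n))
    (fun x : M => TangentSpace (𝓡 n) x)]

lemma LocalFlow.continuousOn_comp {f : PhaseSpace n → ℝ}
    (hf : ContinuousOn f (gramDomain p)) (ht : t ∈ Set.Ioo (-Λ.time) Λ.time) :
    ContinuousOn (fun y => f (Λ.curve y t)) Λ.nhd := by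
  intro y hy
  have h1 := hf.continuousAt ((isOpen_gramDomain p).mem_nhds
    (Λ.compact_subset (Λ.curve_mem y hy t ht)))
  exact (ContinuousAt.comp (f := fun y => Λ.curve y t) h1
    (Λ.continuousAt y hy t ht)).continuousWithinAt

lemma LocalFlow.continuousAt_jac (hX : IsSmoothField X) (hφ : IsFlow X φ)
    (hy : y ∈ Λ.nhd) (ht : t ∈ Set.Ioo (-Λ.time) Λ.time) :
    ContinuousAt (fun y => jac (mfderiv (𝓡 n) (𝓡 n) (φ t) y).toLinearMap) y := by
  have hc := (contDiffOn_sqrt_det_pullGram (n := n) p).continuousOn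
  have h := (Λ.continuousOn_comp hc ht).div (Λ.continuousOn_comp hc Λ.zero_mem)
    fun x hx => (Real.sqrt_pos.2 (Λ.det_pos hx Λ.zero_mem)).ne'
  exact (h.congr fun x hx => Λ.jac_eq hX hφ hx ht).continuousAt (Λ.isOpen_nhd.mem_nhds hy)

variable {k : ℕ} {z : DiffForm n k M}

/-- The transported density in coordinates. -/
lemma LocalFlow.transported_eq (hX : IsSmoothField X) (hφ : IsFlow X φ)
    (hy : y ∈ Λ.nhd) (ht : t ∈ Set.Ioo (-Λ.time) Λ.time)
    (hd : MDifferentiableAt (𝓡 n) (𝓡 n) (φ (-t)) (φ t y)) :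
    transported z φ t y = (Real.sqrt (pullGram p (Λ.curve y 0)).det)⁻¹ *
      ((1 / (k.factorial : ℝ)) * ∑ I, ∑ J, pullCoeff p I J (Λ.curve y t) *
        (comps (coordBasis (Λ.nhd_subset hy)) (z y) I *
          comps (coordBasis (Λ.nhd_subset hy)) (z y) J)) := by
  have h := transported_mul_sqrt_det (z := z) (coordBasis (Λ.nhd_subset hy)) (hφ.neg_comp hX t)
    (Λ.mdifferentiableAt hX hφ hy ht) hd (Λ.inner_mfderiv_coordBasis hX hφ hy ht)
  have h1 : (Matrix.of fun i j => (inner ℝ (coordBasis (Λ.nhd_subset hy) i)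
      (coordBasis (Λ.nhd_subset hy) j) : ℝ)) = pullGram p (Λ.curve y 0) := by
    ext i j
    exact Λ.inner_coordBasis hy i j
  have h2 := (Real.sqrt_pos.2 (Λ.det_pos hy Λ.zero_mem)).ne'
  rw [h1, ← eq_div_iff h2] at h
  rw [h, gramForm, div_eq_inv_mul, mul_left_comm (Real.sqrt _), Finset.mul_sum]
  simp only [Finset.mul_sum, pullCoeff, mul_assoc]

end LocalFlow

/-! ### Linearity of the covariant derivative of an endomorphism field -/

section CovariantDerivativeLinear

variable {n : ℕ} {M : Type*} [TopologicalSpace M]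
  [ChartedSpace (EuclideanSpace ℝ (Fin n)) M]
  [IsManifold (𝓡 n) ∞ M]
  [RiemannianBundle (fun x : M => TangentSpace (𝓡 n) x)]
variable {X W : ∀ x : M, TangentSpace (𝓡 n) x} {p x y : M}
  {T : ∀ x : M, TangentSpace (𝓡 n) x →ₗ[ℝ] TangentSpace (𝓡 n) x}

/-- The chart followed by its inverse returns `y` only up to a propositional equality, on which the
types of `v` and `w` depend; an arbitrary family `F` absorbs this. -/
lemma apply_chartFrame_chart (F : ∀ x : M, TangentSpace (𝓡 n) x → TangentSpace (𝓡 n) x → ℝ)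
    (hy : y ∈ (chartAt (EuclideanSpace ℝ (Fin n)) p).source) (v w : TangentSpace (𝓡 n) y) :
    F _ (chartFrame p (chartAt (EuclideanSpace ℝ (Fin n)) p y) (chartCoframe p y v))
      (chartFrame p (chartAt (EuclideanSpace ℝ (Fin n)) p y) (chartCoframe p y w)) = F y v w := by
  obtain ⟨u, hu, rfl⟩ : ∃ u ∈ (chartAt (EuclideanSpace ℝ (Fin n)) p).target,
      (chartAt (EuclideanSpace ℝ (Fin n)) p).symm u = y :=
    ⟨_, (chartAt (EuclideanSpace ℝ (Fin n)) p).map_source hy,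
      (chartAt (EuclideanSpace ℝ (Fin n)) p).left_inv hy⟩
  rw [(chartAt (EuclideanSpace ℝ (Fin n)) p).right_inv hu, chartFrame_chartCoframe hu,
    chartFrame_chartCoframe hu]

variable [IsContMDiffRiemannianBundle (𝓡 n) ∞ (EuclideanSpace ℝ (Fin n))
    (fun x : M => TangentSpace (𝓡 n) x)]

lemma covDerivEnd_id (w : TangentSpace (𝓡 n) x) :
    covDerivEnd (fun _ => LinearMap.id) X x w = 0 := sub_self _

lemma leviCivita_const_smul
    (hV : MDifferentiableAt (𝓡 n) (𝓡 n).tangent (fun x => (⟨x, W x⟩ : TangentBundle (𝓡 n) M)) x)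
    (r : ℝ) (v : TangentSpace (𝓡 n) x) :
    leviCivita (fun y => r • W y) x v = r • leviCivita W x v :=
  congrArg (fun L : TangentSpace (𝓡 n) x →L[ℝ] TangentSpace (𝓡 n) x => L v)
    (leviCivita.isCovariantDerivativeOnUniv.smul_const r hV (Set.mem_univ x))

/-- By `covDerivEnd_apply` the value does not depend on the extension, so sums and multiples of
extensions may serve as extensions. -/
lemma exists_covDerivEnd_linear
    (hT : SmoothEndOn (chartAt (EuclideanSpace ℝ (Fin n)) x).source T)
    (X : ∀ x : M, TangentSpace (𝓡 n) x) :
    ∃ C : TangentSpace (𝓡 n) x →ₗ[ℝ] TangentSpace (𝓡 n) x, ∀ w, C w = covDerivEnd T X x w := by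
  set S := (chartAt (EuclideanSpace ℝ (Fin n)) x).source
  have hS : IsOpen S := (chartAt (EuclideanSpace ℝ (Fin n)) x).open_source
  have hx : x ∈ S := mem_chart_source _ x
  have hs : ∀ w : TangentSpace (𝓡 n) x, SmoothOn S
    (FiberBundle.extend (EuclideanSpace ℝ (Fin n)) w) := fun w => smoothOn_extend x w
  have hTs : ∀ w : TangentSpace (𝓡 n) x, SmoothOn S
    (fun y => T y (FiberBundle.extend (EuclideanSpace ℝ (Fin n)) w y)) :=
    fun w => hT S subset_rfl hS _ (hs w)
  refine ⟨⟨⟨fun w => covDerivEnd T X x w, fun v w => ?_⟩, fun r w => ?_⟩, fun w => rfl⟩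
  · have h := covDerivEnd_apply hS hx hT ((hs v).add (hs w)) X
    simp only [FiberBundle.extend_apply_self, map_add] at h
    rw [leviCivita_fun_add ((hs v).mdifferentiableAt hS hx) ((hs w).mdifferentiableAt hS hx),
      leviCivita_fun_add ((hTs v).mdifferentiableAt hS hx) ((hTs w).mdifferentiableAt hS hx)] at h
    rw [h, covDerivEnd, covDerivEnd, map_add]
    abel
  · have h := covDerivEnd_apply hS hx hT ((hs w).const_smul r) X
    simp only [FiberBundle.extend_apply_self, map_smul] at h
    rw [leviCivita_const_smul ((hs w).mdifferentiableAt hS hx),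
      leviCivita_const_smul ((hTs w).mdifferentiableAt hS hx)] at h
    refine h.trans ?_
    rw [map_smul, ← smul_sub]
    rfl

end CovariantDerivativeLinear

/-! ### The first two derivatives of the transported density -/

section Identification

lemma formsInner_cliffSum_diagonal {E : Type*} [NormedAddCommGroup E] [InnerProductSpace ℝ E]
    [FiniteDimensional ℝ E] {n k : ℕ} (v : OrthonormalBasis (Fin n) ℝ E) (β : Fin n → ℝ)
    (α : E [⋀^Fin k]→ₗ[ℝ] ℝ) :
    formsInner (ofDegree α) (cliffSum v (fun j m => if j = m then β j else 0) (ofDegree α)) =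
      (1 / (k.factorial : ℝ)) * ∑ I, (2 * ∑ a, β (I a) - ∑ i, β i) * comps v α I ^ 2 := by
  have h1 : ∀ j, contr (comps v α) j j =
      (1 / (k.factorial : ℝ)) * ∑ I, ∑ a, if I a = j then comps v α I ^ 2 else 0 := by
    intro j
    rw [contr]
    congr 1
    refine Finset.sum_congr rfl fun I _ => Finset.sum_congr rfl fun a _ => ?_
    split_ifs with h
    · rw [← h, Function.update_eq_self, pow_two]
    · rfl
  have h2 : ∑ j, β j * contr (comps v α) j j =
      (1 / (k.factorial : ℝ)) * ∑ I, (∑ a, β (I a)) * comps v α I ^ 2 := by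
    simp only [h1, mul_left_comm (β _)]
    rw [← Finset.mul_sum]
    congr 1
    simp only [Finset.mul_sum]
    rw [Finset.sum_comm]
    refine Finset.sum_congr rfl fun I _ => ?_
    rw [Finset.sum_comm, Finset.sum_mul]
    refine Finset.sum_congr rfl fun a _ => ?_
    simp
  have h3 : formsInner (ofDegree α) (cliffSum v (fun j m => if j = m then β j else 0)
      (ofDegree α)) = 2 * (∑ j, β j * contr (comps v α) j j)
        - (∑ j, β j) * formInner α α := by
    rw [formsInner_cliffSum, Finset.mul_sum, Finset.sum_mul, ← Finset.sum_sub_distrib]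
    refine Finset.sum_congr rfl fun j _ => ?_
    rw [Finset.sum_eq_single j (fun m _ hm => by simp [hm.symm]) (by simp)]
    simp only [if_true]
    ring
  rw [h3, h2, formInner_comps v, mul_left_comm 2, mul_left_comm (∑ j, β j), ← mul_sub]
  congr 1
  rw [Finset.mul_sum, Finset.mul_sum, ← Finset.sum_sub_distrib]
  exact Finset.sum_congr rfl fun I _ => by ring

lemma contr_comm {E : Type*} [NormedAddCommGroup E] [InnerProductSpace ℝ E]
    [FiniteDimensional ℝ E] {n k : ℕ} (v : OrthonormalBasis (Fin n) ℝ E)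
    (α : E [⋀^Fin k]→ₗ[ℝ] ℝ) (j m : Fin n) :
    contr (comps v α) j m = contr (comps v α) m j := by
  rw [← formsInner_intMul, ← formsInner_intMul]
  simp only [formsInner, formInner, mul_comm (intMul (v j) (ofDegree α) _ _)]

variable {n : ℕ} {M : Type*} [TopologicalSpace M] [T2Space M]
  [ChartedSpace (EuclideanSpace ℝ (Fin n)) M]
  [IsManifold (𝓡 n) ∞ M]
  [RiemannianBundle (fun x : M => TangentSpace (𝓡 n) x)]
  [IsContMDiffRiemannianBundle (𝓡 n) ∞ (EuclideanSpace ℝ (Fin n))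
    (fun x : M => TangentSpace (𝓡 n) x)]
variable {X : ∀ x : M, TangentSpace (𝓡 n) x} {φ : ℝ → M → M} {p y : M} {t : ℝ}
  (Λ : LocalFlow X p) {k : ℕ} {z : DiffForm n k M}

/-- The first two derivatives of the transported density. -/
lemma LocalFlow.transported_derivatives (hX : IsGradientField X) (hφ : IsFlow X φ)
    (hy : y ∈ Λ.nhd)
    (hd : ∀ᶠ t in 𝓝 (0 : ℝ), MDifferentiableAt (𝓡 n) (𝓡 n) (φ (-t)) (φ t y))
    (v : OrthonormalBasis (Fin n) ℝ (TangentSpace (𝓡 n) y)) :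
    ∃ q' : ℝ → ℝ, (∀ᶠ t in 𝓝 (0 : ℝ), HasDerivAt (fun s => transported z φ s y) (q' t) t) ∧
      q' 0 = -formsInner (ofDegree (z y)) (symOp X y v (ofDegree (z y))) ∧
      HasDerivAt q' (formsInner (ofDegree (z y)) (secondVarOp₁ X y v (ofDegree (z y)))) 0 := by
  have hXs := hX.isSmoothField
  have hys := Λ.nhd_subset hy
  set c := chartAt (EuclideanSpace ℝ (Fin n)) p with hc
  have hsym : (symPart X y).IsSymmetric := fun v w => symPart_symm X y v w
  -- In a frame of eigenvectors of `B` at `y` the velocity `Γ'(0)` is diagonal; `cliffSum_inner_eq`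
  -- returns to the given frame `v` at the end.
  set e := hsym.eigenvectorBasis (finrank_tangentSpace y) with he
  set β := hsym.eigenvalues (finrank_tangentSpace y) with hβ
  have hBe : ∀ i, symPart X y (e i) = β i • e i := hsym.apply_eigenvectorBasis _
  have hBS := smoothEndOn_symPart (hXs.smoothOn c.source)
  obtain ⟨D, hD⟩ := exists_covDerivEnd_linear (x := y) (smoothEndOn_symPart (hXs.smoothOn _)) X
  set C : Matrix (Fin n) (Fin n) ℝ := Matrix.of fun i j => inner ℝ (e i) (D (e j)) with hC
  let a : Fin n → EuclideanSpace ℝ (Fin n) := fun i => chartCoframe p y (e i)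
  let Γ : ℝ → Matrix (Fin n) (Fin n) ℝ := fun t => Matrix.of fun i j =>
    formRep (fun _ => LinearMap.id) p (Λ.curve y t).1 ((Λ.curve y t).2 (a i))
      ((Λ.curve y t).2 (a j))
  let Γ' : ℝ → Matrix (Fin n) (Fin n) ℝ := fun t => Matrix.of fun i j =>
    2 * formRep (symPart X) p (Λ.curve y t).1 ((Λ.curve y t).2 (a i))
      ((Λ.curve y t).2 (a j))
  have hI : Set.Ioo (-Λ.time) Λ.time ∈ 𝓝 (0 : ℝ) := isOpen_Ioo.mem_nhds Λ.zero_mem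
  have orth : ∀ i j, (inner ℝ (e i) (e j) : ℝ) = if i = j then 1 else 0 :=
    fun i j => orthonormal_iff_ite.1 e.orthonormal i j
  -- The Lie derivative formula for `T = id`, whose covariant derivative is zero: `Γ'` is the form
  -- `⟨2B ·, ·⟩`.
  have h : ∀ᶠ t in 𝓝 (0 : ℝ), ∀ i j, HasDerivAt (fun s => Γ s i j) (Γ' t i j) t := by
    filter_upwards [hI] with t ht i j
    have h1 := hasDerivAt_formRep (hXs.smoothOn _) (smoothEndOn_id _) (Λ.hasDerivAt y hy t ht)
      (Λ.curve_mem_target hy ht) (a i) (a j)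
    refine h1.congr_deriv ?_
    rw [covDerivEnd_id, inner_zero_left, zero_add]
    exact two_inner_symPart X _ _ _
  -- The same formula for `T = B` gives `∇_X B + B ∇X + (∇X)* B`. Because `X` is a gradient, `∇X =
  -- B`, so the last two terms add up to `2 B²`; the factor `2` in `Γ'` makes this `4 β²`.
  have h' : ∀ i j, HasDerivAt (fun s => Γ' s i j)
      (((2 : ℝ) • C + Matrix.diagonal (fun i => 4 * β i ^ 2) : Matrix (Fin n) (Fin n) ℝ) i j)
      0 := by
    intro i j
    have h1 := (hasDerivAt_formRep (hXs.smoothOn _) hBS (Λ.hasDerivAt y hy 0 Λ.zero_mem)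
      (Λ.curve_mem_target hy Λ.zero_mem) (a i) (a j)).const_mul 2
    refine h1.congr_deriv ?_
    rw [Λ.curve_zero y hy]
    have h2 := apply_chartFrame_chart (p := p) (fun x v w => (inner ℝ (covDerivEnd (symPart X) X x v) w
      + inner ℝ (symPart X x (nabla X x v)) w + inner ℝ (symPart X x v) (nabla X x w) : ℝ)) hys
      (e i) (e j)
    refine (congrArg (2 * ·) h2).trans ?_
    rw [← hD, ← hX.symPart_eq, hBe, hBe, map_smul, hBe]
    simp only [inner_smul_left, inner_smul_right, orth, Matrix.add_apply, Matrix.smul_apply,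
      Matrix.diagonal_apply, hC, Matrix.of_apply, smul_eq_mul]
    have h3 := inner_covDerivEnd_symPart_comm hXs (e i) (e j)
    rw [← hD, ← hD] at h3
    rw [h3]
    split_ifs with hij
    · subst hij; simp; ring
    · simp
  have h0 : Γ 0 = 1 := by
    ext i j
    have h2 := apply_chartFrame_chart (p := p) (fun x v w => (inner ℝ v w : ℝ)) hys (e i) (e j)
    have h3 : Γ 0 i j = _ := congrArg (fun s : PhaseSpace n =>
      formRep (fun _ : M => LinearMap.id) p s.1 (s.2 (a i)) (s.2 (a j))) (Λ.curve_zero y hy)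
    rw [h3, Matrix.one_apply, ← orth]
    exact h2
  have h0' : Γ' 0 = Matrix.diagonal fun i => 2 * β i := by
    ext i j
    have h2 := apply_chartFrame_chart (p := p) (fun x v w => (inner ℝ (symPart X x v) w : ℝ)) hys
      (e i) (e j)
    have h3 : Γ' 0 i j = _ := congrArg (fun s : PhaseSpace n =>
      2 * formRep (symPart X) p s.1 (s.2 (a i)) (s.2 (a j))) (Λ.curve_zero y hy)
    rw [h3]
    refine (congrArg (2 * ·) h2).trans ?_
    rw [hBe, inner_smul_left, orth, Matrix.diagonal_apply]
    split_ifs <;> simp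
  obtain ⟨q', hq, hq0, hq1⟩ := hasDerivAt_sqrt_det_mul_gramForm h h' h0 h0' k (comps e (z y))
  have htr : ∀ᶠ t in 𝓝 (0 : ℝ), transported z φ t y =
      Real.sqrt (Γ t).det * gramForm k (Γ t)⁻¹ (comps e (z y)) (comps e (z y)) := by
    filter_upwards [hI, hd] with t ht hdt
    have h1 := transported_mul_sqrt_det (z := z) e.toBasis (hφ.neg_comp hXs t)
      (Λ.mdifferentiableAt hXs hφ hy ht) hdt (Γ := Γ t) fun i j => by
        rw [Λ.inner_mfderiv hXs hφ hy ht]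
        simp only [OrthonormalBasis.coe_toBasis]
        rfl
    have h2 : (Matrix.of fun i j => (inner ℝ (e.toBasis i) (e.toBasis j) : ℝ)) = 1 := by
      ext i j
      simp only [OrthonormalBasis.coe_toBasis, Matrix.of_apply, orth, Matrix.one_apply]
    rw [h2, Matrix.det_one, Real.sqrt_one, mul_one, OrthonormalBasis.coe_toBasis] at h1
    exact h1
  have hop : symOp X y v = cliffSum e fun j m => if j = m then β j else 0 := by
    rw [symOp, cliffSum_inner_eq v e]
    congr 1
    funext i m
    rw [hBe, inner_smul_right, orth]
    split_ifs with him
    · rw [him, mul_one]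
    · rw [mul_zero]
  refine ⟨q', ?_, ?_, ?_⟩
  · filter_upwards [hq, htr.eventually_nhds] with t h1 h2
    exact h1.congr_of_eventuallyEq h2
  · rw [hq0, hop, formsInner_cliffSum_diagonal]
  · refine hq1.congr_deriv ?_
    have hcov : cliffSum v (fun j m => -inner ℝ (v j) (covDerivEnd (symPart X) X y (v m))) =
        cliffSum e (fun j m => -C j m) := by
      have h1 := cliffSum_inner_eq v e (-D)
      simp only [LinearMap.neg_apply, inner_neg_right, hD] at h1
      rw [h1]
      simp only [hC, Matrix.of_apply, hD]
    rw [secondVarOp₁, hop, hcov, LinearMap.add_apply, formsInner_ofDegree_add,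
      formsInner_cliffSum_sq, formsInner_cliffSum, formInner_comps e, add_comm, sub_eq_add_neg]
    congr 1
    rw [neg_sub, Matrix.trace, Finset.sum_mul, ← Finset.sum_sub_distrib]
    refine Finset.sum_congr rfl fun j _ => ?_
    have h2 : ∀ m, -C j m * (contr (comps e (z y)) j m + contr (comps e (z y)) m j
        - if j = m then (1 / (k.factorial : ℝ)) * ∑ I, comps e (z y) I * comps e (z y) I else 0) =
        (if j = m then C j m * ((1 / (k.factorial : ℝ)) * ∑ I, comps e (z y) I ^ 2) else 0)
          - C j m * (2 * contr (comps e (z y)) j m) := by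
      intro m
      rw [contr_comm e (z y) m j]
      simp only [pow_two]
      split_ifs <;> ring
    rw [Finset.sum_congr rfl fun m _ => h2 m, Finset.sum_sub_distrib]
    simp

end Identification

/-! ### Uniform Taylor estimates and measurability of the transported density -/

section Estimates

variable {n : ℕ} {M : Type*} [TopologicalSpace M] [T2Space M]
  [ChartedSpace (EuclideanSpace ℝ (Fin n)) M]
  [IsManifold (𝓡 n) ∞ M]
  [RiemannianBundle (fun x : M => TangentSpace (𝓡 n) x)]
  [IsContMDiffRiemannianBundle (𝓡 n) ∞ (EuclideanSpace ℝ (Fin n))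
    (fun x : M => TangentSpace (𝓡 n) x)]
variable {X : ∀ x : M, TangentSpace (𝓡 n) x} {φ : ℝ → M → M} {p y : M} {t : ℝ}
  (Λ : LocalFlow X p)

/-- The components of a form in coordinates are bounded by its norm. -/
lemma LocalFlow.exists_comps_bound (k : ℕ) : ∃ C : ℝ, ∀ (z : DiffForm n k M) (y : M)
    (hy : y ∈ Λ.nhd) (I J : Fin k → Fin n),
    |comps (coordBasis (Λ.nhd_subset hy)) (z y) I * comps (coordBasis (Λ.nhd_subset hy)) (z y) J| ≤
      C * formInner (z y) (z y) := by
  have hb : ∀ i : Fin n, ∃ C : ℝ, ∀ s ∈ Λ.compact, ‖pullGram p s i i‖ ≤ C := by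
    intro i
    refine Λ.isCompact.exists_bound_of_continuousOn ?_
    have h := ((contDiffOn_pullGram p).continuousOn.mono
      (Λ.compact_subset.trans (gramDomain_subset p)))
    exact continuousOn_pi.1 (continuousOn_pi.1 h i) i
  choose G hG using hb
  refine ⟨(k.factorial : ℝ) * (∑ i, |G i|) ^ k, fun z y hy I J => ?_⟩
  set b := coordBasis (Λ.nhd_subset hy) with hbdef
  have hnorm : ∀ i, ‖b i‖ ^ 2 ≤ ∑ i, |G i| := by
    intro i
    rw [← real_inner_self_eq_norm_sq, Λ.inner_coordBasis hy]
    exact (le_abs_self _).trans (((hG i _ (Λ.curve_mem y hy 0 Λ.zero_mem)).trans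
      (le_abs_self _)).trans (Finset.single_le_sum (f := fun i => |G i|)
        (fun i _ => abs_nonneg _) (Finset.mem_univ i)))
  have hsq : ∀ I : Fin k → Fin n, comps b (z y) I ^ 2 ≤
      (k.factorial : ℝ) * (∑ i, |G i|) ^ k * formInner (z y) (z y) := by
    intro I
    have h1 := sq_apply_le (z y) fun a => b (I a)
    have h2 : ∏ a, ‖b (I a)‖ ^ 2 ≤ (∑ i, |G i|) ^ k := by
      refine (Finset.prod_le_prod (fun a _ => sq_nonneg _) fun a _ => hnorm (I a)).trans ?_
      simp
    refine h1.trans ?_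
    rw [mul_right_comm]
    exact mul_le_mul_of_nonneg_right (mul_le_mul_of_nonneg_left h2 (by positivity))
      (formInner_self_nonneg _)
  have h1 := hsq I
  have h2 := hsq J
  rw [abs_mul]
  -- The product of two components is at most the mean of their squares.
  nlinarith [sq_nonneg (|comps b (z y) I| - |comps b (z y) J|), sq_abs (comps b (z y) I),
    sq_abs (comps b (z y) J)]

/-- The transported density and its third derivative are bounded by the norm of the form. -/
lemma LocalFlow.exists_bound (hX : IsSmoothField X) (k : ℕ) : ∃ C : ℝ, 0 ≤ C ∧
    ∀ (φ : ℝ → M → M) (_ : IsFlow X φ) (z : DiffForm n k M) (y : M) (_ : y ∈ Λ.nhd) (ε : ℝ)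
      (_ : ε ≤ Λ.time) (_ : ∀ t ∈ Set.Ioo (-ε) ε, ∀ x, MDifferentiableAt (𝓡 n) (𝓡 n) (φ t) x),
      ∃ g₁ g₂ g₃ : ℝ → ℝ, ∀ t ∈ Set.Ioo (-ε) ε,
        HasDerivAt (fun s => transported z φ s y) (g₁ t) t ∧ HasDerivAt g₁ (g₂ t) t ∧
        HasDerivAt g₂ (g₃ t) t ∧ |transported z φ t y| ≤ C * formInner (z y) (z y) ∧
        |g₃ t| ≤ C * formInner (z y) (z y) := by
  obtain ⟨Cz, hCz⟩ := Λ.exists_comps_bound k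
  choose f₁ f₂ f₃ B hB hf using fun I J : Fin k → Fin n => exists_three_derivatives_along
    (isOpen_gramDomain p) (contDiffOn_variationalField (hX.smoothOn _))
    (contDiffOn_pullCoeff (n := n) p I J) Λ.isCompact Λ.compact_subset
  obtain ⟨N, hN⟩ := Λ.isCompact.exists_bound_of_continuousOn
    (((contDiffOn_sqrt_det_pullGram p).continuousOn.mono Λ.compact_subset).inv₀
      fun s hs => (Real.sqrt_pos.2 (Λ.compact_subset hs).2).ne')
  set C := N * ((1 / (k.factorial : ℝ)) * ∑ I, ∑ J, B I J * Cz) with hC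
  refine ⟨|C|, abs_nonneg _, fun φ hφ z y hy ε hε hd => ?_⟩
  have hsub : ∀ t ∈ Set.Ioo (-ε) ε, t ∈ Set.Ioo (-Λ.time) Λ.time := fun t ht =>
    ⟨(neg_le_neg hε).trans_lt ht.1, ht.2.trans_le hε⟩
  set ζ := comps (coordBasis (Λ.nhd_subset hy)) (z y) with hζ
  set N₀ := (Real.sqrt (pullGram p (Λ.curve y 0)).det)⁻¹ with hN₀
  -- The transported density with its coefficient functions replaced by `F`. Time enters only
  -- through `F` along the trajectory, so differentiation acts on `F` alone and `z` enters only
  -- through the constants `ζ`.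
  let Q : ((Fin k → Fin n) → (Fin k → Fin n) → PhaseSpace n → ℝ) → ℝ → ℝ := fun F t =>
    N₀ * ((1 / (k.factorial : ℝ)) * ∑ I, ∑ J, F I J (Λ.curve y t) * (ζ I * ζ J))
  have hQd : ∀ F G : (Fin k → Fin n) → (Fin k → Fin n) → PhaseSpace n → ℝ, ∀ t : ℝ,
      (∀ I J, HasDerivAt (fun τ => F I J (Λ.curve y τ)) (G I J (Λ.curve y t)) t) →
      HasDerivAt (Q F) (Q G t) t := fun F G t h =>
    ((HasDerivAt.fun_sum fun I _ => HasDerivAt.fun_sum fun J _ =>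
      (h I J).mul_const (ζ I * ζ J)).const_mul _).const_mul _
  have hQb : ∀ F : (Fin k → Fin n) → (Fin k → Fin n) → PhaseSpace n → ℝ, ∀ t : ℝ,
      (∀ I J, |F I J (Λ.curve y t)| ≤ B I J) → |Q F t| ≤ |C| * formInner (z y) (z y) := by
    intro F t h
    have h0 := hN _ (Λ.curve_mem y hy 0 Λ.zero_mem)
    have hle : ∀ I J, |F I J (Λ.curve y t) * (ζ I * ζ J)| ≤
        B I J * Cz * formInner (z y) (z y) := by
      intro I J
      rw [abs_mul, mul_assoc]
      exact mul_le_mul (h I J) (hCz z y hy I J) (abs_nonneg _) ((abs_nonneg _).trans (h I J))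
    have hsum : |∑ I, ∑ J, F I J (Λ.curve y t) * (ζ I * ζ J)| ≤
        (∑ I, ∑ J, B I J * Cz) * formInner (z y) (z y) := by
      rw [Finset.sum_mul]
      refine (Finset.abs_sum_le_sum_abs _ _).trans (Finset.sum_le_sum fun I _ => ?_)
      rw [Finset.sum_mul]
      exact (Finset.abs_sum_le_sum_abs _ _).trans (Finset.sum_le_sum fun J _ => hle I J)
    have hk : (0 : ℝ) ≤ 1 / (k.factorial : ℝ) := by positivity
    calc |Q F t| = |N₀| * ((1 / (k.factorial : ℝ)) *
          |∑ I, ∑ J, F I J (Λ.curve y t) * (ζ I * ζ J)|) := by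
          simp only [Q]
          rw [abs_mul, abs_mul, abs_of_nonneg hk]
      _ ≤ N * ((1 / (k.factorial : ℝ)) *
          ((∑ I, ∑ J, B I J * Cz) * formInner (z y) (z y))) :=
          mul_le_mul h0 (mul_le_mul_of_nonneg_left hsum hk)
            (mul_nonneg hk (abs_nonneg _)) ((norm_nonneg _).trans h0)
      _ = C * formInner (z y) (z y) := by rw [hC]; ring
      _ ≤ |C| * formInner (z y) (z y) :=
          mul_le_mul_of_nonneg_right (le_abs_self _) (formInner_self_nonneg _)
  have hQt : ∀ t ∈ Set.Ioo (-ε) ε, transported z φ t y = Q (pullCoeff p) t := fun t ht =>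
    Λ.transported_eq hX hφ hy (hsub t ht)
      (hd (-t) ⟨neg_lt_neg ht.2, by linarith [ht.1]⟩ _)
  refine ⟨Q f₁, Q f₂, Q f₃, fun t ht => ?_⟩
  have hder := fun I J => hf I J (Λ.curve y) t (Λ.hasDerivAt y hy t (hsub t ht))
    (Λ.compact_subset (Λ.curve_mem y hy t (hsub t ht)))
  have hbd := fun I J => hB I J _ (Λ.curve_mem y hy t (hsub t ht))
  refine ⟨?_, hQd _ _ t fun I J => (hder I J).2.1, hQd _ _ t fun I J => (hder I J).2.2, ?_,
    hQb _ t fun I J => (hbd I J).2⟩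
  · refine (hQd _ _ t fun I J => (hder I J).1).congr_of_eventuallyEq ?_
    filter_upwards [isOpen_Ioo.mem_nhds ht] with s hs using hQt s hs
  · rw [hQt t ht]
    exact hQb _ t fun I J => (hbd I J).1

/-- The local Taylor estimate for the transported density. -/
lemma LocalFlow.exists_taylor (hX : IsGradientField X) (k : ℕ) : ∃ C : ℝ, 0 ≤ C ∧
    ∀ (φ : ℝ → M → M) (_ : IsFlow X φ) (z : DiffForm n k M) (y : M) (_ : y ∈ Λ.nhd) (ε : ℝ)
      (_ : 0 < ε) (_ : ε ≤ Λ.time)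
      (_ : ∀ t ∈ Set.Ioo (-ε) ε, ∀ x, MDifferentiableAt (𝓡 n) (𝓡 n) (φ t) x)
      (v : OrthonormalBasis (Fin n) ℝ (TangentSpace (𝓡 n) y)),
      ∀ t ∈ Set.Ioo (-ε) ε, |transported z φ t y| ≤ C * formInner (z y) (z y) ∧
        |transported z φ t y - transported z φ 0 y
          - t * -formsInner (ofDegree (z y)) (symOp X y v (ofDegree (z y)))
          - t ^ 2 / 2 * formsInner (ofDegree (z y)) (secondVarOp₁ X y v (ofDegree (z y)))| ≤
        C * formInner (z y) (z y) * |t| ^ 3 := by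
  obtain ⟨C, hC, h⟩ := Λ.exists_bound hX.isSmoothField k
  refine ⟨C, hC, fun φ hφ z y hy ε hε0 hε hd v t ht => ?_⟩
  obtain ⟨g₁, g₂, g₃, hg⟩ := h φ hφ z y hy ε hε hd
  have hI : Set.Ioo (-ε) ε ∈ 𝓝 (0 : ℝ) := isOpen_Ioo.mem_nhds ⟨neg_lt_zero.2 hε0, hε0⟩
  obtain ⟨q', hq, hq0, hq1⟩ := Λ.transported_derivatives (z := z) hX hφ hy (by
    filter_upwards [hI] with s hs
    exact hd (-s) ⟨neg_lt_neg hs.2, by linarith [hs.1]⟩ _) v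
  -- `exists_bound` only asserts that derivatives exist; their values at `0` come from
  -- `transported_derivatives` by uniqueness of derivatives.
  have he : q' =ᶠ[𝓝 0] g₁ := by
    filter_upwards [hq, hI] with s h1 h2 using h1.unique (hg s h2).1
  have h1 : g₁ 0 = _ := he.eq_of_nhds.symm.trans hq0
  have h2 : g₂ 0 = _ := (hg 0 (mem_of_mem_nhds hI)).2.1.unique (hq1.congr_of_eventuallyEq he.symm)
  have ht' := abs_sub_taylor_two_le (fun s hs => (hg s hs).1) (fun s hs => (hg s hs).2.1)
    (fun s hs => (hg s hs).2.2.1) (fun s hs => (hg s hs).2.2.2.2) ht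
  rw [h1, h2] at ht'
  exact ⟨(hg t ht).2.2.2.1, ht'⟩

/-- Coordinate fields extend to global smooth fields. -/
lemma exists_smooth_extension (p : M) : ∃ O : Set M, IsOpen O ∧ p ∈ O ∧
    ∀ a : EuclideanSpace ℝ (Fin n), ∃ Y : ∀ x : M, TangentSpace (𝓡 n) x, IsSmoothField Y ∧
      ∀ y ∈ O, Y y = coordField p a y := by
  obtain ⟨f⟩ : Nonempty (SmoothBumpFunction (𝓡 n) p) := inferInstance
  obtain ⟨O, hO, hOo, hpO⟩ := eventually_nhds_iff.1 f.eventuallyEq_one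
  refine ⟨O, hOo, hpO, fun a => ⟨fun y => f y • coordField p a y, ?_, fun y hy => ?_⟩⟩
  · exact ContMDiffOn.smul_section_of_tsupport (V := fun x : M => TangentSpace (𝓡 n) x)
      (f.contMDiff.contMDiffOn) (chartAt (EuclideanSpace ℝ (Fin n)) p).open_source
      f.tsupport_subset_chartAt_source (smoothOn_coordField p a)
  · simp only [hO y hy, Pi.one_apply, one_smul]

variable [MeasurableSpace M] [BorelSpace M]

/-- Measurability of `z` is tested on global smooth fields, so coordinate fields are cut off. Where
the cutoff equals one, the density is a quadratic expression in tested components, with coefficients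
continuous in the point. -/
lemma LocalFlow.exists_aestronglyMeasurable (hX : IsSmoothField X) {k : ℕ} {z : DiffForm n k M}
    (hz : IsL2Form z) : ∃ O : Set M, IsOpen O ∧ p ∈ O ∧ ∀ φ : ℝ → M → M, IsFlow X φ →
      ∀ t ∈ Set.Ioo (-Λ.time) Λ.time, (∀ x, MDifferentiableAt (𝓡 n) (𝓡 n) (φ (-t)) x) →
        AEStronglyMeasurable (transported z φ t) ((riemVolume n M).restrict O) := by
  obtain ⟨O', hO', hpO', hY⟩ := exists_smooth_extension (n := n) p
  choose Y hYs hYe using hY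
  have hO : IsOpen (O' ∩ Λ.nhd) := hO'.inter Λ.isOpen_nhd
  refine ⟨O' ∩ Λ.nhd, hO, ⟨hpO', Λ.mem_nhd⟩, fun φ hφ t ht hd => ?_⟩
  set μ := (riemVolume n M).restrict (O' ∩ Λ.nhd)
  have hζ : ∀ I : Fin k → Fin n, AEStronglyMeasurable
      (fun y => z y fun a => Y (EuclideanSpace.single (I a) (1 : ℝ)) y) μ := fun I =>
    (hz.1 (fun a => Y (EuclideanSpace.single (I a) (1 : ℝ))) fun a => hYs _).restrict
  have hcont : ∀ f : PhaseSpace n → ℝ, ContinuousOn f (gramDomain p) →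
      ∀ s ∈ Set.Ioo (-Λ.time) Λ.time, AEStronglyMeasurable (fun y => f (Λ.curve y s)) μ :=
    fun f hf s hs => ((Λ.continuousOn_comp hf hs).mono
      Set.inter_subset_right).aestronglyMeasurable hO.measurableSet
  have hm : AEStronglyMeasurable (fun y => (Real.sqrt (pullGram p (Λ.curve y 0)).det)⁻¹ *
      ((1 / (k.factorial : ℝ)) * ∑ I, ∑ J, pullCoeff p I J (Λ.curve y t) *
        ((z y fun a => Y (EuclideanSpace.single (I a) (1 : ℝ)) y) *
          (z y fun a => Y (EuclideanSpace.single (J a) (1 : ℝ)) y)))) μ := by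
    refine AEStronglyMeasurable.mul (hcont (fun s => (Real.sqrt (pullGram p s).det)⁻¹) ?_ 0
      Λ.zero_mem) (AEStronglyMeasurable.const_mul ?_ _)
    · exact (contDiffOn_sqrt_det_pullGram p).continuousOn.inv₀
        fun s hs => (Real.sqrt_pos.2 hs.2).ne'
    · exact Finset.aestronglyMeasurable_fun_sum _ fun I _ =>
        Finset.aestronglyMeasurable_fun_sum _ fun J _ =>
          (hcont _ (contDiffOn_pullCoeff p I J).continuousOn t ht).mul ((hζ I).mul (hζ J))
  refine hm.congr ?_
  filter_upwards [ae_restrict_mem hO.measurableSet] with y hy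
  rw [Λ.transported_eq hX hφ hy.2 ht (hd _)]
  have h : ∀ I : Fin k → Fin n, (z y fun a => Y (EuclideanSpace.single (I a) (1 : ℝ)) y) =
      comps (coordBasis (Λ.nhd_subset hy.2)) (z y) I := by
    intro I
    rw [comps]
    congr 1
    funext a
    rw [hYe _ y hy.1, coordBasis_apply]
  simp only [h]

end Estimates

/-! ### Integration of a second order expansion; consequences of a local minimum -/

section Expansion

variable {Ω : Type*} [MeasurableSpace Ω] {μ : Measure Ω} {T : ℝ → Ω → ℝ} {a b w : Ω → ℝ}
  {C ε : ℝ}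

lemma tendsto_of_abs_sub_le_mul {f : ℕ → ℝ} {l K : ℝ} {τ : ℕ → ℝ}
    (hτ : Filter.Tendsto τ Filter.atTop (𝓝 0)) (h : ∀ m, |f m - l| ≤ K * τ m) :
    Filter.Tendsto f Filter.atTop (𝓝 l) := by
  rw [tendsto_iff_norm_sub_tendsto_zero]
  refine squeeze_zero (fun m => norm_nonneg _) h ?_
  simpa using hτ.const_mul K

lemma abs_le_of_abs_sub_mul_le {x y δ B : ℝ} (hδ : 0 < δ) (h : |x - δ * y| ≤ B) :
    |x / δ - y| ≤ B / δ := by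
  rw [le_div_iff₀ hδ, ← abs_of_pos hδ, ← abs_mul, abs_of_pos hδ, sub_mul, div_mul_cancel₀ _ hδ.ne',
    mul_comm y]
  exact h

/-- Integration of a second order expansion with a uniform bound on the remainder. -/
lemma integrable_of_expansion (hw : Integrable w μ) (hε : 0 < ε)
    (hm : ∀ t ∈ Set.Ioo (-ε) ε, AEStronglyMeasurable (T t) μ)
    (hb : ∀ t ∈ Set.Ioo (-ε) ε, ∀ y, |T t y| ≤ C * w y)
    (hT : ∀ t ∈ Set.Ioo (-ε) ε, ∀ y,
      |T t y - T 0 y - t * a y - t ^ 2 / 2 * b y| ≤ C * w y * |t| ^ 3) :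
    Integrable a μ ∧ Integrable b μ ∧ ∀ t ∈ Set.Ioo (-ε) ε,
      |(∫ y, T t y ∂μ) - (∫ y, T 0 y ∂μ) - t * (∫ y, a y ∂μ) - t ^ 2 / 2 * ∫ y, b y ∂μ| ≤
        (∫ y, C * w y ∂μ) * |t| ^ 3 := by
  have h0 : (0 : ℝ) ∈ Set.Ioo (-ε) ε := ⟨neg_lt_zero.2 hε, hε⟩
  have hneg : ∀ {t : ℝ}, t ∈ Set.Ioo (-ε) ε → -t ∈ Set.Ioo (-ε) ε := fun {t} ht =>
    ⟨neg_lt_neg ht.2, neg_lt.1 ht.1⟩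
  -- Symmetric first and second difference quotients approximate `a` and `b` with errors controlled
  -- by `w`. This yields measurability, as limits along `τ`, and integrability, from one fixed
  -- quotient.
  have ha : ∀ t ∈ Set.Ioo (-ε) ε, 0 < t → ∀ y,
      |(T t y - T (-t) y) / (2 * t) - a y| ≤ C * w y * t ^ 2 := fun t ht htp y => by
    have h1 := hT t ht y
    have h2 := hT (-t) (hneg ht) y
    rw [abs_neg] at h2
    rw [abs_of_pos htp] at h1 h2
    have h3 : |(T t y - T (-t) y) - 2 * t * a y| ≤ 2 * (C * w y * t ^ 3) := by
      rw [abs_le] at h1 h2 ⊢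
      constructor <;> nlinarith
    refine (abs_le_of_abs_sub_mul_le (by positivity) h3).trans (le_of_eq ?_)
    field_simp
  have hbb : ∀ t ∈ Set.Ioo (-ε) ε, 0 < t → ∀ y,
      |(T t y + T (-t) y - 2 * T 0 y) / t ^ 2 - b y| ≤ 2 * (C * w y) * t := fun t ht htp y => by
    have h1 := hT t ht y
    have h2 := hT (-t) (hneg ht) y
    rw [abs_neg] at h2
    rw [abs_of_pos htp] at h1 h2
    have h3 : |(T t y + T (-t) y - 2 * T 0 y) - t ^ 2 * b y| ≤ 2 * (C * w y * t ^ 3) := by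
      rw [abs_le] at h1 h2 ⊢
      constructor <;> nlinarith
    refine (abs_le_of_abs_sub_mul_le (by positivity) h3).trans (le_of_eq ?_)
    field_simp
  let τ : ℕ → ℝ := fun m => ε / 2 * (1 / ((m : ℝ) + 1))
  have hτp : ∀ m, 0 < τ m := fun m => by positivity
  have hτε : ∀ m, τ m ≤ ε / 2 := fun m => by
    refine mul_le_of_le_one_right (by positivity) ?_
    rw [div_le_one (by positivity)]
    have : (0 : ℝ) ≤ m := m.cast_nonneg
    linarith
  have hτm : ∀ m, τ m ∈ Set.Ioo (-ε) ε := fun m =>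
    ⟨by linarith [hτp m], by linarith [hτε m]⟩
  have hτ0 : Filter.Tendsto τ Filter.atTop (𝓝 0) := by
    have h := (tendsto_one_div_add_atTop_nhds_zero_nat (𝕜 := ℝ)).const_mul (ε / 2)
    rwa [mul_zero] at h
  have ham : AEStronglyMeasurable a μ := by
    refine aestronglyMeasurable_of_tendsto_ae Filter.atTop
      (f := fun m y => (T (τ m) y - T (-τ m) y) / (2 * τ m)) (fun m => ?_)
      (Filter.Eventually.of_forall fun y => ?_)
    · simp only [div_eq_mul_inv]
      exact ((hm _ (hτm m)).sub (hm _ (hneg (hτm m)))).mul_const (2 * τ m)⁻¹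
    · refine tendsto_of_abs_sub_le_mul (τ := fun m => τ m ^ 2) (K := C * w y) ?_
        fun m => ha _ (hτm m) (hτp m) y
      simpa using hτ0.pow 2
  have hbm : AEStronglyMeasurable b μ := by
    refine aestronglyMeasurable_of_tendsto_ae Filter.atTop
      (f := fun m y => (T (τ m) y + T (-τ m) y - 2 * T 0 y) / τ m ^ 2) (fun m => ?_)
      (Filter.Eventually.of_forall fun y => ?_)
    · simp only [div_eq_mul_inv]
      exact (((hm _ (hτm m)).add (hm _ (hneg (hτm m)))).sub ((hm 0 h0).const_mul 2)).mul_const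
          (τ m ^ 2)⁻¹
    · exact tendsto_of_abs_sub_le_mul hτ0 fun m => hbb _ (hτm m) (hτp m) y
  have hTi : ∀ t ∈ Set.Ioo (-ε) ε, Integrable (T t) μ := fun t ht =>
    (hw.const_mul C).mono' (hm t ht) (Filter.Eventually.of_forall (hb t ht))
  have hδ := hτm 0
  have hai : Integrable a μ := by
    have h1 : Integrable (fun y => |(T (τ 0) y - T (-τ 0) y) / (2 * τ 0)| + C * w y * τ 0 ^ 2) μ :=
      (((hTi _ hδ).sub (hTi _ (hneg hδ))).div_const _).abs.add ((hw.const_mul C).mul_const _)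
    refine h1.mono' ham (Filter.Eventually.of_forall fun y => ?_)
    have h2 := ha _ hδ (hτp 0) y
    have h3 := abs_sub_abs_le_abs_sub (a y) ((T (τ 0) y - T (-τ 0) y) / (2 * τ 0))
    rw [abs_sub_comm] at h3
    rw [Real.norm_eq_abs]
    linarith
  have hbi : Integrable b μ := by
    have h1 : Integrable (fun y => |(T (τ 0) y + T (-τ 0) y - 2 * T 0 y) / τ 0 ^ 2| +
        2 * (C * w y) * τ 0) μ :=
      ((((hTi _ hδ).add (hTi _ (hneg hδ))).sub ((hTi 0 h0).const_mul 2)).div_const _).abs.add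
        (((hw.const_mul C).const_mul 2).mul_const _)
    refine h1.mono' hbm (Filter.Eventually.of_forall fun y => ?_)
    have h2 := hbb _ hδ (hτp 0) y
    have h3 := abs_sub_abs_le_abs_sub (b y) ((T (τ 0) y + T (-τ 0) y - 2 * T 0 y) / τ 0 ^ 2)
    rw [abs_sub_comm] at h3
    rw [Real.norm_eq_abs]
    linarith
  refine ⟨hai, hbi, fun t ht => ?_⟩
  have e : ∫ y, T t y - T 0 y - t * a y - t ^ 2 / 2 * b y ∂μ =
      (∫ y, T t y ∂μ) - (∫ y, T 0 y ∂μ) - t * (∫ y, a y ∂μ) - t ^ 2 / 2 * ∫ y, b y ∂μ := by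
    have i1 : Integrable (fun y => T t y - T 0 y) μ := (hTi t ht).sub (hTi 0 h0)
    have i2 : Integrable (fun y => T t y - T 0 y - t * a y) μ := i1.sub (hai.const_mul t)
    rw [integral_sub i2 (hbi.const_mul _), integral_sub i1 (hai.const_mul t),
      integral_sub (hTi t ht) (hTi 0 h0), integral_const_mul, integral_const_mul]
  rw [← e, ← integral_mul_const]
  rw [← Real.norm_eq_abs]
  refine norm_integral_le_of_norm_le ((hw.const_mul C).mul_const (|t| ^ 3))
    (Filter.Eventually.of_forall fun y => ?_)
  rw [Real.norm_eq_abs]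
  exact hT t ht y

/-- Division by `t` and passage to the limit gives the first claim; if the linear term is absent,
division by `t²` gives the second. -/
lemma nonneg_of_nonneg_quadratic {x y K : ℝ}
    (h : ∀ᶠ t in 𝓝[>] (0 : ℝ), 0 ≤ t * x + t ^ 2 / 2 * y + K * t ^ 3) :
    0 ≤ x ∧ (x = 0 → 0 ≤ y) := by
  have hlim : ∀ p q : ℝ, Filter.Tendsto (fun t : ℝ => p + t * q + K * t ^ 2 ) (𝓝[>] 0) (𝓝 p) := by
    intro p q
    have : Continuous fun t : ℝ => p + t * q + K * t ^ 2 := by fun_prop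
    simpa using (this.tendsto 0).mono_left nhdsWithin_le_nhds
  constructor
  · refine ge_of_tendsto (hlim x (y / 2)) ?_
    filter_upwards [h, self_mem_nhdsWithin] with t ht ht0
    have ht0' : (0 : ℝ) < t := ht0
    refine nonneg_of_mul_nonneg_right (a := t) ?_ ht0'
    linarith
  · rintro rfl
    have h2 : Filter.Tendsto (fun t : ℝ => y / 2 + t * K + 0 * t ^ 2) (𝓝[>] 0) (𝓝 (y / 2)) := by
      have : Continuous fun t : ℝ => y / 2 + t * K + 0 * t ^ 2 := by fun_prop
      simpa using (this.tendsto 0).mono_left nhdsWithin_le_nhds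
    have h3 : 0 ≤ y / 2 := by
      refine ge_of_tendsto h2 ?_
      filter_upwards [h, self_mem_nhdsWithin] with t ht ht0
      have ht0' : (0 : ℝ) < t := ht0
      refine nonneg_of_mul_nonneg_right (a := t ^ 2) ?_ (by positivity)
      linarith
    linarith

/-- The one-sided statement is applied in both time directions, which gives both signs of the linear
coefficient. -/
lemma IsLocalMin.of_expansion {F : ℝ → ℝ} {x y K : ℝ} (hF : IsLocalMin F 0) (hε : 0 < ε)
    (h : ∀ t ∈ Set.Ioo (-ε) ε, |F t - F 0 - t * x - t ^ 2 / 2 * y| ≤ K * |t| ^ 3) :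
    x = 0 ∧ 0 ≤ y := by
  have hI : Set.Ioo (-ε) ε ∈ 𝓝 (0 : ℝ) := isOpen_Ioo.mem_nhds ⟨neg_lt_zero.2 hε, hε⟩
  have hev : ∀ᶠ t in 𝓝 (0 : ℝ), 0 ≤ t * x + t ^ 2 / 2 * y + K * |t| ^ 3 := by
    filter_upwards [hF, hI] with t h1 h2
    have h3 := (abs_le.1 (h t h2)).2
    linarith
  have hneg : Filter.Tendsto (fun t : ℝ => -t) (𝓝 0) (𝓝 0) := by
    simpa using (continuous_neg (G := ℝ)).tendsto 0
  have h1 := nonneg_of_nonneg_quadratic (x := x) (y := y) (K := K) (by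
    filter_upwards [nhdsWithin_le_nhds hev, self_mem_nhdsWithin] with t ht ht0
    rwa [abs_of_pos ht0] at ht)
  have h2 := nonneg_of_nonneg_quadratic (x := -x) (y := y) (K := K) (by
    filter_upwards [nhdsWithin_le_nhds (hneg.eventually hev), self_mem_nhdsWithin] with t ht ht0
    rw [abs_neg, abs_of_pos ht0] at ht
    linarith)
  have hx : x = 0 := le_antisymm (by linarith [h2.1]) h1.1
  exact ⟨hx, h1.2 hx⟩

end Expansion

/-! ### The variation formula on a compact manifold -/

section Global

variable {n : ℕ} {M : Type*} [TopologicalSpace M] [T2Space M] [CompactSpace M]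
  [ChartedSpace (EuclideanSpace ℝ (Fin n)) M]
  [IsManifold (𝓡 n) ∞ M]
  [RiemannianBundle (fun x : M => TangentSpace (𝓡 n) x)]
  [IsContMDiffRiemannianBundle (𝓡 n) ∞ (EuclideanSpace ℝ (Fin n))
    (fun x : M => TangentSpace (𝓡 n) x)]
variable {X : ∀ x : M, TangentSpace (𝓡 n) x} {φ : ℝ → M → M} {t ε : ℝ} {k : ℕ}
  {z : DiffForm n k M}

lemma exists_pos_forall_le {ι : Type*} (s : Finset ι) {τ : ι → ℝ} (hτ : ∀ i, 0 < τ i) :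
    ∃ ε > 0, ∀ i ∈ s, ε ≤ τ i := by
  have h : ∀ᶠ ε in 𝓝[>] (0 : ℝ), ∀ i ∈ s, ε ≤ τ i := (Filter.eventually_all_finset s).2 fun i _ =>
    nhdsWithin_le_nhds ((eventually_lt_nhds (hτ i)).mono fun _ h => h.le)
  obtain ⟨ε, h1, h2⟩ := (h.and self_mem_nhdsWithin).exists
  exact ⟨ε, h2, h1⟩

/-- For times in `(-ε, ε)` the maps `φ t` are differentiable, with continuous and positive
Jacobian. -/
def IsFlowTime (φ : ℝ → M → M) (ε : ℝ) : Prop :=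
  ∀ t ∈ Set.Ioo (-ε) ε, ∀ x, MDifferentiableAt (𝓡 n) (𝓡 n) (φ t) x ∧
    ContinuousAt (fun y => jac (mfderiv (𝓡 n) (𝓡 n) (φ t) y).toLinearMap) x ∧
    0 < jac (mfderiv (𝓡 n) (𝓡 n) (φ t) x).toLinearMap

/-- Finitely many local flows cover `M`, so all integral curves exist for a common time, and a field
with this property has a global flow. The bound `ε` depends only on `X`. -/
lemma exists_flow (hX : IsSmoothField X) :
    (∃ φ, IsFlow X φ) ∧ ∃ ε > 0, ∀ φ, IsFlow X φ → IsFlowTime (n := n) φ ε := by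
  have : IsManifold (𝓡 n) 1 M := .of_le (n := ∞) ENat.LEInfty.out
  have hΛ := fun p => (exists_localFlow hX p).some
  obtain ⟨s, hs⟩ := exists_finite_cover (fun p => (hΛ p).isOpen_nhd) fun p => (hΛ p).mem_nhd
  obtain ⟨ε, hε, hε'⟩ := exists_pos_forall_le s fun p => (hΛ p).time_pos
  have hcov : ∀ y, ∃ p ∈ s, y ∈ (hΛ p).nhd := fun y => by
    have hy : y ∈ ⋃ p : s, (hΛ p).nhd := hs ▸ Set.mem_univ y
    simpa using hy
  have hsub : ∀ p ∈ s, Set.Ioo (-ε) ε ⊆ Set.Ioo (-(hΛ p).time) (hΛ p).time := fun p hp =>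
    Set.Ioo_subset_Ioo (neg_le_neg (hε' p hp)) (hε' p hp)
  refine ⟨?_, ε, hε, fun φ hφ t ht y => ?_⟩
  · have h : ∀ x : M, ∃ γ : ℝ → M, γ 0 = x ∧ IsMIntegralCurveOn (I := 𝓡 n) γ X (Set.Ioo (-ε) ε) := by
      intro y
      obtain ⟨p, hp, hy⟩ := hcov y
      refine ⟨_, ?_, ((hΛ p).isMIntegralCurveOn y hy).mono (hsub p hp)⟩
      rw [(hΛ p).curve_zero y hy]
      exact (chartAt (EuclideanSpace ℝ (Fin n)) p).left_inv ((hΛ p).nhd_subset hy)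
    choose γ h1 h2 using exists_isMIntegralCurve_of_isMIntegralCurveOn hX.contMDiff_one hε h
    exact ⟨fun t x => γ x t, h1, h2⟩
  · obtain ⟨p, hp, hy⟩ := hcov y
    exact ⟨(hΛ p).mdifferentiableAt hX hφ hy (hsub p hp ht),
      (hΛ p).continuousAt_jac hX hφ hy (hsub p hp ht), by
        rw [(hΛ p).jac_eq hX hφ hy (hsub p hp ht)]
        exact div_pos (Real.sqrt_pos.2 ((hΛ p).det_pos hy (hsub p hp ht)))
          (Real.sqrt_pos.2 ((hΛ p).det_pos hy (hΛ p).zero_mem))⟩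

lemma neg_mem_Ioo (ht : t ∈ Set.Ioo (-ε) ε) : -t ∈ Set.Ioo (-ε) ε :=
  ⟨neg_lt_neg ht.2, neg_lt.1 ht.1⟩

/-- The maps of the flow, as homeomorphisms. -/
def flowHomeo (hX : IsSmoothField X) (hφ : IsFlow X φ) (hd : IsFlowTime (n := n) φ ε)
    (ht : t ∈ Set.Ioo (-ε) ε) : M ≃ₜ M where
  toFun := φ t
  invFun := φ (-t)
  left_inv := fun y => congrFun (hφ.neg_comp hX t) y
  right_inv := fun y => by
    have h := congrFun (hφ.neg_comp hX (-t)) y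
    rwa [neg_neg] at h
  continuous_toFun := continuous_iff_continuousAt.2 fun y => (hd t ht y).1.continuousAt
  continuous_invFun := continuous_iff_continuousAt.2 fun y =>
    (hd (-t) (neg_mem_Ioo ht) y).1.continuousAt

lemma transported_zero (hφ : IsFlow X φ) (z : DiffForm n k M) (y : M) :
    transported z φ 0 y = formInner (z y) (z y) := by
  have h0 : φ 0 = id := funext hφ.1
  have hd : ∀ x, MDifferentiableAt (𝓡 n) (𝓡 n) (φ 0) x := fun x => by
    rw [h0]; exact mdifferentiableAt_id
  let v := stdOrthonormalBasis ℝ (TangentSpace (𝓡 n) y)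
  have hΓ : ∀ ψ : M → M, ψ = id → ∀ i j, (inner ℝ (mfderiv (𝓡 n) (𝓡 n) ψ y (v.toBasis i))
      (mfderiv (𝓡 n) (𝓡 n) ψ y (v.toBasis j)) : ℝ) =
        (Matrix.of fun i j => (inner ℝ (v.toBasis i) (v.toBasis j) : ℝ)) i j := by
    rintro _ rfl i j
    rw [mfderiv_id]
    rfl
  have hv : (Matrix.of fun i j => (inner ℝ (v.toBasis i) (v.toBasis j) : ℝ)) = 1 := by
    ext i j
    simp [Matrix.one_apply, orthonormal_iff_ite.1 v.orthonormal]
  have h := transported_mul_sqrt_det (z := z) (t := 0) v.toBasis (by rw [neg_zero, h0]; rfl) (hd y)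
    (by rw [neg_zero]; exact hd _) (hΓ _ h0)
  rw [hv, Matrix.det_one, Real.sqrt_one, mul_one, one_mul, inv_one, gramForm_one] at h
  rw [h, formInner_comps v]
  rfl

variable [MeasurableSpace M] [BorelSpace M]

lemma integral_comp_mul_jac_flow (hX : IsSmoothField X) (hφ : IsFlow X φ)
    (hd : IsFlowTime (n := n) φ ε) (ht : t ∈ Set.Ioo (-ε) ε) (h : M → ℝ) :
    ∫ y, h y ∂riemVolume n M =
      ∫ y, jac (mfderiv (𝓡 n) (𝓡 n) (φ t) y).toLinearMap * h (φ t y) ∂riemVolume n M :=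
  integral_comp_mul_jac (ψ := flowHomeo hX hφ hd ht) (fun y => (hd t ht y).1)
    (continuous_iff_continuousAt.2 fun y => (hd t ht y).2.1).measurable h

/-- The substitution `x = φ_t y`, after which `z` is evaluated at `y` only. The time is reversed in
the process. -/
lemma normSq_pullback_eq (hX : IsSmoothField X) (hφ : IsFlow X φ)
    (hd : IsFlowTime (n := n) φ ε) (ht : t ∈ Set.Ioo (-ε) ε) :
    normSq (pullback (φ (-t)) z) = ∫ y, transported z φ t y ∂riemVolume n M :=
  integral_comp_mul_jac_flow hX hφ hd ht _

/-- The global Taylor estimate for the transported density. -/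
lemma exists_expansion (hX : IsGradientField X) (hz : IsL2Form z)
    (v : ∀ x : M, OrthonormalBasis (Fin n) ℝ (TangentSpace (𝓡 n) x)) (hφ : IsFlow X φ) :
    ∃ C ε : ℝ, 0 < ε ∧ IsFlowTime (n := n) φ ε ∧ ∀ t ∈ Set.Ioo (-ε) ε,
      AEStronglyMeasurable (transported z φ t) (riemVolume n M) ∧
      ∀ y, |transported z φ t y| ≤ C * formInner (z y) (z y) ∧
        |transported z φ t y - transported z φ 0 y
          - t * -density z (fun x => symOp X x (v x)) y
          - t ^ 2 / 2 * density z (fun x => secondVarOp₁ X x (v x)) y| ≤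
        C * formInner (z y) (z y) * |t| ^ 3 := by
  have hs := hX.isSmoothField
  have hΛ := fun p => (exists_localFlow hs p).some
  obtain ⟨-, ε₀, hε₀, hd⟩ := exists_flow hs
  choose O hO hpO hmeas using fun p => (hΛ p).exists_aestronglyMeasurable hs hz
  choose C hC htay using fun p => (hΛ p).exists_taylor hX k
  obtain ⟨s, hcov⟩ := exists_finite_cover (O := fun p => O p ∩ (hΛ p).nhd)
    (fun p => (hO p).inter (hΛ p).isOpen_nhd) fun p => ⟨hpO p, (hΛ p).mem_nhd⟩
  obtain ⟨ε, hε, hε'⟩ := exists_pos_forall_le s fun p => lt_min hε₀ (hΛ p).time_pos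
  have hd' : IsFlowTime (n := n) φ (min ε ε₀) := fun t ht =>
    hd φ hφ t ⟨(neg_le_neg (min_le_right _ _)).trans_lt ht.1, ht.2.trans_le (min_le_right _ _)⟩
  -- The local constants are nonnegative, so their finite sum dominates each of them.
  refine ⟨∑ p ∈ s, C p, min ε ε₀, lt_min hε hε₀, hd', fun t ht => ⟨?_, fun y => ?_⟩⟩
  · rw [← Measure.restrict_univ (μ := riemVolume n M), ← hcov]
    refine AEStronglyMeasurable.iUnion fun p => ?_
    have hp : ε ≤ (hΛ p).time := (hε' p p.2).trans (min_le_right _ _)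
    have h : min ε ε₀ ≤ (hΛ p).time := (min_le_left _ _).trans hp
    exact (hmeas p φ hφ t ⟨(neg_le_neg h).trans_lt ht.1, ht.2.trans_le h⟩ fun x =>
      (hd' (-t) (neg_mem_Ioo ht) x).1).mono_set Set.inter_subset_left
  · have hy : y ∈ ⋃ p : s, O p ∩ (hΛ p).nhd := hcov ▸ Set.mem_univ y
    obtain ⟨p, hp⟩ := Set.mem_iUnion.1 hy
    have hpt : ε ≤ (hΛ p).time := (hε' p p.2).trans (min_le_right _ _)
    have h := htay p φ hφ z y hp.2 (min ε ε₀) (lt_min hε hε₀) ((min_le_left _ _).trans hpt)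
      (fun t ht x => (hd' t ht x).1) (v y) t ht
    have hCp : C p * formInner (z y) (z y) ≤ (∑ p ∈ s, C p) * formInner (z y) (z y) :=
      mul_le_mul_of_nonneg_right (Finset.single_le_sum (fun q _ => hC q) p.2)
        (formInner_self_nonneg _)
    exact ⟨h.1.trans hCp, h.2.trans (mul_le_mul_of_nonneg_right hCp (by positivity))⟩

/-- The first and second variation of `‖φ_t^* z‖²` along the flow of a gradient field. -/
lemma exists_variation (hX : IsGradientField X) (hz : IsL2Form z)
    (v : ∀ x : M, OrthonormalBasis (Fin n) ℝ (TangentSpace (𝓡 n) x)) :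
    (Integrable (density z fun x => symOp X x (v x)) (riemVolume n M) ∧
      Integrable (density z fun x => secondVarOp₁ X x (v x)) (riemVolume n M)) ∧
    (IsGradientFlowMinimal z →
      ∫ x, density z (fun x => symOp X x (v x)) x ∂(riemVolume n M) = 0 ∧
      0 ≤ ∫ x, density z (fun x => secondVarOp₁ X x (v x)) x ∂(riemVolume n M)) := by
  obtain ⟨φ, hφ⟩ := (exists_flow hX.isSmoothField).1
  obtain ⟨C, ε, hε, hd, h⟩ := exists_expansion hX hz v hφ
  obtain ⟨h1, h2, h3⟩ := integrable_of_expansion hz.2 hε (fun t ht => (h t ht).1)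
    (fun t ht y => ((h t ht).2 y).1) fun t ht y => ((h t ht).2 y).2
  refine ⟨⟨?_, h2⟩, fun hmin => ?_⟩
  · simpa using h1.neg
  · have h4 := IsLocalMin.of_expansion (hmin X hX φ hφ) hε
      (x := ∫ x, density z (fun x => symOp X x (v x)) x ∂(riemVolume n M))
      (y := ∫ x, density z (fun x => secondVarOp₁ X x (v x)) x ∂(riemVolume n M))
      (K := ∫ y, C * formInner (z y) (z y) ∂riemVolume n M) fun t ht => by
        -- The integral at time `-t` is `‖φ_t^* z‖²`. The two sign changes cancel, so the linear
        -- coefficient becomes `+∫ density` of `symOp`.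
        have h5 := h3 (-t) (neg_mem_Ioo ht)
        rw [← normSq_pullback_eq hX.isSmoothField hφ hd (neg_mem_Ioo ht),
          ← normSq_pullback_eq hX.isSmoothField hφ hd ⟨neg_lt_zero.2 hε, hε⟩, neg_neg, neg_zero,
          integral_neg, abs_neg, neg_sq, neg_mul_neg] at h5
        exact h5
    exact h4

end Global

/-! ### Forms of top degree -/

section TopDegree

variable {V : Type*} [NormedAddCommGroup V] [InnerProductSpace ℝ V] {n : ℕ}

lemma topForm_apply_comp (b : Module.Basis (Fin n) ℝ V) (α : V [⋀^Fin n]→ₗ[ℝ] ℝ) (L : V →ₗ[ℝ] V)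
    (u : Fin n → V) : α (L ∘ u) = LinearMap.det L * α u := by
  rw [α.eq_smul_basis_det b]
  simp only [AlternatingMap.smul_apply, Module.Basis.det_comp, smul_eq_mul]
  ring

variable [FiniteDimensional ℝ V]

/-- For fixed `I` the sum over `J` expands `α` on the images of the basis vectors under `Kᵀ`, and a
top form is scaled by the determinant. -/
lemma gramForm_topForm (b : Module.Basis (Fin n) ℝ V) (α : V [⋀^Fin n]→ₗ[ℝ] ℝ)
    (K : Matrix (Fin n) (Fin n) ℝ) :
    gramForm n K (comps b α) (comps b α) = K.det * gramForm n 1 (comps b α) (comps b α) := by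
  rw [gramForm_one, gramForm, mul_left_comm]
  congr 1
  rw [Finset.mul_sum]
  refine Finset.sum_congr rfl fun I _ => ?_
  have h1 := multilinear_apply_sum α b K.transpose I
  have h2 : (fun a => ∑ i, K.transpose i (I a) • b i) =
      Matrix.toLin b b K.transpose ∘ fun a => b (I a) := by
    funext a
    rw [Function.comp_apply, Matrix.toLin_self]
  rw [h2, topForm_apply_comp b, LinearMap.det_toLin, Matrix.det_transpose] at h1
  calc ∑ J, (∏ a, K (I a) (J a)) * (comps b α I * comps b α J)
      = comps b α I * ∑ J : Fin n → Fin n, (∏ a, K.transpose (J a) (I a)) * α fun a => b (J a) := by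
        rw [Finset.mul_sum]
        exact Finset.sum_congr rfl fun J _ => mul_left_comm _ _ _
    _ = K.det * (comps b α I * comps b α I) := by
        rw [← h1]
        exact mul_left_comm _ _ _

/-- Components vanish unless `I` is a permutation. Then `j` occupies exactly one slot, and replacing
it there by some `m ≠ j` repeats `m` and gives zero. -/
lemma contr_topForm (v : OrthonormalBasis (Fin n) ℝ V) (α : V [⋀^Fin n]→ₗ[ℝ] ℝ) (j m : Fin n) :
    contr (comps v α) j m = if j = m then formInner α α else 0 := by
  have h0 : ∀ I : Fin n → Fin n, ¬ Function.Injective I → comps v α I = 0 := fun I hI =>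
    α.map_eq_zero_of_not_injective _ fun h => hI fun a b hab => h (congrArg v hab)
  rw [formInner_comps v, ← mul_ite_zero, contr]
  congr 1
  split_ifs with hjm
  · subst hjm
    refine Finset.sum_congr rfl fun I _ => ?_
    by_cases hI : Function.Injective I
    · obtain ⟨a, rfl⟩ := (Finite.injective_iff_surjective.1 hI) j
      rw [Finset.sum_eq_single a]
      · simp
      · intro b _ hb
        rw [if_neg fun h => hb (hI h)]
      · simp
    · simp [h0 I hI]
  · refine Finset.sum_eq_zero fun I _ => Finset.sum_eq_zero fun a _ => ?_
    split_ifs with ha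
    · by_cases hI : Function.Injective I
      · obtain ⟨b, hb⟩ := (Finite.injective_iff_surjective.1 hI) m
        have hba : b ≠ a := by
          rintro rfl
          exact hjm (ha.symm.trans hb)
        rw [h0 (Function.update I a m), mul_zero]
        intro h
        refine hba (h ?_)
        rw [Function.update_of_ne hba, Function.update_self, hb]
      · rw [h0 I hI, zero_mul]
    · rfl

end TopDegree

/-! ### Minimality in top degree; the integral formulas -/

section Global

variable {n : ℕ} {M : Type*} [TopologicalSpace M] [T2Space M] [CompactSpace M]
  [ChartedSpace (EuclideanSpace ℝ (Fin n)) M]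
  [IsManifold (𝓡 n) ∞ M]
  [RiemannianBundle (fun x : M => TangentSpace (𝓡 n) x)]
  [IsContMDiffRiemannianBundle (𝓡 n) ∞ (EuclideanSpace ℝ (Fin n))
    (fun x : M => TangentSpace (𝓡 n) x)]
variable {X : ∀ x : M, TangentSpace (𝓡 n) x} {φ : ℝ → M → M} {t ε : ℝ}

/-- In top degree `|φ_{-t}^* z|²` is multiplied by `det Γ⁻¹ = J⁻²`, and one factor `J` comes from
the change of variables. -/
lemma transported_topForm {z : DiffForm n n M} (hz : ∀ x, formInner (z x) (z x) = 1)
    (hX : IsSmoothField X) (hφ : IsFlow X φ) (hd : IsFlowTime (n := n) φ ε)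
    (ht : t ∈ Set.Ioo (-ε) ε) (y : M) :
    transported z φ t y = (jac (mfderiv (𝓡 n) (𝓡 n) (φ t) y).toLinearMap)⁻¹ := by
  let v : OrthonormalBasis (Fin n) ℝ (TangentSpace (𝓡 n) y) :=
    (stdOrthonormalBasis ℝ (TangentSpace (𝓡 n) y)).reindex (finCongr (finrank_tangentSpace y))
  have hv : (Matrix.of fun i j => (inner ℝ (v.toBasis i) (v.toBasis j) : ℝ)) = 1 := by
    ext i j
    simp [Matrix.one_apply, orthonormal_iff_ite.1 v.orthonormal]
  have h1 := sqrt_det_gram_map v.toBasis (mfderiv (𝓡 n) (𝓡 n) (φ t) y).toLinearMap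
  have h2 := transported_mul_sqrt_det (z := z) v.toBasis (hφ.neg_comp hX t) (hd t ht y).1
    (hd (-t) (neg_mem_Ioo ht) _).1 (Γ := Matrix.of fun i j =>
      (inner ℝ (mfderiv (𝓡 n) (𝓡 n) (φ t) y (v.toBasis i))
        (mfderiv (𝓡 n) (𝓡 n) (φ t) y (v.toBasis j)) : ℝ)) fun _ _ => rfl
  have hJ := (hd t ht y).2.2
  rw [hv, Matrix.det_one, Real.sqrt_one, mul_one] at h1 h2
  have h3 : gramForm n 1 (comps v.toBasis (z y)) (comps v.toBasis (z y)) = 1 := by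
    rw [gramForm_one]
    exact (formInner_comps v (z y) (z y)).symm.trans (hz y)
  set J := jac (mfderiv (𝓡 n) (𝓡 n) (φ t) y).toLinearMap
  set Γ := Matrix.of fun i j => (inner ℝ (mfderiv (𝓡 n) (𝓡 n) (φ t) y (v.toBasis i))
        (mfderiv (𝓡 n) (𝓡 n) (φ t) y (v.toBasis j)) : ℝ)
  have h4 : Real.sqrt Γ.det = J := h1
  have h5 : Γ.det = J ^ 2 := by
    rw [← h4, Real.sq_sqrt]
    by_contra h
    rw [Real.sqrt_eq_zero'.2 (not_le.1 h).le] at h4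
    exact hJ.ne h4
  rw [h2, h4, gramForm_topForm, Matrix.det_nonsing_inv, Ring.inverse_eq_inv', h5, h3]
  field_simp

variable [MeasurableSpace M] [BorelSpace M]

/-- The norm of the pulled back form is `∫ 1/J`, the total volume is `∫ J`, and `1/J ≥ 2 - J`. Hence
the integral of `1/J` is at least the total volume, the value at time zero. -/
lemma isGradientFlowMinimal_topForm {z : DiffForm n n M} (hL : IsL2Form z)
    (hz : ∀ x, formInner (z x) (z x) = 1) : IsGradientFlowMinimal z := by
  intro X hX φ hφ
  have hs := hX.isSmoothField
  obtain ⟨-, ε, hε, h⟩ := exists_flow hs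
  have hd := h φ hφ
  have h0 : (0 : ℝ) ∈ Set.Ioo (-ε) ε := ⟨neg_lt_zero.2 hε, hε⟩
  -- Finiteness of the volume is read off from the square integrability of `z` together with `|z| =
  -- 1`.
  have hint : Integrable (fun _ : M => (1 : ℝ)) (riemVolume n M) := by
    simpa only [hz] using hL.2
  have hfin : IsFiniteMeasure (riemVolume n M) := by
    simpa [integrable_const_iff] using hint
  have hvol : normSq (pullback (φ 0) z) = ∫ _ : M, (1 : ℝ) ∂riemVolume n M := by
    have h := normSq_pullback_eq (z := z) hs hφ hd h0
    rw [neg_zero] at h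
    simpa only [transported_zero hφ, hz] using h
  have hI : Set.Ioo (-ε) ε ∈ 𝓝 (0 : ℝ) := isOpen_Ioo.mem_nhds h0
  filter_upwards [hI] with t ht'
  have ht := neg_mem_Ioo ht'
  have hc : Continuous fun y => jac (mfderiv (𝓡 n) (𝓡 n) (φ (-t)) y).toLinearMap :=
    continuous_iff_continuousAt.2 fun y => (hd _ ht y).2.1
  have hi : ∀ f : M → ℝ, Continuous f → Integrable f (riemVolume n M) := fun f hf =>
    hf.integrable_of_hasCompactSupport (HasCompactSupport.of_compactSpace f)
  have hJ := hi _ hc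
  have hJ' := hi _ (hc.inv₀ fun y => (hd _ ht y).2.2.ne')
  have h1 := integral_comp_mul_jac_flow hs hφ hd ht fun _ => 1
  have h2 := normSq_pullback_eq (z := z) hs hφ hd ht
  simp only [mul_one] at h1
  simp only [neg_neg, transported_topForm hz hs hφ hd ht] at h2
  rw [hvol, h2]
  have h3 : ∫ y, (2 * 1 - jac (mfderiv (𝓡 n) (𝓡 n) (φ (-t)) y).toLinearMap) ∂riemVolume n M ≤
      ∫ y, (jac (mfderiv (𝓡 n) (𝓡 n) (φ (-t)) y).toLinearMap)⁻¹ ∂riemVolume n M := by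
    refine integral_mono ((hint.const_mul 2).sub hJ) hJ' fun y => ?_
    have hp := (hd _ ht y).2.2
    change 2 * 1 - _ ≤ _
    rw [inv_eq_one_div, le_div_iff₀ hp]
    nlinarith [sq_nonneg (jac (mfderiv (𝓡 n) (𝓡 n) (φ (-t)) y).toLinearMap - 1)]
  rw [integral_sub (hint.const_mul 2) hJ, integral_const_mul, ← h1] at h3
  linarith

variable {k : ℕ} {z : DiffForm n k M}

/-- The extra summand relative to the first operator is the first variation along the gradient field
`∇_X X`; by minimality its integral is zero. -/
lemma integrable_second_variation (hL : IsL2Form z) (hmin : IsGradientFlowMinimal z)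
    (hX : IsGradientField X)
    (v : ∀ x : M, OrthonormalBasis (Fin n) ℝ (TangentSpace (𝓡 n) x)) :
    Integrable (density z fun x => secondVarOp₂ X x (v x)) (riemVolume n M) ∧
      0 ≤ ∫ x, density z (fun x => secondVarOp₂ X x (v x)) x ∂(riemVolume n M) := by
  obtain ⟨⟨-, h2⟩, h⟩ := exists_variation hX hL v
  obtain ⟨⟨h3, -⟩, h'⟩ := exists_variation hX.nabla_self hL v
  have e : (density z fun x => secondVarOp₂ X x (v x)) = fun x =>
      density z (fun x => secondVarOp₁ X x (v x)) x +
        density z (fun x => symOp (fun y => nabla X y (X y)) x (v x)) x :=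
    funext fun x => density_secondVarOp₂ z hX.isSmoothField v x
  rw [e, integral_add h2 h3, (h' hmin).1, add_zero]
  exact ⟨h2.add h3, (h hmin).2⟩

/-- Since `secondVarOp₁` vanishes, the whole integrand is the first variation along `∇_X X`, which
is a gradient field although `X` need not be one. -/
lemma IsKillingField.integral_density_eq_zero (hL : IsL2Form z) (hmin : IsGradientFlowMinimal z)
    (hX : IsKillingField X)
    (v : ∀ x : M, OrthonormalBasis (Fin n) ℝ (TangentSpace (𝓡 n) x)) :
    Integrable (density z fun x => secondVarOp₂ X x (v x)) (riemVolume n M) ∧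
      0 = ∫ x, density z (fun x => secondVarOp₂ X x (v x)) x ∂(riemVolume n M) := by
  obtain ⟨⟨h3, -⟩, h'⟩ := exists_variation hX.nabla_self hL v
  have e : (density z fun x => secondVarOp₂ X x (v x)) = fun x =>
      density z (fun x => symOp (fun y => nabla X y (X y)) x (v x)) x :=
    funext fun x => IsKillingField.density_secondVarOp₂ z hX v x
  rw [e]
  exact ⟨h3, (h' hmin).1.symm⟩

lemma IsKillingField.integral_bochnerTerm_eq_zero (hL : IsL2Form z)
    (hmin : IsGradientFlowMinimal z) (hX : IsKillingField X)
    (v : ∀ x : M, OrthonormalBasis (Fin n) ℝ (TangentSpace (𝓡 n) x))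
    (hv : ∀ x, ∀ j m, j ≠ m → intInner z x (v x j) (v x m) = 0) :
    Integrable (fun x => ∑ j, bochnerTerm X x (v x j) *
        (2 * intInner z x (v x j) (v x j) - formInner (z x) (z x))) (riemVolume n M) ∧
      0 = ∫ x, ∑ j, bochnerTerm X x (v x j) *
        (2 * intInner z x (v x j) (v x j) - formInner (z x) (z x)) ∂(riemVolume n M) := by
  obtain ⟨h1, h2⟩ := hX.integral_density_eq_zero hL hmin v
  have e : (fun x => ∑ j, bochnerTerm X x (v x j) *
      (2 * intInner z x (v x j) (v x j) - formInner (z x) (z x))) = fun x =>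
        -density z (fun x => secondVarOp₂ X x (v x)) x := funext fun x => by
    rw [IsKillingField.density_eq_sum_bochnerTerm z hX v x (hv x), neg_neg]
  rw [e, integral_neg, ← h2, neg_zero]
  exact ⟨h1.neg, rfl⟩

lemma intInner_topForm {z : DiffForm n n M} (hz : ∀ x, formInner (z x) (z x) = 1)
    (v : ∀ x : M, OrthonormalBasis (Fin n) ℝ (TangentSpace (𝓡 n) x)) (x : M) (j m : Fin n) :
    intInner z x (v x j) (v x m) = if j = m then 1 else 0 := by
  rw [intInner, formsInner_intMul, contr_topForm, hz]

end Global

end SecondVariation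

end
theorem mainTheorem6 {n : ℕ} {M : Type*} [TopologicalSpace M] [T2Space M] [CompactSpace M]
    [ChartedSpace (EuclideanSpace ℝ (Fin n)) M] [IsManifold (𝓡 n) ∞ M]
    [RiemannianBundle (fun x : M => TangentSpace (𝓡 n) x)]
    [IsContMDiffRiemannianBundle (𝓡 n) ∞ (EuclideanSpace ℝ (Fin n))
      (fun x : M => TangentSpace (𝓡 n) x)]
    [MeasurableSpace M] [BorelSpace M]
    {k : ℕ} (z : DiffForm n k M) (hz : IsL2Form z) :
    (IsGradientFlowMinimal z →
      (∀ X : ∀ x : M, TangentSpace (𝓡 n) x, IsGradientField X →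
        ∀ v : ∀ x : M, OrthonormalBasis (Fin n) ℝ (TangentSpace (𝓡 n) x),
          (Integrable (density z fun x => secondVarOp₁ X x (v x)) (riemVolume n M) ∧
            0 ≤ ∫ x, density z (fun x => secondVarOp₁ X x (v x)) x ∂(riemVolume n M)) ∧
          (Integrable (density z fun x => secondVarOp₂ X x (v x)) (riemVolume n M) ∧
            0 ≤ ∫ x, density z (fun x => secondVarOp₂ X x (v x)) x ∂(riemVolume n M))) ∧
      (∀ X : ∀ x : M, TangentSpace (𝓡 n) x, IsKillingField X →
        ∀ v : ∀ x : M, OrthonormalBasis (Fin n) ℝ (TangentSpace (𝓡 n) x),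
          (Integrable (density z fun x => secondVarOp₂ X x (v x)) (riemVolume n M) ∧
            0 = ∫ x, density z (fun x => secondVarOp₂ X x (v x)) x ∂(riemVolume n M)) ∧
          ((∀ x, ∀ j m, j ≠ m → intInner z x (v x j) (v x m) = 0) →
            Integrable (fun x => ∑ j, bochnerTerm X x (v x j) *
                (2 * intInner z x (v x j) (v x j) - formInner (z x) (z x))) (riemVolume n M) ∧
            0 = ∫ x, ∑ j, bochnerTerm X x (v x j) *
                (2 * intInner z x (v x j) (v x j) - formInner (z x) (z x))
              ∂(riemVolume n M)))) ∧
    (k = n → (∀ x, formInner (z x) (z x) = 1) →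
      IsGradientFlowMinimal z ∧
      ∀ X : ∀ x : M, TangentSpace (𝓡 n) x, IsKillingField X →
        ∀ v : ∀ x : M, OrthonormalBasis (Fin n) ℝ (TangentSpace (𝓡 n) x),
          Integrable (fun x => ∑ j, bochnerTerm X x (v x j)) (riemVolume n M) ∧
          0 = ∫ x, ∑ j, bochnerTerm X x (v x j) ∂(riemVolume n M)) := by
  refine ⟨fun hmin => ⟨fun X hX v => ⟨⟨(exists_variation hX hz v).1.2,
    ((exists_variation hX hz v).2 hmin).2⟩, integrable_second_variation hz hmin hX v⟩,
    fun X hX v => ⟨hX.integral_density_eq_zero hz hmin v,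
      hX.integral_bochnerTerm_eq_zero hz hmin v⟩⟩, ?_⟩
  rintro rfl hz1
  have hmin := isGradientFlowMinimal_topForm hz hz1
  refine ⟨hmin, fun X hX v => ?_⟩
  have h := hX.integral_bochnerTerm_eq_zero hz hmin v fun x j m hjm => by
    rw [intInner_topForm hz1, if_neg hjm]
  have e : ∀ x, ∑ j, bochnerTerm X x (v x j) *
      (2 * intInner z x (v x j) (v x j) - formInner (z x) (z x)) =
        ∑ j, bochnerTerm X x (v x j) := fun x => Finset.sum_congr rfl fun j _ => by
    rw [intInner_topForm hz1, if_pos rfl, hz1]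
    norm_num
  simpa only [e] using h
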